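/- Let $A\in\mathbb R^{n\times n}$ and let $F\subseteq\{1,\dots,n\}$ be a set of forbidden variables. The system $\dot x=Ax+Bu$ is structurally controllable if there are matrices $A',B'$ of the same dimensions, with $A'_{ij}=0$ whenever $A_{ij}=0$ and $B'_{ij}=0$ whenever $B_{ij}=0$, such that $\dot x=A'x+B'u$ is controllable (every state can be steered to every other state in finite time). Call $I\subseteq\{1,\dots,n\}$ feasible if $I\cap F=\emptyset$ and $\dot x=Ax+B(I)u$ is structurally controllable for some diagonal matrix $B(I)$ with $B_{ii}(I)\ne0$ if and only if $i\in I$. The minimum structural controllability problem asks for a feasible set $I$ of minimum cardinality; it is solvable if such a set exists. Let $I^*$ be this minimum cardinality ($+\infty$ if there is no feasible set). Let $G(A)$ be the directed graph on $\{1,\dots,n\}$ with edge set $\{(i,j): A_{ji}\neq0\}$. A matching $M$ in $G(A)$ is a set of edges no two of which share a source or share a destination; a vertex is unmatched in $M$ if it is not the destination of an edge of $M$; $M$ is allowed if no vertex of $F$ is unmatched. A source strongly connected component is a strongly connected component that no edge enters from another component. The cost of $M$ is the number of unmatched vertices plus the number of source strongly connected components without an unmatched vertex. Let $c^*$ be the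 minimum cost of an allowed matching ($+\infty$ if there is none). Assume that no vertex of $G(A)$ is isolated (every vertex has an incoming or an outgoing edge, possibly a loop), and let $m$ be the number of nonzero entries of $A$. Then: (a) The minimum structural controllability problem is solvable if and only if (1) $G(A)$ has an allowed matching, and (2) every source strongly connected component of $G(A)$ contains a vertex outside $F$. (b) If (2) holds, then $I^*=c^*$. (c) There is an algorithm in the unit-cost RAM model (the same for all $n,A,F$) which, whenever the problem is solvable, computes an optimal set $I$ from any minimum cost allowed matching in $G(A)$ in $O(m)$ operations, with an absolute constant (for $n=0$, where $m=0$, in $O(1)$ operations). Its input consists of $n$, a list of the positions of the nonzero entries of $A$, a list of the elements of $F$, a list of the edges of the matching, and the lengths of these lists; each list is without repetitions and in arbitrary order. -/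

import Mathlib

namespace MinStructControl

/-! ### Linear systems and structural controllability -/

/-- The linear system `x' = A x + B u` is controllable: any initial state can be steered to any
final state in some finite time by some (continuous) input. -/
def Controllable {n k : ℕ} (A : Matrix (Fin n) (Fin n) ℝ) (B : Matrix (Fin n) (Fin k) ℝ) : Prop :=
  ∀ x₀ x₁ : Fin n → ℝ, ∃ T : ℝ, 0 < T ∧ ∃ (u : ℝ → Fin k → ℝ) (x : ℝ → Fin n → ℝ),
    Continuous u ∧ x 0 = x₀ ∧ x T = x₁ ∧
    ∀ t ∈ Set.Icc 0 T,
      HasDerivWithinAt x (A.mulVec (x t) + B.mulVec (u t)) (Set.Icc 0 T) t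

/-- The zero pattern of a matrix: the set of positions of its zero entries. -/
def zeroPattern {n k : ℕ} (P : Matrix (Fin n) (Fin k) ℝ) : Set (Fin n × Fin k) :=
  {p | P p.1 p.2 = 0}

/-- Structural controllability of `x' = A x + B u`. -/
def StructurallyControllable {n k : ℕ}
    (A : Matrix (Fin n) (Fin n) ℝ) (B : Matrix (Fin n) (Fin k) ℝ) : Prop :=
  ∃ (A' : Matrix (Fin n) (Fin n) ℝ) (B' : Matrix (Fin n) (Fin k) ℝ),
    zeroPattern A ⊆ zeroPattern A' ∧ zeroPattern B ⊆ zeroPattern B' ∧ Controllable A' B'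

/-! ### The minimum structural controllability problem -/

/-- `I` is an admissible choice of input variables: it avoids the forbidden set `F`, and
`x' = A x + B u` is structurally controllable for some diagonal `B` whose nonzero diagonal
entries are exactly those indexed by `I`. -/
def IsFeasible {n : ℕ} (A : Matrix (Fin n) (Fin n) ℝ) (F I : Finset (Fin n)) : Prop :=
  Disjoint I F ∧ ∃ B : Matrix (Fin n) (Fin n) ℝ,
    B.IsDiag ∧ (∀ i, B i i ≠ 0 ↔ i ∈ I) ∧ StructurallyControllable A B

/-- `I` solves the minimum structural controllability problem. -/
def IsOptimal {n : ℕ} (A : Matrix (Fin n) (Fin n) ℝ) (F I : Finset (Fin n)) : Prop :=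
  IsFeasible A F I ∧ ∀ J : Finset (Fin n), IsFeasible A F J → I.card ≤ J.card

/-- The minimum structural controllability problem has a solution. -/
def ProblemSolvable {n : ℕ} (A : Matrix (Fin n) (Fin n) ℝ) (F : Finset (Fin n)) : Prop :=
  ∃ I : Finset (Fin n), IsOptimal A F I

/-- The smallest cardinality of an admissible set of input variables (`⊤` if there is none). -/
noncomputable def optimalValue {n : ℕ} (A : Matrix (Fin n) (Fin n) ℝ) (F : Finset (Fin n)) : ℕ∞ :=
  ⨅ (I : Finset (Fin n)) (_ : IsFeasible A F I), (I.card : ℕ∞)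

/-! ### Directed graphs, strongly connected components, matchings -/

/-- The adjacency graph `G(A)`, with an edge from `i` to `j` iff `A j i ≠ 0`. -/
def adjacencyGraph {n : ℕ} (A : Matrix (Fin n) (Fin n) ℝ) : Digraph (Fin n) where
  Adj i j := A j i ≠ 0

/-- A vertex without incoming and without outgoing edges (a loop counts as both). -/
def IsIsolated {V : Type*} (G : Digraph V) (v : V) : Prop :=
  ∀ w, ¬ G.Adj v w ∧ ¬ G.Adj w v

/-- Mutual reachability by directed paths. -/
def stronglyConnected {V : Type*} (G : Digraph V) : Setoid V where
  r u v := Relation.ReflTransGen G.Adj u v ∧ Relation.ReflTransGen G.Adj v u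
  iseqv := ⟨fun _ => ⟨.refl, .refl⟩, fun h => ⟨h.2, h.1⟩,
    fun h k => ⟨h.1.trans k.1, k.2.trans h.2⟩⟩

/-- The type of strongly connected components. -/
abbrev SCC {V : Type*} (G : Digraph V) : Type _ := Quotient (stronglyConnected G)

/-- The strongly connected component of a vertex. -/
def sccOf {V : Type*} (G : Digraph V) (v : V) : SCC G := Quotient.mk (stronglyConnected G) v

/-- The condensation: strongly connected components are collapsed, loops are discarded. -/
def condensation {V : Type*} (G : Digraph V) : Digraph (SCC G) where
  Adj c d := c ≠ d ∧ ∃ u v, sccOf G u = c ∧ sccOf G v = d ∧ G.Adj u v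

/-- A source vertex is a vertex without incoming edges. -/
def IsSourceVertex {V : Type*} (G : Digraph V) (v : V) : Prop := ∀ w, ¬ G.Adj w v

/-- A source strongly connected component. -/
def IsSourceSCC {V : Type*} (G : Digraph V) (c : SCC G) : Prop :=
  IsSourceVertex (condensation G) c

/-- A matching in a directed graph: a set of edges `(u, v)` no two of which have a common source
or a common destination. -/
def IsMatching {V : Type*} (G : Digraph V) (M : Finset (V × V)) : Prop :=
  (∀ e ∈ M, G.Adj e.1 e.2) ∧
    ∀ e ∈ M, ∀ f ∈ M, e ≠ f → e.1 ≠ f.1 ∧ e.2 ≠ f.2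

/-- The vertices that are not the destination of an edge of `M`. -/
def unmatched {V : Type*} (M : Finset (V × V)) : Set V := {v | ∀ e ∈ M, e.2 ≠ v}

/-- An allowed matching leaves no vertex of `F` unmatched. -/
def IsAllowedMatching {V : Type*} (G : Digraph V) (F : Finset V) (M : Finset (V × V)) : Prop :=
  IsMatching G M ∧ unmatched M ∩ (F : Set V) = ∅

/-- The number of unmatched vertices plus the number of source strongly connected components
without an unmatched vertex. -/
noncomputable def matchingCost {V : Type*} (G : Digraph V) (M : Finset (V × V)) : ℕ :=
  (unmatched M).ncard + {c : SCC G | IsSourceSCC G c ∧ ∀ v ∈ unmatched M, sccOf G v ≠ c}.ncard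

/-- A minimum cost allowed matching. -/
def IsMinCostAllowedMatching {V : Type*} (G : Digraph V) (F : Finset V)
    (M : Finset (V × V)) : Prop :=
  IsAllowedMatching G F M ∧
    ∀ N : Finset (V × V), IsAllowedMatching G F N → matchingCost G M ≤ matchingCost G N

/-- The smallest cost of an allowed matching (`⊤` if there is none). -/
noncomputable def minMatchingCost {V : Type*} (G : Digraph V) (F : Finset V) : ℕ∞ :=
  ⨅ (M : Finset (V × V)) (_ : IsAllowedMatching G F M), (matchingCost G M : ℕ∞)

/-! ### The unit-cost random access machine -/

/-- Instructions of a random access machine with memory cells `0, 1, 2, …` holding natural numbers,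
a read-only input tape and a write-only output tape. Below, `[a]` is the content of cell `a`. -/
inductive Instr where
  /-- `[a] := k` -/
  | const (a k : ℕ)
  /-- `[a] := [b]` -/
  | copy (a b : ℕ)
  /-- `[a] := [b] + [c]` -/
  | add (a b c : ℕ)
  /-- `[a] := max ([b] - [c]) 0` -/
  | sub (a b c : ℕ)
  /-- `[a] := [[b]]` -/
  | load (a b : ℕ)
  /-- `[[a]] := [b]` -/
  | store (a b : ℕ)
  /-- `[a] :=` the next number on the input tape (`0` when the input is exhausted) -/
  | read (a : ℕ)
  /-- append `[a]` to the output tape -/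
  | write (a : ℕ)
  /-- continue with instruction number `l` -/
  | jump (l : ℕ)
  /-- continue with instruction number `l` if `[a] = 0` -/
  | jumpZero (a l : ℕ)
  /-- stop -/
  | halt

/-- A configuration: program counter, memory, unread input, output written so far. -/
structure Config where
  pc : ℕ
  mem : ℕ → ℕ
  input : List ℕ
  output : List ℕ

/-- The configuration `c` after storing `k` in cell `a` and advancing the program counter. -/
def Config.put (c : Config) (a k : ℕ) : Config :=
  { c with pc := c.pc + 1, mem := Function.update c.mem a k }

/-- The effect of a single instruction; `none` means that the machine stops. -/
def Instr.exec : Instr → Config → Option Config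
  | .const a k, c => some (c.put a k)
  | .copy a b, c => some (c.put a (c.mem b))
  | .add a b d, c => some (c.put a (c.mem b + c.mem d))
  | .sub a b d, c => some (c.put a (c.mem b - c.mem d))
  | .load a b, c => some (c.put a (c.mem (c.mem b)))
  | .store a b, c => some (c.put (c.mem a) (c.mem b))
  | .read a, c => some { c.put a (c.input.headD 0) with input := c.input.tail }
  | .write a, c => some { c with pc := c.pc + 1, output := c.output ++ [c.mem a] }
  | .jump l, c => some { c with pc := l }
  | .jumpZero a l, c => some { c with pc := if c.mem a = 0 then l else c.pc + 1 }
  | .halt, _ => none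

/-- One step of the program `P`; the machine also stops when the program counter leaves `P`. -/
def step (P : List Instr) (c : Config) : Option Config :=
  P[c.pc]?.bind fun i => i.exec c

/-- The program `P` leads from one configuration to another in exactly `t` steps. -/
def Reaches (P : List Instr) : ℕ → Config → Config → Prop
  | 0, c, d => c = d
  | t + 1, c, d => ∃ c', step P c = some c' ∧ Reaches P t c' d

/-- The initial configuration: all memory cells are `0`. -/
def initConfig (input : List ℕ) : Config := ⟨0, fun _ => 0, input, []⟩

/-- On the given input, the program `P` stops after exactly `t` steps, having written the given
output. Every instruction costs one step. -/
def HaltsWith (P : List Instr) (input : List ℕ) (t : ℕ) (output : List ℕ) : Prop :=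
  ∃ c, Reaches P t (initConfig input) c ∧ step P c = none ∧ c.output = output

/-! ### The input of the recovery problem -/

/-- The number `m` of nonzero entries of `A`. -/
noncomputable def numNonzero {n : ℕ} (A : Matrix (Fin n) (Fin n) ℝ) : ℕ :=
  {p : Fin n × Fin n | A p.1 p.2 ≠ 0}.ncard

/-- `l` lists every element of `s` exactly once, in an arbitrary order. -/
def IsListing {α : Type*} (l : List α) (s : Set α) : Prop :=
  l.Nodup ∧ ∀ a, a ∈ l ↔ a ∈ s

/-- A list of pairs, written out as a list of numbers. -/
def flattenPairs {n : ℕ} (l : List (Fin n × Fin n)) : List ℕ :=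
  l.flatMap fun p => [(p.1 : ℕ), (p.2 : ℕ)]

/-- The input tape: the dimension and the lengths of three lists, followed by these lists: the
positions `(i, j)` with `A i j ≠ 0`, the forbidden variables, and the edges of a matching. -/
def encodeInput {n : ℕ} (entries : List (Fin n × Fin n)) (forbidden : List (Fin n))
    (matching : List (Fin n × Fin n)) : List ℕ :=
  [n, entries.length, forbidden.length, matching.length] ++
    flattenPairs entries ++ forbidden.map Fin.val ++ flattenPairs matching

end MinStructControl

open MinStructControl

namespace MinStructControl

/-! ### Controllability of linear systems -/

section Controllability

open Matrix NormedSpace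

attribute [local instance] Matrix.linftyOpNormedRing Matrix.linftyOpNormedAlgebra

/-! Feasibility is a combinatorial condition: a set `I` disjoint from `F` is feasible exactly when
some matching of `G(A)` leaves only vertices of `I` unmatched and every vertex can be reached from
`I`; the latter says that `I` meets every source component.

Necessity (`IsFeasible.exists_matching`, `IsFeasible.reaches`): controllability of `(A', B')` makes
the rows of `[A' B']` independent, so Hall's theorem picks a nonzero entry in each row, in distinct
columns. The entries picked in `A'` form a matching, and the rows served by `B'` lie in `I`.
Moreover, a set of states with no influence from outside, started at zero, stays at zero, so no
vertex is out of reach of `I`.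

Sufficiency (`isFeasible_of_matching`): complete the matching to a permutation `σ` of the vertices.
Its edges run in the graph or end in `I`. Take up its cycles one at a time, each entered at a vertex
of `I` or through one edge from the part already treated, and give each a larger weight than all
earlier ones. A cycle of weight `w` supports eigenvectors only at frequencies of modulus `w`, so
different cycles do not interfere and no left eigenvector vanishes on `I` (`Observes.extend`). The
Popov–Belevitch–Hautus test, derived here from the Gramian, then gives controllability.

Parts (a) and (b) follow by counting. If `I` is feasible with matching `M`, each source component
without an unmatched vertex contains an element of `I` that is matched, so the cost of `M` is at
most `|I|`. Conversely, the unmatched vertices of an allowed matching together with one vertex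
outside `F` for each remaining source component form a feasible set no larger than the cost.

For (c) no strongly connected components are computed. An auxiliary vertex `n` gets an edge to every
unmatched vertex. A pass of graph searches through `n` and the vertices outside `F` keeps those not
reachable from an earlier entry, and a second pass does the same to the kept list in reverse order,
again with `n` in front. What remains, apart from `n`, is an antichain for reachability, is not
reachable from any unmatched vertex, and together with `n` reaches every vertex outside `F`
(`roots_reverse_roots`). These properties force one vertex in each source component without an
unmatched vertex and no others (`isOptimal_union`). Marks persist during a pass, so its cost is
linear in vertices and edges. The absence of isolated vertices gives `n ≤ 2m`. The running time is
proved for a small structured language with a compiler to the machine, by a program logic with time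
credits. -/

theorem hasDerivAt_mulVec {n : ℕ} {M : ℝ → Matrix (Fin n) (Fin n) ℝ}
    {M' : Matrix (Fin n) (Fin n) ℝ} {v : ℝ → Fin n → ℝ} {v' : Fin n → ℝ} {t : ℝ}
    (hM : HasDerivAt M M' t) (hv : HasDerivAt v v' t) :
    HasDerivAt (fun s => M s *ᵥ v s) (M' *ᵥ v t + M t *ᵥ v') t := by
  rw [hasDerivAt_pi] at hv ⊢
  intro i
  have hent : ∀ j, HasDerivAt (fun s => M s i j) (M' i j) t := fun j =>
    ((Matrix.entryLinearMap ℝ ℝ i j).toContinuousLinearMap.hasFDerivAt (x := M t)).comp_hasDerivAt t hM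
  have := HasDerivAt.fun_sum (u := Finset.univ) fun j _ => (hent j).mul (hv j)
  simpa [Matrix.mulVec, dotProduct, Finset.sum_add_distrib] using this

theorem hasDerivAt_exp_smul {n : ℕ} (A : Matrix (Fin n) (Fin n) ℝ) (t : ℝ) :
    HasDerivAt (fun s : ℝ => exp (s • A)) (A * exp (t • A)) t :=
  hasDerivAt_exp_smul_const' A t

theorem exp_smul_mul_exp_neg_smul {n : ℕ} (A : Matrix (Fin n) (Fin n) ℝ) (t : ℝ) :
    exp (t • A) * exp ((-t) • A) = 1 := by
  rw [neg_smul, ← Matrix.exp_add_of_commute _ _ (Commute.refl (t • A)).neg_right]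
  simp

/-- Reachability by polynomials in `A` implies controllability, by way of the Gramian. -/
theorem controllable_of_vecMul_pow {n k : ℕ} (A : Matrix (Fin n) (Fin n) ℝ)
    (B : Matrix (Fin n) (Fin k) ℝ)
    (h : ∀ q : Fin n → ℝ, (∀ j : ℕ, q ᵥ* (A ^ j * B) = 0) → q = 0) : Controllable A B := by
  have hE : ∀ t : ℝ, HasDerivAt (fun s : ℝ => exp ((-s) • A)) (-(A * exp ((-t) • A))) t := by
    intro t
    have := (hasDerivAt_exp_smul A (-t)).scomp t (hasDerivAt_neg t)
    exact this.congr_deriv (by simp)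
  have hEc : Continuous fun s : ℝ => exp ((-s) • A) :=
    continuous_iff_continuousAt.2 fun t => (hE t).continuousAt
  set G : ℝ → Matrix (Fin n) (Fin k) ℝ := fun s => exp ((-s) • A) * B with hG
  have hGc : Continuous G := hEc.matrix_mul continuous_const
  have hint : ∀ p : Fin n → ℝ, Continuous fun s => G s *ᵥ ((G s)ᵀ *ᵥ p) := fun p =>
    hGc.matrix_mulVec (hGc.matrix_transpose.matrix_mulVec continuous_const)
  let W : (Fin n → ℝ) →ₗ[ℝ] (Fin n → ℝ) :=
    { toFun := fun p => ∫ s in (0 : ℝ)..1, G s *ᵥ ((G s)ᵀ *ᵥ p)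
      map_add' := fun p q => by
        rw [← intervalIntegral.integral_add ((hint p).intervalIntegrable _ _)
          ((hint q).intervalIntegrable _ _)]
        simp [Matrix.mulVec_add]
      map_smul' := fun c p => by
        rw [RingHom.id_apply, ← intervalIntegral.integral_smul]
        simp [Matrix.mulVec_smul] }
  have hW : ∀ p, W p = ∫ s in (0 : ℝ)..1, G s *ᵥ ((G s)ᵀ *ᵥ p) := fun p => rfl
  have hinj : Function.Injective W := by
    rw [← LinearMap.ker_eq_bot, LinearMap.ker_eq_bot']
    intro p hp
    -- This integral is `p ⬝ᵥ W p`; its integrand is a sum of squares and therefore vanishes on the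
    -- interval.
    have hsq : ∫ s in (0 : ℝ)..1, (p ᵥ* G s) ⬝ᵥ (p ᵥ* G s) = 0 := by
      let L : (Fin n → ℝ) →L[ℝ] ℝ := (dotProductBilin ℝ ℝ p).toContinuousLinearMap
      have := L.intervalIntegral_comp_comm ((hint p).intervalIntegrable (μ := MeasureTheory.volume) 0 1)
      rw [← hW, hp, map_zero] at this
      rw [← this]
      congr 1
      ext s
      simp [L, dotProductBilin, Matrix.dotProduct_mulVec, Matrix.mulVec_transpose]
    have hcont : Continuous fun s => (p ᵥ* G s) ⬝ᵥ (p ᵥ* G s) := by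
      have h1 : Continuous fun s => p ᵥ* G s := continuous_const.matrix_vecMul hGc
      exact h1.dotProduct h1
    have hnn : ∀ s, 0 ≤ (p ᵥ* G s) ⬝ᵥ (p ᵥ* G s) := fun s => by
      simpa using dotProduct_star_self_nonneg (p ᵥ* G s)
    have hz : ∀ s ∈ Set.Ioo (0 : ℝ) 1, p ᵥ* G s = 0 := by
      intro s hs
      by_contra hne
      have hpos : 0 < (p ᵥ* G s) ⬝ᵥ (p ᵥ* G s) := by
        refine lt_of_le_of_ne (hnn s) fun h0 => hne ?_
        exact dotProduct_self_eq_zero.1 h0.symm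
      have := intervalIntegral.integral_pos (f := fun s => (p ᵥ* G s) ⬝ᵥ (p ᵥ* G s))
        (by norm_num : (0 : ℝ) < 1) hcont.continuousOn (fun x _ => hnn x)
        ⟨s, ⟨hs.1.le, hs.2.le⟩, hpos⟩
      exact this.ne' hsq
    -- Each differentiation of the vanishing function in `s` brings down one more factor `-A`.
    have hder : ∀ j : ℕ, ∀ s ∈ Set.Ioo (0 : ℝ) 1, p ᵥ* (A ^ j * exp ((-s) • A) * B) = 0 := by
      intro j
      induction j with
      | zero => intro s hs; simpa [hG] using hz s hs
      | succ j ih =>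
        intro s hs
        ext l
        have h1 : HasDerivAt (fun t => exp ((-t) • A) *ᵥ (fun i => B i l))
            (-(A * exp ((-s) • A)) *ᵥ (fun i => B i l) + exp ((-s) • A) *ᵥ 0) s :=
          hasDerivAt_mulVec (hE s) (hasDerivAt_const s _)
        have h2 := (dotProductBilin ℝ ℝ (p ᵥ* A ^ j)).toContinuousLinearMap.hasFDerivAt
          (x := exp ((-s) • A) *ᵥ (fun i => B i l)) |>.comp_hasDerivAt s h1
        have h3 : HasDerivAt (fun _ : ℝ => (0 : ℝ)) 0 s := hasDerivAt_const s 0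
        have h4 := h3.congr_of_eventuallyEq (f₁ := _) (Filter.eventuallyEq_of_mem
          (isOpen_Ioo.mem_nhds hs) (f := (⇑(dotProductBilin ℝ ℝ (p ᵥ* A ^ j)).toContinuousLinearMap ∘
            fun t => exp ((-t) • A) *ᵥ (fun i => B i l))) ?_)
        · have h5 := h2.unique h4
          have h6 : (p ᵥ* (A ^ (j + 1) * exp ((-s) • A) * B)) l
              = (p ᵥ* A ^ j) ⬝ᵥ ((A * exp ((-s) • A)) *ᵥ (fun i => B i l)) := by
            rw [dotProduct_mulVec, Matrix.vecMul_vecMul, pow_succ, ← Matrix.vecMul_vecMul _ _ B]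
            simp only [Matrix.mul_assoc]
            rfl
          rw [h6]
          simpa [dotProductBilin, Matrix.neg_mulVec] using h5
        · intro t ht
          have := congrFun (ih t ht) l
          rw [← Matrix.vecMul_vecMul _ _ B, ← Matrix.vecMul_vecMul] at this
          change (p ᵥ* A ^ j) ⬝ᵥ (exp ((-t) • A) *ᵥ (fun i => B i l)) = 0
          rw [dotProduct_mulVec]
          exact this
    -- Any interior time would do. The exponential commutes with `A ^ j`, so `q` is annihilated by
    -- all `A ^ j * B`; it is zero only if `p` is, because the exponential is invertible.
    set q := p ᵥ* exp ((-(1 / 2) : ℝ) • A) with hq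
    have hq0 : q = 0 := by
      apply h
      intro j
      have := hder j (1 / 2) (by norm_num)
      have hc : Commute (A ^ j) (exp ((-(1 / 2) : ℝ) • A)) := by
        have : Commute (A ^ j) ((-(1 / 2) : ℝ) • A) :=
          ((Commute.refl A).pow_left j).smul_right _
        exact this.exp_right
      rw [hc.eq, Matrix.mul_assoc, ← Matrix.vecMul_vecMul] at this
      exact this
    have := congrArg (fun v => v ᵥ* exp ((1 / 2 : ℝ) • A)) hq0
    simp only [hq, Matrix.vecMul_vecMul, Matrix.zero_vecMul] at this
    have h1 := exp_smul_mul_exp_neg_smul A (-(1 / 2))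
    rw [neg_neg] at h1
    rwa [h1, Matrix.vecMul_one] at this
  have hsurj : Function.Surjective W := LinearMap.injective_iff_surjective.1 hinj
  intro x₀ x₁
  obtain ⟨p, hp⟩ := hsurj (exp ((-1 : ℝ) • A) *ᵥ x₁ - x₀)
  -- Variation of constants: with this input the integral at time 1 equals `W p`, which was chosen
  -- to bring the state to `x₁`.
  refine ⟨1, one_pos, fun s => (G s)ᵀ *ᵥ p,
    fun t => exp (t • A) *ᵥ (x₀ + ∫ s in (0 : ℝ)..t, G s *ᵥ ((G s)ᵀ *ᵥ p)), ?_, ?_, ?_, ?_⟩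
  · exact hGc.matrix_transpose.matrix_mulVec continuous_const
  · simp
  · beta_reduce
    rw [← hW, hp]
    have := exp_smul_mul_exp_neg_smul A 1
    simp only [one_smul, neg_smul] at this ⊢
    simp [this]
  · intro t _
    have h1 := (hint p).integral_hasStrictDerivAt 0 t |>.hasDerivAt.const_add x₀
    have h2 := hasDerivAt_mulVec (hasDerivAt_exp_smul A t) h1
    refine (h2.congr_deriv ?_).hasDerivWithinAt
    simp only [Matrix.mulVec_mulVec, hG, ← Matrix.mul_assoc, exp_smul_mul_exp_neg_smul]
    simp

/-- A left null vector of `[A B]` is an obstruction to controllability. -/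
theorem Controllable.eq_zero_of_vecMul {n k : ℕ} {A : Matrix (Fin n) (Fin n) ℝ}
    {B : Matrix (Fin n) (Fin k) ℝ} (h : Controllable A B) {q : Fin n → ℝ}
    (hA : q ᵥ* A = 0) (hB : q ᵥ* B = 0) : q = 0 := by
  -- Steering from `0` to `q` is impossible unless `q = 0`, because `q ⬝ᵥ x t` is constant along
  -- every trajectory.
  obtain ⟨T, hT, u, x, -, h0, h1, hx⟩ := h 0 q
  have hd : ∀ t ∈ Set.Icc 0 T, HasDerivWithinAt (fun t => q ⬝ᵥ x t) 0 (Set.Icc 0 T) t := by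
    intro t ht
    have := (dotProductBilin ℝ ℝ q).toContinuousLinearMap.hasFDerivAt
          (x := x t) |>.comp_hasDerivWithinAt t (hx t ht)
    simpa [dotProductBilin, Function.comp_def, dotProduct_add, dotProduct_mulVec, hA, hB] using this
  have := constant_of_derivWithin_zero (fun t ht => (hd t ht).differentiableWithinAt)
    (fun t ht => (hd t ⟨ht.1, ht.2.le⟩).derivWithin
      (uniqueDiffOn_Icc hT t ⟨ht.1, ht.2.le⟩)) T ⟨hT.le, le_rfl⟩
  simp only [h0, h1, dotProduct_zero] at this
  exact dotProduct_self_eq_zero.1 this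

/-- A set of states that is not influenced from outside, and in particular not by the inputs,
is an obstruction to controllability. -/
theorem Controllable.exists_ne_zero {n k : ℕ} {A : Matrix (Fin n) (Fin n) ℝ}
    {B : Matrix (Fin n) (Fin k) ℝ} (h : Controllable A B) {S : Set (Fin n)} (hS : S.Nonempty)
    (hB : ∀ i ∈ S, ∀ j, B i j = 0) : ∃ i ∈ S, ∃ j, j ∉ S ∧ A i j ≠ 0 := by
  classical
  by_contra! hA
  obtain ⟨i₀, hi₀⟩ := hS
  obtain ⟨T, hT, u, x, -, h0, h1, hx⟩ := h 0 (Pi.single i₀ 1)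
  -- The part of the state on `S` obeys a homogeneous linear equation with zero initial value. By
  -- uniqueness it stays zero, although it should end with a `1` at `i₀`.
  let y : ℝ → Fin n → ℝ := fun t i => if i ∈ S then x t i else 0
  have hy : ∀ t ∈ Set.Icc 0 T, HasDerivWithinAt y (A *ᵥ y t - fun i => if i ∈ S then 0 else (A *ᵥ y t) i)
      (Set.Icc 0 T) t := by
    intro t ht
    rw [hasDerivWithinAt_pi]
    intro i
    by_cases hi : i ∈ S
    · have := hasDerivWithinAt_pi.1 (hx t ht) i
      simp only [y, hi, if_true, Pi.sub_apply, sub_zero]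
      convert this using 1
      have e1 : (B *ᵥ u t) i = 0 := by simp [Matrix.mulVec, dotProduct, hB i hi]
      rw [Pi.add_apply, e1, add_zero]
      simp only [Matrix.mulVec, dotProduct]
      refine Finset.sum_congr rfl fun j _ => ?_
      by_cases hj : j ∈ S
      · simp [hj]
      · simp [hj, hA i hi j hj]
    · simpa [y, hi] using hasDerivWithinAt_const t (Set.Icc 0 T) (0 : ℝ)
  let L : (Fin n → ℝ) →ₗ[ℝ] (Fin n → ℝ) :=
    { toFun := fun v i => if i ∈ S then (A *ᵥ v) i else 0
      map_add' := fun v w => by ext i; by_cases hi : i ∈ S <;> simp [hi, Matrix.mulVec_add]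
      map_smul' := fun c v => by ext i; by_cases hi : i ∈ S <;> simp [hi, Matrix.mulVec_smul] }
  have hy' : ∀ t ∈ Set.Icc 0 T, HasDerivWithinAt y (L.toContinuousLinearMap (y t)) (Set.Icc 0 T) t := by
    intro t ht
    convert hy t ht using 1
    ext i
    by_cases hi : i ∈ S <;> simp [L, hi]
  have := ODE_solution_unique_of_mem_Icc_right (v := fun _ => L.toContinuousLinearMap)
    (s := fun _ => Set.univ) (f := y) (g := fun _ => (0 : Fin n → ℝ)) (a := 0) (b := T)
    (fun t _ => L.toContinuousLinearMap.lipschitz.lipschitzOnWith)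
    (fun t ht => (hy' t ht).continuousWithinAt)
    (fun t ht => (hy' t ⟨ht.1, ht.2.le⟩).mono_of_mem_nhdsWithin (Icc_mem_nhdsGE_of_mem ht))
    (fun _ _ => trivial) continuousOn_const
    (fun t _ => (hasDerivWithinAt_const t (Set.Ici t) (0 : Fin n → ℝ)).congr_deriv (map_zero _).symm)
    (fun _ _ => trivial) (by ext i; simp [y, h0]) ⟨hT.le, le_rfl⟩
  have := congrFun this i₀
  simp [y, h1, hi₀] at this

end Controllability

/-! ### Weights that make a graph covered by cycles controllable -/

section Cycles

variable {V : Type*}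

/-- Take absolute values and sum over `C`, which `σ` permutes: `‖z‖` and `w` multiply the same sum
to the same result, so the sum is zero. -/
theorem eq_zero_on_cycles_of_norm_ne {σ : Equiv.Perm V} {C : Finset V} (hC : ∀ i, σ i ∈ C ↔ i ∈ C)
    {w : ℝ} (hw : 0 < w) {z : ℂ} (hz : ‖z‖ ≠ w) {q : V → ℂ}
    (hq : ∀ i ∈ C, z * q i = w * q (σ i)) : ∀ i ∈ C, q i = 0 := by
  have h1 : ∑ i ∈ C, ‖q (σ i)‖ = ∑ i ∈ C, ‖q i‖ :=
    Finset.sum_equiv σ (fun i => (hC i).symm) (fun _ _ => rfl)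
  have h2 : ‖z‖ * ∑ i ∈ C, ‖q i‖ = w * ∑ i ∈ C, ‖q i‖ := by
    conv_rhs => rw [← h1]
    rw [Finset.mul_sum, Finset.mul_sum]
    refine Finset.sum_congr rfl fun i hi => ?_
    have := congrArg norm (hq i hi)
    simpa [abs_of_pos hw] using this
  have h3 : ∑ i ∈ C, ‖q i‖ = 0 := by
    by_contra hne
    exact hz (mul_right_cancel₀ hne h2)
  intro i hi
  exact norm_eq_zero.1 ((Finset.sum_eq_zero_iff_of_nonneg fun _ _ => norm_nonneg _).1 h3 i hi)

/-- A zero is passed on from `i` to `σ i`, since `w` is invertible. -/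
theorem eq_zero_on_cycle_of_eq_zero [Finite V] {σ : Equiv.Perm V} {v : V} {w : ℝ} (hw : 0 < w) {z : ℂ}
    {q : V → ℂ} (hq : ∀ i, σ.SameCycle v i → z * q i = w * q (σ i)) (hv : q v = 0) :
    ∀ i, σ.SameCycle v i → q i = 0 := by
  intro i hi
  obtain ⟨k, -, rfl⟩ := hi.exists_pow_eq'
  clear hi
  induction k with
  | zero => simpa
  | succ k ih =>
    have := hq ((σ ^ k) v) ((Equiv.Perm.SameCycle.refl σ v).pow_right)
    rw [ih, mul_zero] at this
    rw [pow_succ', Equiv.Perm.mul_apply]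
    exact (mul_eq_zero.1 this.symm).resolve_left (by exact_mod_cast hw.ne')

variable [Fintype V] [DecidableEq V]

/-- The zero at `v` travels forward along the cycle up to `s`, and backward (here `z ≠ 0` is needed)
down to `σ s`, without using the disturbed equation. That equation then forces `α = 0`, and the
undisturbed case applies. -/
theorem eq_zero_on_cycle_of_perturbation {σ : Equiv.Perm V} {v s : V} (hs : σ.SameCycle v s)
    {w : ℝ} (hw : 0 < w) {z α : ℂ} (hz : z ≠ 0) {q : V → ℂ}
    (hq : ∀ i, σ.SameCycle v i → z * q i = w * q (σ i) + if i = s then α else 0)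
    (hv : q v = 0) : ∀ i, σ.SameCycle v i → q i = 0 := by
  have hw' : (w : ℂ) ≠ 0 := by exact_mod_cast hw.ne'
  have h1 : q s = 0 := by
    have hex : ∃ k : ℕ, (σ ^ k) v = s := by
      obtain ⟨k, -, hk⟩ := hs.exists_pow_eq'
      exact ⟨k, hk⟩
    have key : ∀ k : ℕ, (∀ j < k, (σ ^ j) v ≠ s) → q ((σ ^ k) v) = 0 := by
      intro k
      induction k with
      | zero => intro _; simpa
      | succ k ih =>
        intro h
        have := hq ((σ ^ k) v) ((Equiv.Perm.SameCycle.refl σ v).pow_right)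
        rw [ih fun j hj => h j (hj.trans k.lt_succ_self), if_neg (h k k.lt_succ_self), mul_zero,
          add_zero] at this
        rw [pow_succ', Equiv.Perm.mul_apply]
        exact (mul_eq_zero.1 this.symm).resolve_left hw'
    rw [← Nat.find_spec hex]
    exact key _ fun j hj => Nat.find_min hex hj
  have h2 : q (σ s) = 0 := by
    have hex : ∃ k : ℕ, (σ⁻¹ ^ k) v = σ s := by
      obtain ⟨k, -, hk⟩ := (Equiv.Perm.sameCycle_inv.2
        (Equiv.Perm.sameCycle_apply_right.2 hs)).exists_pow_eq'
      exact ⟨k, hk⟩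
    have key : ∀ k : ℕ, (∀ j < k, (σ⁻¹ ^ j) v ≠ σ s) → q ((σ⁻¹ ^ k) v) = 0 := by
      intro k
      induction k with
      | zero => intro _; simpa
      | succ k ih =>
        intro h
        have e : σ ((σ⁻¹ ^ (k + 1)) v) = (σ⁻¹ ^ k) v := by
          rw [pow_succ', Equiv.Perm.mul_apply]
          exact σ.apply_symm_apply _
        have := hq ((σ⁻¹ ^ (k + 1)) v)
          (Equiv.Perm.sameCycle_inv.1 ((Equiv.Perm.SameCycle.refl σ⁻¹ v).pow_right))
        rw [e, ih fun j hj => h j (hj.trans k.lt_succ_self), if_neg, mul_zero, add_zero] at this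
        · exact (mul_eq_zero.1 this).resolve_left hz
        · intro hk
          rw [hk] at e
          exact h k k.lt_succ_self e.symm
    rw [← Nat.find_spec hex]
    exact key _ fun j hj => Nat.find_min hex hj
  have h3 : α = 0 := by simpa [h1, h2] using (hq s hs).symm
  exact eq_zero_on_cycle_of_eq_zero hw (fun i hi => by simpa [h3] using hq i hi) hv

/-- The weights `a` on the edges inside `S` leave no eigenvector that vanishes on `I`; and the
inputs at `I` respond to a disturbance at a single vertex of `S` for all frequencies of modulus
greater than `R`. -/
structure Observes (I : Set V) (S : Finset V) (a : V → V → ℝ) (R : ℝ) : Prop where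
  supp : ∀ i j, a i j ≠ 0 → i ∈ S ∧ j ∈ S
  eigen : ∀ (z : ℂ) (q : V → ℂ), (∀ i ∉ S, q i = 0) → (∀ i ∈ I, q i = 0) →
    (∀ i ∈ S, z * q i = ∑ j, a i j * q j) → q = 0
  response : ∀ (z : ℂ) (q : V → ℂ) (s : V) (α : ℂ), R < ‖z‖ → s ∈ S → (∀ i ∉ S, q i = 0) →
    (∀ i ∈ I, q i = 0) →
    (∀ i ∈ S, z * q i = ∑ j, a i j * q j + if i = s then α else 0) → q = 0

/-- The new edges are the cycle of `σ` through `v`, with weight `w` above the old threshold, and at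
most one edge from `S` to `v`. The values on the cycle satisfy a closed system, so they vanish
unless `‖z‖ = w`. If `‖z‖ = w > R`, the value `q v` acts on `S` like a disturbance at the source of
the connecting edge. By `response` for `S` there is no nonzero solution on `S`; the equation at that
source then reads `q v = 0`, and the cycle vanishes as well. For `response` with threshold `w`, a
disturbance in `S` leaves the cycle at zero by the norm argument, and one on the cycle is handled by
`eq_zero_on_cycle_of_perturbation`. -/
theorem Observes.extend {I : Set V} {S : Finset V} {a : V → V → ℝ} {R : ℝ}
    (h : Observes I S a R) {σ : Equiv.Perm V} (hS : ∀ i, σ i ∈ S ↔ i ∈ S) {v : V} (hv : v ∉ S)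
    (s₀ : Option V) (hs₀ : (s₀ = none ∧ v ∈ I) ∨ ∃ s ∈ S, s₀ = some s) {w : ℝ} (hw : 0 < w)
    (hR : R < w) :
    Observes I (S ∪ Finset.univ.filter (σ.SameCycle v))
      (fun i j => a i j + (if σ.SameCycle v i ∧ j = σ i then w else 0) +
        if s₀ = some i ∧ j = v then 1 else 0) w := by
  have hdisj : ∀ i ∈ S, ¬ σ.SameCycle v i := by
    intro i hi hc
    obtain ⟨k, -, rfl⟩ := hc.exists_pow_eq'
    apply hv
    clear hc
    induction k with
    | zero => simpa using hi
    | succ k ih => exact ih ((hS _).1 (by rwa [pow_succ', Equiv.Perm.mul_apply] at hi))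
  have hs₀S : ∀ i, s₀ = some i → i ∈ S := by
    rintro i rfl
    rcases hs₀ with ⟨h, -⟩ | ⟨s, hs, h⟩
    · simp at h
    · simp only [Option.some.injEq] at h
      exact h ▸ hs
  have hasupp : ∀ i ∉ S, ∀ j, a i j = 0 := fun i hi j => by
    by_contra hne
    exact hi (h.supp i j hne).1
  have hasupp' : ∀ i, ∀ j ∉ S, a i j = 0 := fun i j hj => by
    by_contra hne
    exact hj (h.supp i j hne).2
  set a' : V → V → ℝ := fun i j => a i j + (if σ.SameCycle v i ∧ j = σ i then w else 0) +
        if s₀ = some i ∧ j = v then 1 else 0 with ha'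
  -- Equations at vertices of `S` see the new cycle only through `q v`; those on the cycle do not
  -- see `S` at all.
  have sumS : ∀ (q : V → ℂ), ∀ i ∈ S, ∑ j, (a' i j : ℂ) * q j =
      ∑ j, (a i j : ℂ) * (if j ∈ S then q j else 0) + if s₀ = some i then q v else 0 := by
    intro q i hi
    have e1 : ∀ j, (a' i j : ℂ) * q j = (a i j : ℂ) * (if j ∈ S then q j else 0)
        + if j = v then (if s₀ = some i then q v else 0) else 0 := by
      intro j
      simp only [ha', hdisj i hi, false_and, if_false, add_zero]
      by_cases hj : j = v
      · subst hj
        by_cases hs : s₀ = some i <;> simp [hs, hv, hasupp' i j hv]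
      · by_cases hjS : j ∈ S
        · simp [hj, hjS]
        · simp [hj, hjS, hasupp' i j hjS]
    simp only [e1, Finset.sum_add_distrib]
    simp
  have sumC : ∀ (q : V → ℂ) (i), σ.SameCycle v i → ∑ j, (a' i j : ℂ) * q j = w * q (σ i) := by
    intro q i hi
    have hiS : i ∉ S := fun h => hdisj i h hi
    have hi0 : s₀ ≠ some i := fun h => hiS (hs₀S i h)
    have e1 : ∀ j, (a' i j : ℂ) * q j = if j = σ i then (w : ℂ) * q (σ i) else 0 := by
      intro j
      by_cases hj : j = σ i
      · subst hj; simp [ha', hi, hi0, hasupp i hiS]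
      · simp [ha', hj, hi0, hasupp i hiS]
    simp [e1]
  -- the part of a solution living on `S`
  have restr0 : ∀ (q : V → ℂ), ∀ i ∉ S, (if i ∈ S then q i else 0) = 0 := by
    intro q i hi; simp [hi]
  have restrI : ∀ (q : V → ℂ), (∀ i ∈ I, q i = 0) → ∀ i ∈ I, (if i ∈ S then q i else 0) = 0 := by
    intro q hq i hi; simp [hq i hi]
  have split : ∀ (q : V → ℂ), (∀ i ∉ S ∪ Finset.univ.filter (σ.SameCycle v), q i = 0) →
      (∀ i, σ.SameCycle v i → q i = 0) → (fun i => if i ∈ S then q i else 0) = 0 → q = 0 := by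
    intro q h0 hC hSq
    ext i
    by_cases hi : i ∈ S
    · simpa [hi] using congrFun hSq i
    · by_cases hc : σ.SameCycle v i
      · exact hC i hc
      · exact h0 i (by simp [hi, hc])
  have qv : ∀ (z : ℂ) (q : V → ℂ), R < ‖z‖ → (∀ i ∈ I, q i = 0) →
      (∀ i ∈ S, z * q i = ∑ j, (a' i j : ℂ) * q j) → q v = 0 := by
    intro z q hz hI hq
    rcases hs₀ with ⟨-, hvI⟩ | ⟨s, hs, rfl⟩
    · exact hI v hvI
    · have := h.response z (fun i => if i ∈ S then q i else 0) s (q v) hz hs (restr0 q) (restrI q hI)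
        (fun i hi => by
          simp only [hi, if_true]
          rw [hq i hi, sumS q i hi]
          simp [eq_comm])
      have h2 := hq s hs
      rw [sumS q s hs] at h2
      have h3 := fun j => congrFun this j
      have h4 := h3 s
      simp only [h3] at h2
      simp only [hs, if_true, Pi.zero_apply] at h4
      simpa [h4] using h2.symm
  have memC : ∀ i, σ.SameCycle v i → i ∈ S ∪ Finset.univ.filter (σ.SameCycle v) := by
    intro i hi; simp [hi]
  have memS : ∀ i ∈ S, i ∈ S ∪ Finset.univ.filter (σ.SameCycle v) := by
    intro i hi; simp [hi]
  have eigS : ∀ (z : ℂ) (q : V → ℂ), q v = 0 → (∀ i ∈ I, q i = 0) →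
      (∀ i ∈ S, z * q i = ∑ j, (a' i j : ℂ) * q j) → (fun i => if i ∈ S then q i else 0) = 0 := by
    intro z q hqv hI hq
    refine h.eigen z _ (restr0 q) (restrI q hI) fun i hi => ?_
    have := hq i hi
    rw [sumS q i hi] at this
    simpa [hi, hqv] using this
  refine ⟨?_, ?_, ?_⟩
  · intro i j hij
    by_cases hi : i ∈ S
    · refine ⟨memS i hi, ?_⟩
      by_cases hj : j ∈ S
      · exact memS j hj
      · by_cases hjv : j = v
        · subst hjv; exact memC j (Equiv.Perm.SameCycle.refl σ j)
        · exfalso; apply hij; simp [ha', hasupp' i j hj, hdisj i hi, hjv]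
    · have hi0 : s₀ ≠ some i := fun h => hi (hs₀S i h)
      by_cases hc : σ.SameCycle v i ∧ j = σ i
      · exact ⟨memC i hc.1, memC j (hc.2 ▸ Equiv.Perm.sameCycle_apply_right.2 hc.1)⟩
      · exfalso; apply hij; simp [ha', hasupp i hi, hi0, hc]
  · intro z q h0 hI hq
    have hqC : ∀ i, σ.SameCycle v i → z * q i = w * q (σ i) := fun i hi => by
      rw [hq i (memC i hi), sumC q i hi]
    have hqS : ∀ i ∈ S, z * q i = ∑ j, (a' i j : ℂ) * q j := fun i hi => hq i (memS i hi)
    have hC : ∀ i, σ.SameCycle v i → q i = 0 := by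
      by_cases hz : ‖z‖ = w
      · exact eq_zero_on_cycle_of_eq_zero hw hqC (qv z q (hz ▸ hR) hI hqS)
      · intro i hi
        exact eq_zero_on_cycles_of_norm_ne (σ := σ) (C := Finset.univ.filter (σ.SameCycle v))
          (by simp) hw hz (by simpa using hqC) i (by simpa using hi)
    exact split q h0 hC (eigS z q (hC v (Equiv.Perm.SameCycle.refl σ v)) hI hqS)
  · intro z q s α hz hs h0 hI hq
    have hz0 : z ≠ 0 := by rintro rfl; simp at hz; linarith
    by_cases hsS : s ∈ S
    · have hC : ∀ i, σ.SameCycle v i → q i = 0 := by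
        intro i hi
        refine eq_zero_on_cycles_of_norm_ne (σ := σ) (C := Finset.univ.filter (σ.SameCycle v))
          (by simp) hw hz.ne' (fun i hi => ?_) i (by simpa using hi)
        have hi' : σ.SameCycle v i := by simpa using hi
        rw [hq i (memC i hi'), sumC q i hi', if_neg, add_zero]
        rintro rfl
        exact hdisj i hsS hi'
      refine split q h0 hC (h.response z _ s α (hR.trans hz) hsS (restr0 q) (restrI q hI)
        fun i hi => ?_)
      have := hq i (memS i hi)
      rw [sumS q i hi, hC v (Equiv.Perm.SameCycle.refl σ v)] at this
      simpa [hi] using this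
    · have hsC : σ.SameCycle v s := by simpa [hsS] using hs
      have hqS : ∀ i ∈ S, z * q i = ∑ j, (a' i j : ℂ) * q j := fun i hi => by
        rw [hq i (memS i hi), if_neg, add_zero]
        rintro rfl
        exact hsS hi
      have hqv := qv z q (hR.trans hz) hI hqS
      have hC := eq_zero_on_cycle_of_perturbation hsC hw hz0 (fun i hi => by
        rw [hq i (memC i hi), sumC q i hi]) hqv
      exact split q h0 hC (eigS z q hqv hI hqS)

/-- Cover the vertices by cycles of `σ`, one at a time. Following a path from `I` to an uncovered
vertex backward, one finds an uncovered `v` that either starts the path in `I` or is entered by an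
edge from a covered vertex. This is the entry point that `Observes.extend` requires. -/
theorem exists_observes_univ {I : Set V} {E : V → V → Prop} {σ : Equiv.Perm V}
    (hσ : ∀ i, E i (σ i)) (hreach : ∀ v, ∃ i ∈ I, Relation.ReflTransGen E i v) :
    ∃ (a : V → V → ℝ) (R : ℝ), Observes I Finset.univ a R ∧ ∀ i j, a i j ≠ 0 → E i j := by
  suffices H : ∀ (m : ℕ) (S : Finset V) (a : V → V → ℝ) (R : ℝ), Sᶜ.card = m →
      (∀ i, σ i ∈ S ↔ i ∈ S) → Observes I S a R → (∀ i j, a i j ≠ 0 → E i j) →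
      ∃ (a : V → V → ℝ) (R : ℝ), Observes I Finset.univ a R ∧ ∀ i j, a i j ≠ 0 → E i j by
    refine H _ ∅ (fun _ _ => 0) 0 rfl (by simp) ⟨by simp, ?_, by simp⟩ (by simp)
    intro z q h0 _ _
    ext i
    exact h0 i (by simp)
  intro m
  induction m using Nat.strong_induction_on with
  | _ m ih =>
    intro S a R hm hS hobs hE
    by_cases hu : S = Finset.univ
    · subst hu; exact ⟨a, R, hobs, hE⟩
    · obtain ⟨u, hu⟩ : ∃ u, u ∉ S := by
        by_contra! hall
        exact hu (Finset.eq_univ_of_forall hall)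
      obtain ⟨v, hv, s₀, hs₀, hsE⟩ : ∃ v, v ∉ S ∧ ∃ s₀ : Option V,
          ((s₀ = none ∧ v ∈ I) ∨ ∃ s ∈ S, s₀ = some s) ∧ ∀ s, s₀ = some s → E s v := by
        obtain ⟨i, hi, hr⟩ := hreach u
        clear hm
        induction hr with
        | refl => exact ⟨i, hu, none, Or.inl ⟨rfl, hi⟩, by simp⟩
        | @tail b c _ hbc ih' =>
          by_cases hb : b ∈ S
          · exact ⟨c, hu, some b, Or.inr ⟨b, hb, rfl⟩, by rintro s ⟨⟩; exact hbc⟩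
          · exact ih' hb
      -- The weight `max R 0 + 1` is positive and beyond all frequencies in use.
      have hw : 0 < max R 0 + 1 := by positivity
      have hR : R < max R 0 + 1 := (le_max_left R 0).trans_lt (lt_add_one _)
      refine ih _ ?_ _ _ _ rfl ?_ (hobs.extend hS hv s₀ hs₀ hw hR) ?_
      · rw [← hm]
        apply Finset.card_lt_card
        rw [Finset.compl_ssubset_compl]
        refine Finset.ssubset_iff_subset_ne.2 ⟨Finset.subset_union_left, fun h => hv ?_⟩
        rw [h]
        simp [Equiv.Perm.SameCycle.refl]
      · intro i; simp [hS]
      · intro i j hij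
        by_cases h1 : a i j ≠ 0
        · exact hE i j h1
        · by_cases h2 : σ.SameCycle v i ∧ j = σ i
          · exact h2.2 ▸ hσ i
          · by_cases h3 : s₀ = some i ∧ j = v
            · exact h3.2 ▸ hsE i h3.1
            · exact absurd (by simp [not_not.1 h1, h2, h3]) hij

end Cycles

/-- Popov–Belevitch–Hautus test for inputs that act on single states. -/
theorem controllable_diagonal_of_eigenvectors {n : ℕ} (A : Matrix (Fin n) (Fin n) ℝ)
    (I : Finset (Fin n))
    (h : ∀ (z : ℂ) (q : Fin n → ℂ), (∀ i ∈ I, q i = 0) →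
      (∀ i, z * q i = ∑ j, (A j i : ℂ) * q j) → q = 0) :
    Controllable A (Matrix.diagonal fun i => if i ∈ I then (1 : ℝ) else 0) := by
  open Matrix in
  apply controllable_of_vecMul_pow
  intro q hq
  by_contra hne
  let AC : Matrix (Fin n) (Fin n) ℂ := A.map (algebraMap ℝ ℂ)
  let f : Module.End ℂ (Fin n → ℂ) := AC.vecMulLinear
  have hf : ∀ p, f p = p ᵥ* AC := fun p => rfl
  -- The complex row vectors that the inputs at `I` never detect. This space is invariant under `f`,
  -- so if it were nonzero it would contain an eigenvector, and that eigenvector would vanish on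
  -- `I`.
  let W : Submodule ℂ (Fin n → ℂ) :=
    { carrier := {p | ∀ j : ℕ, ∀ i ∈ I, (p ᵥ* AC ^ j) i = 0}
      add_mem' := fun {p r} hp hr j i hi => by simp [Matrix.add_vecMul, hp j i hi, hr j i hi]
      zero_mem' := by simp
      smul_mem' := fun c p hp j i hi => by simp [Matrix.smul_vecMul, hp j i hi] }
  have hWf : ∀ p ∈ W, f p ∈ W := by
    intro p hp j i hi
    rw [hf, Matrix.vecMul_vecMul, ← pow_succ']
    exact hp (j + 1) i hi
  have hqW : (fun i => (q i : ℂ)) ∈ W := by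
    intro j i hi
    have h1 := congrFun (hq j) i
    rw [← Matrix.vecMul_vecMul, Matrix.vecMul_diagonal, if_pos hi, mul_one] at h1
    have h2 : AC ^ j = (A ^ j).map (algebraMap ℝ ℂ) := by
      simp only [AC]
      exact (map_pow (algebraMap ℝ ℂ).mapMatrix A j).symm
    have h3 := congrArg (fun x : ℝ => (x : ℂ)) h1
    rw [h2]
    simpa [Matrix.vecMul, dotProduct] using h3
  have hnt : Nontrivial W := by
    refine ⟨⟨⟨_, hqW⟩, 0, fun h0 => hne ?_⟩⟩
    ext i
    have := congrFun (congrArg Subtype.val h0) i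
    simpa using this
  obtain ⟨z, hz⟩ := Module.End.exists_eigenvalue (f.restrict hWf)
  obtain ⟨p, hp⟩ := hz.exists_hasEigenvector
  have hp1 := congrArg Subtype.val hp.apply_eq_smul
  refine hp.2 (Subtype.ext (h z p.1 (fun i hi => by simpa using p.2 0 i hi) fun i => ?_))
  have := congrFun hp1 i
  rw [LinearMap.coe_restrict_apply, hf] at this
  simp only [Submodule.coe_smul, Pi.smul_apply, smul_eq_mul] at this
  rw [← this]
  simp [Matrix.vecMul, dotProduct, AC, mul_comm]

/-- Sufficiency in the structural controllability theorem. A perfect matching that uses edges of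
the graph and edges into input vertices is given as a permutation `σ`. -/
theorem exists_controllable_of_perm {n : ℕ} {A : Matrix (Fin n) (Fin n) ℝ} {I : Finset (Fin n)}
    {σ : Equiv.Perm (Fin n)} (hσ : ∀ i, (adjacencyGraph A).Adj i (σ i) ∨ σ i ∈ I)
    (hreach : ∀ v, ∃ i ∈ I, Relation.ReflTransGen (adjacencyGraph A).Adj i v) :
    ∃ A' : Matrix (Fin n) (Fin n) ℝ, zeroPattern A ⊆ zeroPattern A' ∧
      Controllable A' (Matrix.diagonal fun i => if i ∈ I then (1 : ℝ) else 0) := by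
  obtain ⟨a, R, ha, haE⟩ := exists_observes_univ (I := (I : Set (Fin n)))
    (E := fun i j => (adjacencyGraph A).Adj i j ∨ j ∈ I) hσ (fun v => by
      obtain ⟨i, hi, h⟩ := hreach v
      exact ⟨i, hi, Relation.ReflTransGen.mono (fun _ _ => Or.inl) _ _ h⟩)
  -- The permutation may use pairs ending in `I` that are not edges of the graph. Their weights can
  -- be deleted, because they only multiply values of `q` on `I`, which are zero.
  refine ⟨fun j i => if A j i = 0 then 0 else a i j, ?_, ?_⟩
  · intro p hp
    simp only [zeroPattern, Set.mem_ofPred_eq] at hp ⊢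
    simp [hp]
  · apply controllable_diagonal_of_eigenvectors
    intro z q hI hq
    refine ha.eigen z q (by simp) hI fun i _ => ?_
    rw [hq i]
    refine Finset.sum_congr rfl fun j _ => ?_
    by_cases h0 : A j i = 0
    · by_cases h1 : a i j = 0
      · simp [h1]
      · rcases haE i j h1 with h2 | h2
        · exact absurd h0 h2
        · simp [hI j h2]
    · simp [h0]

/-! ### Feasible sets, matchings and source components -/

open Relation

/-- Hall's theorem for the zero pattern of a matrix with independent rows. -/
theorem exists_injective_of_vecMul_injective {m k : Type*} [Fintype m] [Fintype k] [DecidableEq k]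
    (C : Matrix m k ℝ) (h : ∀ q, Matrix.vecMul q C = 0 → q = 0) :
    ∃ f : m → k, Function.Injective f ∧ ∀ i, C i (f i) ≠ 0 := by
  classical
  obtain ⟨f, hf, hft⟩ := (Finset.all_card_le_biUnion_card_iff_exists_injective
    (fun i => Finset.univ.filter fun j => C i j ≠ 0)).1 (by
      intro s
      by_contra! hlt
      set N := s.biUnion fun i => Finset.univ.filter fun j => C i j ≠ 0 with hN
      -- If Hall's condition fails for `s`, these rows live in fewer than `|s|` columns. They are
      -- therefore dependent, and the dependency extended by zero is a left null vector of `C`.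
      let f : (s → ℝ) →ₗ[ℝ] (N → ℝ) := (C.submatrix (fun i : s => i.1) (fun j : N => j.1)).vecMulLinear
      have hker := LinearMap.ker_ne_bot_of_finrank_lt (f := f) (by simpa using hlt)
      obtain ⟨q, hq, hq0⟩ := Submodule.exists_mem_ne_zero_of_ne_bot hker
      apply hq0
      have hz := h (fun i => if hi : i ∈ s then q ⟨i, hi⟩ else 0) (by
        ext j
        have e : ∑ i, (if hi : i ∈ s then q ⟨i, hi⟩ else 0) * C i j = ∑ i : s, q i * C i j := by
          rw [Finset.univ_eq_attach]
          rw [← Finset.sum_subset (Finset.subset_univ s) (fun i _ hi => by simp [hi]),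
            ← Finset.sum_attach s]
          exact Finset.sum_congr rfl fun i _ => by simp
        simp only [Matrix.vecMul, dotProduct, Pi.zero_apply]
        rw [e]
        by_cases hj : j ∈ N
        · have := congrFun (LinearMap.mem_ker.1 hq) ⟨j, hj⟩
          simpa [f, Matrix.vecMul, dotProduct] using this
        · refine Finset.sum_eq_zero fun i _ => ?_
          have : C i j = 0 := by
            by_contra hne
            exact hj (Finset.mem_biUnion.2 ⟨i, i.2, by simpa using hne⟩)
          simp [this])
      ext i
      have := congrFun hz i.1
      simpa using this)
  exact ⟨f, hf, fun i => by simpa using hft i⟩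

variable {n : ℕ} {A : Matrix (Fin n) (Fin n) ℝ} {F I : Finset (Fin n)}

/-- Choose by Hall's theorem a nonzero entry of `[A' B']` in each row, with distinct columns. An
entry of `A'` in row `j` and column `i` is the edge from `i` to `j`. A row served by `B'` uses a
diagonal entry, and so belongs to `I`. -/
theorem IsFeasible.exists_matching (h : IsFeasible A F I) :
    ∃ M, IsMatching (adjacencyGraph A) M ∧ unmatched M ⊆ (I : Set (Fin n)) := by
  classical
  obtain ⟨-, B, hBd, hBI, A', B', hA', hB', hc⟩ := h
  obtain ⟨f, hf, hfC⟩ := exists_injective_of_vecMul_injective (Matrix.fromCols A' B') (fun q hq => by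
    rw [Matrix.vecMul_fromCols] at hq
    exact hc.eq_zero_of_vecMul (funext fun j => congrFun hq (Sum.inl j))
      (funext fun j => congrFun hq (Sum.inr j)))
  refine ⟨Finset.univ.filter fun e => f e.2 = Sum.inl e.1, ⟨?_, ?_⟩, ?_⟩
  · rintro ⟨i, j⟩ he h0
    have he : f j = Sum.inl i := by simpa using he
    have h1 := hfC j
    rw [he] at h1
    exact h1 (hA' (show (j, i) ∈ zeroPattern A from h0))
  · rintro ⟨i, j⟩ he ⟨i', j'⟩ he' hne
    have he : f j = Sum.inl i := by simpa using he
    have he' : f j' = Sum.inl i' := by simpa using he'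
    refine ⟨?_, ?_⟩
    · rintro (rfl : i = i')
      exact hne (by rw [hf (he.trans he'.symm)])
    · rintro (rfl : j = j')
      rw [he] at he'
      exact hne (by rw [Sum.inl_injective he'])
  · intro v hv
    have h1 := hfC v
    cases hfv : f v with
    | inl i => exact absurd rfl (hv (i, v) (by simpa using hfv))
    | inr j =>
      rw [hfv] at h1
      have h2 : B v j ≠ 0 := fun h0 => h1 (hB' (show (v, j) ∈ zeroPattern B from h0))
      have h3 : v = j := by
        by_contra hne
        exact h2 (hBd hne)
      subst h3
      exact (hBI v).1 h2

/-- The set of vertices not reachable from `I` receives no input and no edge from outside. -/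
theorem IsFeasible.reaches (h : IsFeasible A F I) (v : Fin n) :
    ∃ i ∈ I, ReflTransGen (adjacencyGraph A).Adj i v := by
  obtain ⟨-, B, hBd, hBI, A', B', hA', hB', hc⟩ := h
  by_contra! hv
  obtain ⟨i, hi, j, hj, hij⟩ := hc.exists_ne_zero
    (S := {v | ∀ i ∈ I, ¬ ReflTransGen (adjacencyGraph A).Adj i v}) ⟨v, hv⟩ (fun i hi j => by
      refine hB' (show (i, j) ∈ zeroPattern B from ?_)
      by_cases hij : i = j
      · subst hij
        by_contra hne
        exact hi i ((hBI i).1 hne) .refl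
      · exact hBd hij)
  obtain ⟨k, hk, hkj⟩ : ∃ k ∈ I, ReflTransGen (adjacencyGraph A).Adj k j := by simpa using hj
  exact hi k hk (hkj.tail fun h0 => hij (hA' (show (i, j) ∈ zeroPattern A from h0)))

/-- The matching is an injective partial map from sources to destinations and extends to a
permutation. By injectivity, a vertex that is not a source is sent to one that is not a destination,
that is, to an unmatched vertex, and these lie in `I`. -/
theorem isFeasible_of_matching (hd : Disjoint I F) {M : Finset (Fin n × Fin n)}
    (hM : IsMatching (adjacencyGraph A) M) (hMI : unmatched M ⊆ (I : Set (Fin n)))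
    (hr : ∀ v, ∃ i ∈ I, ReflTransGen (adjacencyGraph A).Adj i v) : IsFeasible A F I := by
  classical
  have hdst : ∀ i ∈ M.image Prod.fst, ∃ j, (i, j) ∈ M := by
    intro i hi
    obtain ⟨e, he, rfl⟩ := Finset.mem_image.1 hi
    exact ⟨e.2, he⟩
  choose! f hf using hdst
  obtain ⟨g, hg⟩ := Finset.exists_equiv_extend_of_card_eq (α := Fin n) (t := Finset.univ)
    (by simp) (s := M.image Prod.fst) (f := f) (Finset.subset_univ _) (by
      intro i hi j hj hij
      by_contra hne
      exact (hM.2 _ (hf i hi) _ (hf j hj) (by simp [hne])).2 hij)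
  let σ : Equiv.Perm (Fin n) := g.trans (Equiv.subtypeUnivEquiv fun _ => Finset.mem_univ _)
  have hσ : ∀ i ∈ M.image Prod.fst, σ i = f i := hg
  obtain ⟨A', hA', hc⟩ := exists_controllable_of_perm (A := A) (I := I) (σ := σ) (fun i => by
    by_cases hi : i ∈ M.image Prod.fst
    · rw [hσ i hi]
      exact Or.inl (hM.1 _ (hf i hi))
    · refine Or.inr (hMI fun e he hev => hi ?_)
      have h1 : e.1 ∈ M.image Prod.fst := Finset.mem_image_of_mem _ he
      have h2 : f e.1 = e.2 := by
        by_contra hne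
        exact (hM.2 _ (hf e.1 h1) _ he (fun h => hne (congrArg Prod.snd h))).1 rfl
      have : e.1 = i := σ.injective (by rw [hσ _ h1, h2, hev])
      exact this ▸ h1) hr
  exact ⟨hd, _, Matrix.isDiag_diagonal _, by simp, A', _, hA', subset_rfl, hc⟩

/-! ### Source components and reachability -/

section Source

variable {V : Type*} {G : Digraph V}

theorem sccOf_eq_iff {u v : V} :
    sccOf G u = sccOf G v ↔ ReflTransGen G.Adj u v ∧ ReflTransGen G.Adj v u :=
  Quotient.eq (r := stronglyConnected G)

theorem IsSourceSCC.sccOf_eq {c : SCC G} (hc : IsSourceSCC G c) {u v : V} (hv : sccOf G v = c)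
    (h : ReflTransGen G.Adj u v) : sccOf G u = c := by
  induction h using ReflTransGen.head_induction_on with
  | refl => exact hv
  | @head a b hab _ ih =>
    by_contra hne
    exact hc (sccOf G a) ⟨hne, a, b, rfl, ih, hab⟩

theorem isSourceSCC_sccOf {v : V} (h : ∀ u, ReflTransGen G.Adj u v → ReflTransGen G.Adj v u) :
    IsSourceSCC G (sccOf G v) := by
  rintro _ ⟨hne, a, b, rfl, hb, hab⟩
  have h1 : ReflTransGen G.Adj a v := ReflTransGen.head hab (sccOf_eq_iff.1 hb).1
  exact hne (sccOf_eq_iff.2 ⟨h1, h a h1⟩)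

/-- Among the vertices that reach `v`, take one with the fewest ancestors. An ancestor of it that it
cannot reach back would have strictly fewer. -/
theorem exists_source_reaching [Finite V] (v : V) :
    ∃ s, IsSourceSCC G (sccOf G s) ∧ ReflTransGen G.Adj s v := by
  obtain ⟨s, hs, hmin⟩ := Set.exists_min_image {s | ReflTransGen G.Adj s v}
    (fun s => {u | ReflTransGen G.Adj u s}.ncard) (Set.toFinite _) ⟨v, .refl⟩
  refine ⟨s, isSourceSCC_sccOf fun u hu => ?_, hs⟩
  by_contra hsu
  refine (hmin u (hu.trans hs)).not_gt (Set.ncard_lt_ncard ⟨fun w hw => hw.trans hu, fun h => ?_⟩)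
  exact hsu (h ReflTransGen.refl)

theorem reaches_of_source [Finite V] {J : Set V}
    (h : ∀ c, IsSourceSCC G c → ∃ i ∈ J, sccOf G i = c) (v : V) :
    ∃ i ∈ J, ReflTransGen G.Adj i v := by
  obtain ⟨s, hs, hsv⟩ := exists_source_reaching (G := G) v
  obtain ⟨i, hi, his⟩ := h _ hs
  exact ⟨i, hi, (sccOf_eq_iff.1 his).1.trans hsv⟩

theorem source_meets_of_reaches {J : Set V} (h : ∀ v, ∃ i ∈ J, ReflTransGen G.Adj i v)
    {c : SCC G} (hc : IsSourceSCC G c) : ∃ i ∈ J, sccOf G i = c := by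
  obtain ⟨v, rfl⟩ := Quotient.exists_rep c
  obtain ⟨i, hi, hiv⟩ := h v
  exact ⟨i, hi, hc.sccOf_eq rfl hiv⟩

end Source

/-- For the matching with unmatched vertices inside `I`, each source component without an unmatched
vertex still meets `I`. This injects those components into `I` minus the unmatched vertices. -/
theorem IsFeasible.exists_matchingCost_le (h : IsFeasible A F I) :
    ∃ M, IsAllowedMatching (adjacencyGraph A) F M ∧ matchingCost (adjacencyGraph A) M ≤ I.card := by
  classical
  obtain ⟨M, hM, hMI⟩ := h.exists_matching
  refine ⟨M, ⟨hM, ?_⟩, ?_⟩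
  · rw [← Set.disjoint_iff_inter_eq_empty]
    exact (Finset.disjoint_coe.2 h.1).mono_left hMI
  · have hrep : ∀ c ∈ {c : SCC (adjacencyGraph A) | IsSourceSCC (adjacencyGraph A) c ∧
        ∀ v ∈ unmatched M, sccOf (adjacencyGraph A) v ≠ c}, ∃ i ∈ (I : Set (Fin n)) \ unmatched M,
        sccOf (adjacencyGraph A) i = c := by
      rintro c ⟨hc, hcM⟩
      obtain ⟨i, hi, hic⟩ := source_meets_of_reaches (J := (I : Set (Fin n))) h.reaches hc
      exact ⟨i, ⟨hi, fun hiM => hcM i hiM hic⟩, hic⟩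
    -- `Option` supplies a default value for components outside the set, since `Fin n` may be empty.
    choose! r hr hrc using fun (c : SCC (adjacencyGraph A)) (hc) =>
      (show ∃ i : Option (Fin n), ∃ j, i = some j ∧ j ∈ (I : Set (Fin n)) \ unmatched M ∧
        sccOf (adjacencyGraph A) j = c from let ⟨i, hi, hic⟩ := hrep c hc; ⟨some i, i, rfl, hi, hic⟩)
    have h1 := Set.ncard_le_ncard_of_injOn
      (s := {c : SCC (adjacencyGraph A) | IsSourceSCC (adjacencyGraph A) c ∧
        ∀ v ∈ unmatched M, sccOf (adjacencyGraph A) v ≠ c})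
      (t := some '' ((I : Set (Fin n)) \ unmatched M)) r
      (fun c hc => by
        rw [(hrc c hc).1]
        exact ⟨_, (hrc c hc).2.1, rfl⟩)
      (fun c hc d hd hcd => by
        rw [(hrc c hc).1, (hrc d hd).1] at hcd
        rw [← (hrc c hc).2.2, ← (hrc d hd).2.2, Option.some_injective _ hcd])
    rw [(Option.some_injective _).injOn.ncard_image] at h1
    have h2 := Set.ncard_sdiff_add_ncard_of_subset hMI
    rw [Set.ncard_coe_finset] at h2
    unfold matchingCost
    omega

theorem card_le_ncard_source {M : Finset (Fin n × Fin n)} {K : Finset (Fin n)}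
    (hs : ∀ k ∈ K, IsSourceSCC (adjacencyGraph A) (sccOf (adjacencyGraph A) k) ∧
      ∀ v ∈ unmatched M, sccOf (adjacencyGraph A) v ≠ sccOf (adjacencyGraph A) k)
    (hinj : Set.InjOn (sccOf (adjacencyGraph A)) K) :
    K.card ≤ {c : SCC (adjacencyGraph A) | IsSourceSCC (adjacencyGraph A) c ∧
      ∀ v ∈ unmatched M, sccOf (adjacencyGraph A) v ≠ c}.ncard := by
  rw [← Set.ncard_coe_finset]
  exact Set.ncard_le_ncard_of_injOn _ (fun k hk => hs k hk) hinj

/-- Source components not already met by an unmatched vertex each receive one representative outside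
`F`; then every source component is met. -/
theorem exists_isFeasible_of_matching {M : Finset (Fin n × Fin n)}
    (hM : IsAllowedMatching (adjacencyGraph A) F M)
    (h2 : ∀ c, IsSourceSCC (adjacencyGraph A) c → ∃ v, sccOf (adjacencyGraph A) v = c ∧ v ∉ F) :
    ∃ J, IsFeasible A F J ∧ J.card ≤ matchingCost (adjacencyGraph A) M := by
  classical
  choose r hr hrF using h2
  let S : Set (SCC (adjacencyGraph A)) := {c | IsSourceSCC (adjacencyGraph A) c ∧
      ∀ v ∈ unmatched M, sccOf (adjacencyGraph A) v ≠ c}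
  let K : Finset (Fin n) := Finset.univ.filter fun k => ∃ (c : SCC (adjacencyGraph A)) (hc : c ∈ S), k = r c hc.1
  let U : Finset (Fin n) := (unmatched M).toFinset
  have hU : ∀ v, v ∈ U ↔ v ∈ unmatched M := fun v => by simp [U]
  have hK : ∀ k, k ∈ K ↔ ∃ (c : SCC (adjacencyGraph A)) (hc : c ∈ S), k = r c hc.1 := fun k => by
    simp [K]
  refine ⟨U ∪ K, isFeasible_of_matching ?_ hM.1 ?_ ?_, ?_⟩
  · rw [Finset.disjoint_left]
    intro v hv hvF
    rcases Finset.mem_union.1 hv with h | h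
    · have : v ∈ unmatched M ∩ (F : Set (Fin n)) := ⟨(hU v).1 h, hvF⟩
      rw [hM.2] at this
      exact this
    · obtain ⟨c, hc, rfl⟩ := (hK v).1 h
      exact hrF c hc.1 hvF
  · intro v hv
    exact Finset.mem_coe.2 (Finset.mem_union_left _ ((hU v).2 hv))
  · refine reaches_of_source (J := ((U ∪ K : Finset (Fin n)) : Set (Fin n))) fun c hc => ?_
    by_cases h : ∀ v ∈ unmatched M, sccOf (adjacencyGraph A) v ≠ c
    · exact ⟨r c hc, Finset.mem_coe.2 (Finset.mem_union_right _ ((hK _).2 ⟨c, ⟨hc, h⟩, rfl⟩)), hr c hc⟩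
    · push Not at h
      obtain ⟨v, hv, hvc⟩ := h
      exact ⟨v, Finset.mem_coe.2 (Finset.mem_union_left _ ((hU v).2 hv)), hvc⟩
  · refine (Finset.card_union_le _ _).trans (Nat.add_le_add ?_ (card_le_ncard_source ?_ ?_))
    · rw [Set.ncard_eq_toFinset_card']
    · intro k hk
      obtain ⟨c, hc, rfl⟩ := (hK k).1 hk
      rw [hr c hc.1]
      exact hc
    · intro k hk l hl hkl
      obtain ⟨c, hc, rfl⟩ := (hK k).1 hk
      obtain ⟨d, hd, rfl⟩ := (hK l).1 hl
      rw [hr c hc.1, hr d hd.1] at hkl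
      subst hkl
      rfl

theorem IsFeasible.source_meets (h : IsFeasible A F I) :
    ∀ c, IsSourceSCC (adjacencyGraph A) c → ∃ v, sccOf (adjacencyGraph A) v = c ∧ v ∉ F := by
  intro c hc
  obtain ⟨i, hi, hic⟩ := source_meets_of_reaches (J := (I : Set (Fin n))) h.reaches hc
  exact ⟨i, hic, Finset.disjoint_left.1 h.1 hi⟩

theorem problemSolvable_iff_exists_isFeasible : ProblemSolvable A F ↔ ∃ I, IsFeasible A F I := by
  refine ⟨fun ⟨I, hI⟩ => ⟨I, hI.1⟩, fun ⟨I, hI⟩ => ?_⟩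
  obtain ⟨J, hJ, hmin⟩ := Set.exists_min_image {J | IsFeasible A F J} Finset.card
    (Set.toFinite _) ⟨I, hI⟩
  exact ⟨J, hJ, hmin⟩

theorem problemSolvable_iff : ProblemSolvable A F ↔
    (∃ M, IsAllowedMatching (adjacencyGraph A) F M) ∧
      ∀ c, IsSourceSCC (adjacencyGraph A) c → ∃ v, sccOf (adjacencyGraph A) v = c ∧ v ∉ F := by
  rw [problemSolvable_iff_exists_isFeasible]
  constructor
  · rintro ⟨I, hI⟩
    obtain ⟨M, hM, -⟩ := hI.exists_matchingCost_le
    exact ⟨⟨M, hM⟩, hI.source_meets⟩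
  · rintro ⟨⟨M, hM⟩, h2⟩
    obtain ⟨J, hJ, -⟩ := exists_isFeasible_of_matching hM h2
    exact ⟨J, hJ⟩

theorem optimalValue_eq_minMatchingCost
    (h2 : ∀ c, IsSourceSCC (adjacencyGraph A) c → ∃ v, sccOf (adjacencyGraph A) v = c ∧ v ∉ F) :
    optimalValue A F = minMatchingCost (adjacencyGraph A) F := by
  apply le_antisymm
  · refine le_iInf₂ fun M hM => ?_
    obtain ⟨J, hJ, hJM⟩ := exists_isFeasible_of_matching hM h2
    exact (iInf₂_le J hJ).trans (by exact_mod_cast hJM)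
  · refine le_iInf₂ fun J hJ => ?_
    obtain ⟨M, hM, hMJ⟩ := hJ.exists_matchingCost_le
    exact (iInf₂_le M hM).trans (by exact_mod_cast hMJ)

/-- The unmatched vertices of a minimum cost allowed matching, together with one vertex outside
`F` for each source component without an unmatched vertex, are an optimal set. -/
theorem isOptimal_union {M : Finset (Fin n × Fin n)}
    (hM : IsMinCostAllowedMatching (adjacencyGraph A) F M) {U K : Finset (Fin n)}
    (hU : ∀ v, v ∈ U ↔ v ∈ unmatched M) (hKF : Disjoint K F)
    (hr : ∀ v, ∃ i ∈ U ∪ K, ReflTransGen (adjacencyGraph A).Adj i v)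
    (hK : ∀ i ∈ U ∪ K, ∀ k ∈ K, ReflTransGen (adjacencyGraph A).Adj i k → i = k)
    (hUK : Disjoint U K) :
    IsOptimal A F (U ∪ K) := by
  refine ⟨isFeasible_of_matching ?_ hM.1.1 ?_ hr, fun J hJ => ?_⟩
  · rw [Finset.disjoint_union_left]
    refine ⟨?_, hKF⟩
    rw [Finset.disjoint_left]
    intro v hv hvF
    have : v ∈ unmatched M ∩ (F : Set (Fin n)) := ⟨(hU v).1 hv, hvF⟩
    rw [hM.1.2] at this
    exact this
  · intro v hv
    exact Finset.mem_coe.2 (Finset.mem_union_left _ ((hU v).2 hv))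
  · obtain ⟨N, hN, hNJ⟩ := hJ.exists_matchingCost_le
    refine le_trans ?_ ((hM.2 N hN).trans hNJ)
    refine (Finset.card_union_le _ _).trans (Nat.add_le_add ?_ (card_le_ncard_source ?_ ?_))
    · have : unmatched M = (U : Set (Fin n)) := by ext v; simp [hU]
      rw [this, Set.ncard_coe_finset]
    · intro k hk
      -- If `u` reaches `k`, the chosen vertex that reaches `u` also reaches `k`, so it is `k`
      -- itself and `k` reaches `u`. Hence the component of `k` is a source.
      refine ⟨isSourceSCC_sccOf fun u hu => ?_, fun v hv hvk => ?_⟩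
      · obtain ⟨i, hi, hiu⟩ := hr u
        rwa [← hK i hi k hk (hiu.trans hu)]
      · have hvU := (hU v).2 hv
        have := hK v (Finset.mem_union_left _ hvU) k hk (sccOf_eq_iff.1 hvk).1
        subst this
        exact Finset.disjoint_left.1 hUK hvU hk
    · intro k hk l hl hkl
      exact hK k (Finset.mem_union_right _ hk) l hl (sccOf_eq_iff.1 hkl).1

/-! ### A structured programming language for the random access machine -/

/-- Registers. -/
inductive Reg where
  | num | numE | numF | numM | idx | xv | yv | cur | ptr | tmp | cnt | top | one
  | len (k : Fin 3)
deriving DecidableEq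

/-- Arrays. -/
inductive Arr where
  | head | tgt | nxt | forb | mat | stk
  | lst (k : Fin 3)
  | mark (k : Fin 2)
deriving DecidableEq

/-- The memory cell of a register. -/
def Reg.cell : Reg → ℕ
  | .num => 4 | .numE => 6 | .numF => 8 | .numM => 10 | .idx => 12 | .xv => 14 | .yv => 16
  | .cur => 18 | .ptr => 20 | .tmp => 22 | .cnt => 24 | .top => 26 | .one => 28
  | .len k => 30 + 2 * k

/-- Position of the memory cell of the `i`-th entry of an array, for `i = 0`. -/
def Arr.offset : Arr → ℕ
  | .head => 1 | .tgt => 3 | .nxt => 5 | .forb => 7 | .mat => 9 | .stk => 11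
  | .lst k => 13 + 2 * k
  | .mark k => 19 + 2 * k

/-- The memory cell of the `i`-th entry of an array. -/
def Arr.cell (a : Arr) (i : ℕ) : ℕ := 32 * i + a.offset

/-- Registers sit in even cells from 4 on, arrays in odd cells interleaved with period 32. Cells 0
and 2 are left free as scratch space for address computations. -/
theorem Reg.cell_injective : Function.Injective Reg.cell := by
  intro a b h
  cases a <;> cases b <;> simp_all [Reg.cell] <;> omega

theorem Reg.four_le_cell (r : Reg) : 4 ≤ r.cell := by
  cases r <;> simp [Reg.cell]
  omega

theorem Reg.cell_mod (r : Reg) : r.cell % 2 = 0 := by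
  cases r <;> simp [Reg.cell]

theorem Arr.offset_injective : Function.Injective Arr.offset := by
  intro a b h
  cases a <;> cases b <;> simp_all [Arr.offset] <;> omega

theorem Arr.offset_lt (a : Arr) : a.offset < 32 := by
  cases a <;> simp [Arr.offset] <;> omega

theorem Arr.offset_mod (a : Arr) : a.offset % 2 = 1 := by
  cases a <;> simp [Arr.offset]

theorem Arr.cell_inj {a b : Arr} {i j : ℕ} : a.cell i = b.cell j ↔ a = b ∧ i = j := by
  constructor
  · intro h
    have h1 := a.offset_lt
    have h2 := b.offset_lt
    unfold Arr.cell at h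
    exact ⟨Arr.offset_injective (by omega), by omega⟩
  · rintro ⟨rfl, rfl⟩; rfl

theorem Arr.cell_ne_regCell (a : Arr) (i : ℕ) (r : Reg) : a.cell i ≠ r.cell := by
  have h1 := a.offset_mod
  have h2 := r.cell_mod
  unfold Arr.cell
  omega

theorem Arr.cell_ne_zero (a : Arr) (i : ℕ) : a.cell i ≠ 0 := by
  have h1 := a.offset_mod
  unfold Arr.cell
  omega

theorem Arr.cell_ne_two (a : Arr) (i : ℕ) : a.cell i ≠ 2 := by
  have h1 := a.offset_mod
  unfold Arr.cell
  omega

/-- The state of a structured program. -/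
structure St where
  reg : Reg → ℕ
  arr : Arr → ℕ → ℕ
  inp : List ℕ
  out : List ℕ

/-- Assign to a register. -/
def St.set (σ : St) (r : Reg) (k : ℕ) : St := { σ with reg := Function.update σ.reg r k }

/-- Assign to an array entry. -/
def St.setArr (σ : St) (a : Arr) (i k : ℕ) : St :=
  { σ with arr := Function.update σ.arr a (Function.update (σ.arr a) i k) }

/-- Elementary operations. -/
inductive Op where
  | const (r : Reg) (k : ℕ)
  | mov (r s : Reg)
  | add (r s t : Reg)
  | sub (r s t : Reg)
  | ld (r : Reg) (a : Arr) (i : Reg)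
  | st (a : Arr) (i r : Reg)
  | rd (r : Reg)
  | wr (r : Reg)

/-- The effect of an elementary operation. -/
def Op.eff : Op → St → St
  | .const r k, σ => σ.set r k
  | .mov r s, σ => σ.set r (σ.reg s)
  | .add r s t, σ => σ.set r (σ.reg s + σ.reg t)
  | .sub r s t, σ => σ.set r (σ.reg s - σ.reg t)
  | .ld r a i, σ => σ.set r (σ.arr a (σ.reg i))
  | .st a i r, σ => σ.setArr a (σ.reg i) (σ.reg r)
  | .rd r, σ => { σ.set r (σ.inp.headD 0) with inp := σ.inp.tail }
  | .wr r, σ => { σ with out := σ.out ++ [σ.reg r] }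

/-- Computes the address of an array entry in cell `0`. -/
def addressCode (a : Arr) (i : Reg) : List Instr :=
  [.copy 0 i.cell, .add 0 0 0, .add 0 0 0, .add 0 0 0, .add 0 0 0, .add 0 0 0,
    .const 2 a.offset, .add 0 0 2]

/-- Machine code of an elementary operation. -/
def Op.code : Op → List Instr
  | .const r k => [.const r.cell k]
  | .mov r s => [.copy r.cell s.cell]
  | .add r s t => [.add r.cell s.cell t.cell]
  | .sub r s t => [.sub r.cell s.cell t.cell]
  | .ld r a i => addressCode a i ++ [.load r.cell 0]
  | .st a i r => addressCode a i ++ [.store 0 r.cell]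
  | .rd r => [.read r.cell]
  | .wr r => [.write r.cell]

/-- Structured programs. -/
inductive Cmd where
  | op (o : Op)
  | seq (c d : Cmd)
  /-- if `r` is zero then `c` -/
  | ifz (r : Reg) (c : Cmd)
  /-- while `r` is not zero do `c` -/
  | loop (r : Reg) (c : Cmd)

/-- Length of the machine code. -/
def Cmd.size : Cmd → ℕ
  | .op o => o.code.length
  | .seq c d => c.size + d.size
  | .ifz _ c => c.size + 2
  | .loop _ c => c.size + 2

/-- Machine code of a structured program that is to be placed at address `s`. -/
def Cmd.code : Cmd → ℕ → List Instr
  | .op o, _ => o.code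
  | .seq c d, s => c.code s ++ d.code (s + c.size)
  | .ifz r c, s => .jumpZero r.cell (s + 2) :: .jump (s + 2 + c.size) :: c.code (s + 2)
  | .loop r c, s => .jumpZero r.cell (s + c.size + 2) :: (c.code (s + 1) ++ [.jump s])

theorem Cmd.length_code (c : Cmd) (s : ℕ) : (c.code s).length = c.size := by
  induction c generalizing s with
  | op o => rfl
  | seq c d hc hd => simp [Cmd.code, Cmd.size, hc, hd]
  | ifz r c hc => simp [Cmd.code, Cmd.size, hc]
  | loop r c hc => simp [Cmd.code, Cmd.size, hc]

/-! ### Semantics of structured programs and correctness of the compiler -/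

/-- Execution of a structured program in exactly `t` machine steps. -/
inductive Exec : Cmd → St → ℕ → St → Prop
  | op (o : Op) (σ : St) : Exec (.op o) σ o.code.length (o.eff σ)
  | seq {c d σ σ' σ'' t t'} : Exec c σ t σ' → Exec d σ' t' σ'' → Exec (.seq c d) σ (t + t') σ''
  | ifz_zero {r c σ t σ'} : σ.reg r = 0 → Exec c σ t σ' → Exec (.ifz r c) σ (1 + t) σ'
  | ifz_pos {r c σ} : σ.reg r ≠ 0 → Exec (.ifz r c) σ 2 σ
  | loop_zero {r c σ} : σ.reg r = 0 → Exec (.loop r c) σ 1 σ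
  | loop_pos {r c σ σ' σ'' t t'} : σ.reg r ≠ 0 → Exec c σ t σ' → Exec (.loop r c) σ' t' σ'' →
      Exec (.loop r c) σ (1 + (t + (1 + t'))) σ''

/-- A machine configuration represents a state. -/
structure Represents (c : Config) (σ : St) : Prop where
  reg : ∀ r : Reg, c.mem r.cell = σ.reg r
  arr : ∀ (a : Arr) (i : ℕ), c.mem (a.cell i) = σ.arr a i
  inp : c.input = σ.inp
  out : c.output = σ.out

theorem Represents.of_eq {c d : Config} {σ : St} (h : Represents c σ) (hm : d.mem = c.mem)
    (hi : d.input = c.input) (ho : d.output = c.output) : Represents d σ :=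
  ⟨fun r => by rw [hm, h.reg], fun a i => by rw [hm, h.arr], hi.trans h.inp, ho.trans h.out⟩

theorem Reaches.trans {P : List Instr} {t t' : ℕ} {c d e : Config} (h : Reaches P t c d)
    (h' : Reaches P t' d e) : Reaches P (t + t') c e := by
  induction t generalizing c with
  | zero => cases h; simpa using h'
  | succ t ih =>
    obtain ⟨c', hs, hr⟩ := h
    rw [Nat.succ_add]
    exact ⟨c', hs, ih hr⟩

theorem Reaches.single {P : List Instr} {c d : Config} (h : step P c = some d) : Reaches P 1 c d :=
  ⟨d, h, rfl⟩

theorem step_append {pre post : List Instr} {ins : Instr} {c : Config} (h : c.pc = pre.length) :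
    step (pre ++ ins :: post) c = ins.exec c := by
  simp [step, h]

/-- Execution of a list of instructions, one after the other. -/
def execList : List Instr → Config → Option Config
  | [], c => some c
  | i :: l, c => (i.exec c).bind (execList l)

/-- Instructions other than jumps and `halt`. -/
def Instr.IsStraight : Instr → Prop
  | .jump _ => False
  | .jumpZero _ _ => False
  | .halt => False
  | _ => True

theorem Instr.IsStraight.pc {i : Instr} (h : i.IsStraight) {c d : Config} (hd : i.exec c = some d) :
    d.pc = c.pc + 1 := by
  cases i <;> simp_all [Instr.exec, Instr.IsStraight, Config.put] <;> subst hd <;> rfl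

theorem reaches_execList {l : List Instr} (hl : ∀ i ∈ l, i.IsStraight) {pre post : List Instr}
    {c d : Config} (hc : c.pc = pre.length) (hd : execList l c = some d) :
    Reaches (pre ++ l ++ post) l.length c d ∧ d.pc = c.pc + l.length := by
  induction l generalizing pre c with
  | nil => simp [execList] at hd; subst hd; exact ⟨rfl, rfl⟩
  | cons i l ih =>
    simp only [execList, Option.bind_eq_some_iff] at hd
    obtain ⟨c', hi, hd⟩ := hd
    have hpc := (hl i (by simp)).pc hi
    have := ih (fun j hj => hl j (by simp [hj])) (pre := pre ++ [i]) (c := c')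
      (by simp [hpc, hc]) hd
    rw [show pre ++ [i] ++ l ++ post = pre ++ i :: l ++ post by simp] at this
    refine ⟨⟨c', ?_, this.1⟩, by rw [this.2, hpc]; simp; omega⟩
    rw [show pre ++ i :: l ++ post = pre ++ i :: (l ++ post) by simp, step_append hc, hi]

theorem Op.isStraight_code (o : Op) : ∀ i ∈ o.code, i.IsStraight := by
  cases o <;> simp [Op.code, Instr.IsStraight, addressCode]

theorem Op.execList_code (o : Op) {c : Config} {σ : St} (h : Represents c σ) :
    ∃ d, execList o.code c = some d ∧ Represents d (o.eff σ) := by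
  have h4 : ∀ r : Reg, r.cell ≠ 0 ∧ r.cell ≠ 2 := fun r => by
    have := r.four_le_cell
    omega
  have upd : ∀ (r s : Reg) (k : ℕ), (Function.update c.mem r.cell k) s.cell =
      Function.update σ.reg r k s := by
    intro r s k
    by_cases hs : s = r
    · subst hs; simp
    · rw [Function.update_of_ne hs, Function.update_of_ne (fun he => hs (Reg.cell_injective he)), h.reg]
  have upda : ∀ (r : Reg) (a : Arr) (i k : ℕ), (Function.update c.mem r.cell k) (a.cell i) =
      σ.arr a i := by
    intro r a i k
    rw [Function.update_of_ne (a.cell_ne_regCell i r), h.arr]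
  -- Five doublings of the index and the addition of the offset give `32 * i + a.offset`.
  have addr : ∀ (a : Arr) (i : ℕ), i + i + (i + i) + (i + i + (i + i)) + (i + i + (i + i) +
      (i + i + (i + i))) + (i + i + (i + i) + (i + i + (i + i)) + (i + i + (i + i) +
      (i + i + (i + i)))) + a.offset = a.cell i := by
    intro a i; unfold Arr.cell; omega
  cases o with
  | const r k =>
    refine ⟨_, rfl, ⟨fun s => ?_, fun a i => ?_, h.inp, h.out⟩⟩
    · simp [Config.put, Op.eff, St.set, upd]
    · simp [Config.put, Op.eff, St.set, upda]
  | mov r s =>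
    refine ⟨_, rfl, ⟨fun s => ?_, fun a i => ?_, h.inp, h.out⟩⟩
    · simp [Config.put, Op.eff, St.set, upd, h.reg]
    · simp [Config.put, Op.eff, St.set, upda]
  | add r s t =>
    refine ⟨_, rfl, ⟨fun s => ?_, fun a i => ?_, h.inp, h.out⟩⟩
    · simp [Config.put, Op.eff, St.set, upd, h.reg]
    · simp [Config.put, Op.eff, St.set, upda]
  | sub r s t =>
    refine ⟨_, rfl, ⟨fun s => ?_, fun a i => ?_, h.inp, h.out⟩⟩
    · simp [Config.put, Op.eff, St.set, upd, h.reg]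
    · simp [Config.put, Op.eff, St.set, upda]
  | ld r a i =>
    refine ⟨_, rfl, ⟨fun s => ?_, fun b j => ?_, h.inp, h.out⟩⟩
    · by_cases hs : s = r
      · subst hs
        simp [Config.put, Op.eff, St.set, h.reg, addr, h.arr,
          Arr.cell_ne_zero, Arr.cell_ne_two]
      · have hs' : s.cell ≠ r.cell := fun he => hs (Reg.cell_injective he)
        simp [Config.put, Op.eff, St.set, h.reg, Function.update_apply, hs, hs', h4]
    · simp [Config.put, Op.eff, St.set, h.arr, Function.update_apply,
          Arr.cell_ne_zero, Arr.cell_ne_two, Arr.cell_ne_regCell]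
  | st a i r =>
    refine ⟨_, rfl, ⟨fun s => ?_, fun b j => ?_, h.inp, h.out⟩⟩
    · simp [Config.put, Op.eff, St.setArr, h.reg, addr, h4,
        (Arr.cell_ne_regCell _ _ _).symm]
    · by_cases hb : b = a
      · subst hb
        simp [Config.put, Op.eff, St.setArr, h.reg, h.arr, addr, Function.update_apply, h4,
          Arr.cell_ne_zero, Arr.cell_ne_two, Arr.cell_inj]
      · simp [Config.put, Op.eff, St.setArr, h.reg, h.arr, addr, h4,
          Arr.cell_ne_zero, Arr.cell_ne_two, Arr.cell_inj, hb]
  | rd r =>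
    refine ⟨_, rfl, ⟨fun s => ?_, fun a i => ?_, ?_, h.out⟩⟩
    · simp [Config.put, Op.eff, St.set, upd, h.inp]
    · simp [Config.put, Op.eff, St.set, upda]
    · simp [Op.eff, h.inp]
  | wr r =>
    refine ⟨_, rfl, ⟨h.reg, h.arr, h.inp, ?_⟩⟩
    simp [Op.eff, h.out, h.reg]

/-- Correctness of the compiler. -/
theorem Exec.reaches {cmd : Cmd} {σ σ' : St} {t : ℕ} (h : Exec cmd σ t σ') :
    ∀ {pre post : List Instr} {c : Config}, c.pc = pre.length → Represents c σ →
      ∃ d, Reaches (pre ++ cmd.code pre.length ++ post) t c d ∧ d.pc = pre.length + cmd.size ∧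
        Represents d σ' := by
  induction h with
  | op o σ =>
    intro pre post c hc hr
    obtain ⟨d, hd, hrd⟩ := o.execList_code hr
    have := reaches_execList (post := post) o.isStraight_code hc hd
    exact ⟨d, this.1, by rw [this.2, hc]; rfl, hrd⟩
  | @seq c₁ c₂ σ σ' σ'' t t' _ _ ih₁ ih₂ =>
    intro pre post c hc hr
    obtain ⟨d, hd, hdp, hdr⟩ := ih₁ (post := c₂.code (pre.length + c₁.size) ++ post) hc hr
    have hlen : (pre ++ c₁.code pre.length).length = pre.length + c₁.size := by
      simp [Cmd.length_code]
    obtain ⟨e, he, hep, her⟩ := ih₂ (pre := pre ++ c₁.code pre.length) (post := post)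
      (hdp.trans hlen.symm) hdr
    rw [hlen] at he hep
    refine ⟨e, ?_, by rw [hep, Cmd.size]; omega, her⟩
    simp only [Cmd.code, List.append_assoc] at hd he ⊢
    exact hd.trans he
  | @ifz_zero r c₁ σ t σ' h0 _ ih =>
    intro pre post c hc hr
    have hlen : (pre ++ [Instr.jumpZero r.cell (pre.length + 2), .jump (pre.length + 2 + c₁.size)]).length
      = pre.length + 2 := by simp
    obtain ⟨e, he, hep, her⟩ := ih (post := post)
      (pre := pre ++ [Instr.jumpZero r.cell (pre.length + 2), .jump (pre.length + 2 + c₁.size)])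
      (c := { c with pc := pre.length + 2 }) hlen.symm (hr.of_eq rfl rfl rfl)
    rw [hlen] at he hep
    refine ⟨e, (Reaches.single (d := { c with pc := pre.length + 2 }) ?_).trans ?_,
      by rw [hep, Cmd.size]; omega, her⟩
    · simp only [Cmd.code, List.append_assoc, List.cons_append]
      rw [step_append hc]
      simp [Instr.exec, hr.reg, h0]
    · simpa [Cmd.code] using he
  | @ifz_pos r c₁ σ h0 =>
    intro pre post c hc hr
    refine ⟨{ c with pc := pre.length + 2 + c₁.size }, ?_, by simp [Cmd.size]; omega,
      hr.of_eq rfl rfl rfl⟩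
    refine (Reaches.single (d := { c with pc := pre.length + 1 }) ?_).trans (Reaches.single ?_)
    · simp only [Cmd.code, List.append_assoc, List.cons_append]
      rw [step_append hc]
      simp [Instr.exec, hr.reg, h0, hc]
    · simp only [Cmd.code, List.append_assoc, List.cons_append]
      rw [show ∀ (i j : Instr) (l : List Instr), pre ++ i :: j :: l = (pre ++ [i]) ++ j :: l by simp,
        step_append (by simp)]
      rfl
  | @loop_zero r c₁ σ h0 =>
    intro pre post c hc hr
    refine ⟨{ c with pc := pre.length + c₁.size + 2 }, Reaches.single ?_, rfl,
      hr.of_eq rfl rfl rfl⟩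
    simp only [Cmd.code, List.append_assoc, List.cons_append]
    rw [step_append hc]
    simp [Instr.exec, hr.reg, h0]
  | @loop_pos r c₁ σ σ' σ'' t t' h0 _ _ ih₁ ih₂ =>
    intro pre post c hc hr
    have hlen : (pre ++ [Instr.jumpZero r.cell (pre.length + c₁.size + 2)]).length = pre.length + 1 := by
      simp
    obtain ⟨d, hd, hdp, hdr⟩ := ih₁ (post := .jump pre.length :: post)
      (pre := pre ++ [Instr.jumpZero r.cell (pre.length + c₁.size + 2)])
      (c := { c with pc := pre.length + 1 }) hlen.symm (hr.of_eq rfl rfl rfl)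
    rw [hlen] at hd hdp
    obtain ⟨e, he, hep, her⟩ := ih₂ (pre := pre) (post := post)
      (c := { d with pc := pre.length }) rfl (hdr.of_eq rfl rfl rfl)
    refine ⟨e, (Reaches.single (d := { c with pc := pre.length + 1 }) ?_).trans
      (Reaches.trans (d := d) ?_ ((Reaches.single (d := { d with pc := pre.length }) ?_).trans he)),
      hep, her⟩
    · simp only [Cmd.code, List.append_assoc, List.cons_append]
      rw [step_append hc]
      simp [Instr.exec, hr.reg, h0, hc]
    · simpa [Cmd.code] using hd
    · rw [show pre ++ (Cmd.loop r c₁).code pre.length ++ post =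
        (pre ++ .jumpZero r.cell (pre.length + c₁.size + 2) :: c₁.code (pre.length + 1)) ++
          .jump pre.length :: post by simp [Cmd.code],
        step_append (by simp [hdp, Cmd.length_code]; omega)]
      rfl

/-- The initial state. -/
def initSt (input : List ℕ) : St := ⟨fun _ => 0, fun _ _ => 0, input, []⟩

theorem Exec.haltsWith {cmd : Cmd} {input : List ℕ} {t : ℕ} {σ : St}
    (h : Exec cmd (initSt input) t σ) : HaltsWith (cmd.code 0) input t σ.out := by
  obtain ⟨d, hd, hdp, hdr⟩ := h.reaches (pre := []) (post := []) (c := initConfig input) rfl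
    ⟨fun _ => rfl, fun _ _ => rfl, rfl, rfl⟩
  refine ⟨d, by simpa using hd, ?_, hdr.out⟩
  -- The machine stops by running off the end of the program; the compiler emits no `halt`.
  have : (cmd.code 0)[d.pc]? = none := by
    rw [List.getElem?_eq_none_iff, Cmd.length_code, hdp]
    simp
  simp [step, this]

/-! ### Program logic with time credits -/

/-- From the state `σ` and with `T` time credits, `c` terminates, and `Q` holds for the remaining
credits and the final state. -/
def WP (c : Cmd) (σ : St) (T : ℕ) (Q : ℕ → St → Prop) : Prop :=
  ∃ t σ', Exec c σ t σ' ∧ t ≤ T ∧ Q (T - t) σ'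

theorem WP.op {o : Op} {σ : St} {T : ℕ} {Q : ℕ → St → Prop} (hT : o.code.length ≤ T)
    (h : Q (T - o.code.length) (o.eff σ)) : WP (.op o) σ T Q :=
  ⟨_, _, .op o σ, hT, h⟩

theorem WP.seq {c d : Cmd} {σ : St} {T : ℕ} {Q : ℕ → St → Prop}
    (h : WP c σ T fun T' σ' => WP d σ' T' Q) : WP (.seq c d) σ T Q := by
  obtain ⟨t, σ', he, ht, t', σ'', he', ht', hq⟩ := h
  exact ⟨_, _, .seq he he', by omega, by rwa [Nat.sub_sub] at hq⟩

theorem WP.ifz {r : Reg} {c : Cmd} {σ : St} {T : ℕ} {Q : ℕ → St → Prop} (hT : 2 ≤ T)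
    (h0 : σ.reg r = 0 → WP c σ (T - 1) Q) (h1 : σ.reg r ≠ 0 → Q (T - 2) σ) :
    WP (.ifz r c) σ T Q := by
  by_cases h : σ.reg r = 0
  · obtain ⟨t, σ', he, ht, hq⟩ := h0 h
    exact ⟨_, _, .ifz_zero h he, by omega, by rwa [Nat.sub_sub] at hq⟩
  · exact ⟨_, _, .ifz_pos h, hT, h1 h⟩

theorem WP.mono {c : Cmd} {σ : St} {T : ℕ} {Q Q' : ℕ → St → Prop} (h : WP c σ T Q)
    (hQ : ∀ T' σ', Q T' σ' → Q' T' σ') : WP c σ T Q' := by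
  obtain ⟨t, σ', he, ht, hq⟩ := h
  exact ⟨t, σ', he, ht, hQ _ _ hq⟩

/-! ### Frame conditions -/

/-- Whether an operation leaves a register unchanged. -/
def Op.keepsReg : Op → Reg → Prop
  | .const r _, s => s ≠ r
  | .mov r _, s => s ≠ r
  | .add r _ _, s => s ≠ r
  | .sub r _ _, s => s ≠ r
  | .ld r _ _, s => s ≠ r
  | .st _ _ _, _ => True
  | .rd r, s => s ≠ r
  | .wr _, _ => True

/-- Whether an operation leaves an array unchanged. -/
def Op.keepsArr : Op → Arr → Prop
  | .st a _ _, b => b ≠ a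
  | _, _ => True

/-- Whether an operation leaves the input tape unchanged. -/
def Op.keepsInp : Op → Prop
  | .rd _ => False
  | _ => True

/-- Whether an operation leaves the output tape unchanged. -/
def Op.keepsOut : Op → Prop
  | .wr _ => False
  | _ => True

/-- All elementary operations of a program have a property. -/
def Cmd.All (q : Op → Prop) : Cmd → Prop
  | .op o => q o
  | .seq c d => c.All q ∧ d.All q
  | .ifz _ c => c.All q
  | .loop _ c => c.All q

theorem Exec.preserves {α : Type*} {q : Op → Prop} {g : St → α} (hg : ∀ o σ, q o → g (o.eff σ) = g σ)
    {c : Cmd} {σ σ' : St} {t : ℕ} (h : Exec c σ t σ') (hc : c.All q) : g σ' = g σ := by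
  induction h with
  | op o σ => exact hg o σ hc
  | seq _ _ ih₁ ih₂ => exact (ih₂ hc.2).trans (ih₁ hc.1)
  | ifz_zero _ _ ih => exact ih hc
  | ifz_pos _ => rfl
  | loop_zero _ => rfl
  | loop_pos _ _ _ ih₁ ih₂ => exact (ih₂ hc).trans (ih₁ hc)

/-- `σ'` agrees with `σ` wherever the program `c` does not write. -/
structure Frame (c : Cmd) (σ σ' : St) : Prop where
  reg : ∀ r, c.All (fun o => o.keepsReg r) → σ'.reg r = σ.reg r
  arr : ∀ a, c.All (fun o => o.keepsArr a) → σ'.arr a = σ.arr a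
  inp : c.All Op.keepsInp → σ'.inp = σ.inp
  out : c.All Op.keepsOut → σ'.out = σ.out

theorem Frame.refl (c : Cmd) (σ : St) : Frame c σ σ := ⟨by simp, by simp, by simp, by simp⟩

theorem Frame.trans {c : Cmd} {σ σ' σ'' : St} (h : Frame c σ σ') (h' : Frame c σ' σ'') :
    Frame c σ σ'' :=
  ⟨fun r hr => (h'.reg r hr).trans (h.reg r hr), fun r hr => (h'.arr r hr).trans (h.arr r hr),
    fun hr => (h'.inp hr).trans (h.inp hr), fun hr => (h'.out hr).trans (h.out hr)⟩

theorem Exec.frame {c : Cmd} {σ σ' : St} {t : ℕ} (h : Exec c σ t σ') : Frame c σ σ' where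
  reg r := h.preserves (g := fun σ => σ.reg r) fun o σ ho => by
    cases o <;> simp_all [Op.eff, St.set, St.setArr, Op.keepsReg]
  arr a := h.preserves (g := fun σ => σ.arr a) fun o σ ho => by
    cases o <;> simp_all [Op.eff, St.set, St.setArr, Op.keepsArr]
  inp := h.preserves (g := St.inp) fun o σ ho => by
    cases o <;> simp_all [Op.eff, St.set, St.setArr, Op.keepsInp]
  out := h.preserves (g := St.out) fun o σ ho => by
    cases o <;> simp_all [Op.eff, St.set, St.setArr, Op.keepsOut]

theorem WP.frame {c : Cmd} {σ : St} {T : ℕ} {Q : ℕ → St → Prop} (h : WP c σ T Q) :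
    WP c σ T fun T' σ' => Q T' σ' ∧ Frame c σ σ' := by
  obtain ⟨t, σ', he, ht, hq⟩ := h
  exact ⟨t, σ', he, ht, hq, he.frame⟩

/-- The rule for loops: credits also bound the number of iterations. -/
theorem WP.loop {r : Reg} {c : Cmd} {σ : St} {T : ℕ} {Q : ℕ → St → Prop} (Inv : ℕ → St → Prop)
    (h0 : Inv T σ)
    (hexit : ∀ T' σ', Inv T' σ' → Frame c σ σ' → σ'.reg r = 0 → 1 ≤ T' ∧ Q (T' - 1) σ')
    (hstep : ∀ T' σ', Inv T' σ' → Frame c σ σ' → σ'.reg r ≠ 0 → 1 ≤ T' ∧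
      WP c σ' (T' - 1) fun T'' σ'' => 1 ≤ T'' ∧ Inv (T'' - 1) σ'') :
    WP (.loop r c) σ T Q := by
  suffices H : ∀ T' σ', Inv T' σ' → Frame c σ σ' → WP (.loop r c) σ' T' Q from
    H T σ h0 (Frame.refl c σ)
  -- The credits serve as the variant: a round pays one step for the test and one for the jump back.
  intro T'
  induction T' using Nat.strong_induction_on with
  | _ T' ih =>
    intro σ' hi hf
    by_cases hr : σ'.reg r = 0
    · obtain ⟨h1, hq⟩ := hexit T' σ' hi hf hr
      exact ⟨1, σ', .loop_zero hr, h1, hq⟩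
    · obtain ⟨h1, t, σ'', he, ht, h2, hi'⟩ := hstep T' σ' hi hf hr
      obtain ⟨t', σ₃, he', ht', hq⟩ := ih _ (by omega) σ'' hi' (hf.trans he.frame)
      refine ⟨_, σ₃, .loop_pos hr he he', by omega, ?_⟩
      rwa [show T' - (1 + (t + (1 + t'))) = T' - 1 - t - 1 - t' by omega]

/-! ### Symbolic execution -/

theorem wp_op {o : Op} {σ : St} {T : ℕ} {Q : ℕ → St → Prop} :
    WP (.op o) σ T Q ↔ o.code.length ≤ T ∧ Q (T - o.code.length) (o.eff σ) := by
  constructor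
  · rintro ⟨t, σ', he, ht, hq⟩
    cases he
    exact ⟨ht, hq⟩
  · exact fun h => WP.op h.1 h.2

theorem wp_seq {c d : Cmd} {σ : St} {T : ℕ} {Q : ℕ → St → Prop} :
    WP (.seq c d) σ T Q ↔ WP c σ T fun T' σ' => WP d σ' T' Q := by
  constructor
  · rintro ⟨_, σ'', he, ht, hq⟩
    cases he with
    | seq h₁ h₂ => exact ⟨_, _, h₁, by omega, _, _, h₂, by omega, by rwa [Nat.sub_sub]⟩
  · exact WP.seq

@[simp] theorem St.set_reg (σ : St) (r s : Reg) (k : ℕ) :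
    (σ.set r k).reg s = if s = r then k else σ.reg s := by
  simp [St.set, Function.update_apply]

@[simp] theorem St.set_arr (σ : St) (r : Reg) (k : ℕ) : (σ.set r k).arr = σ.arr := rfl

@[simp] theorem St.set_inp (σ : St) (r : Reg) (k : ℕ) : (σ.set r k).inp = σ.inp := rfl

@[simp] theorem St.set_out (σ : St) (r : Reg) (k : ℕ) : (σ.set r k).out = σ.out := rfl

@[simp] theorem St.setArr_reg (σ : St) (a : Arr) (i k : ℕ) : (σ.setArr a i k).reg = σ.reg := rfl

@[simp] theorem St.setArr_inp (σ : St) (a : Arr) (i k : ℕ) : (σ.setArr a i k).inp = σ.inp := rfl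

@[simp] theorem St.setArr_arr (σ : St) (a b : Arr) (i k : ℕ) :
    (σ.setArr a i k).arr b = if b = a then Function.update (σ.arr a) i k else σ.arr b := by
  by_cases h : b = a
  · subst h; simp [St.setArr]
  · simp [St.setArr, h]

@[simp] theorem length_addressCode (a : Arr) (i : Reg) : (addressCode a i).length = 8 := rfl

/-! ### Stacks and linked lists in arrays -/

/-- The entries `1, …, k` of an array, read from `k` down to `1`, are the list `l`. -/
def IsStack (a : ℕ → ℕ) : List ℕ → ℕ → Prop
  | [], k => k = 0
  | x :: l, k => ∃ j, k = j + 1 ∧ a k = x ∧ IsStack a l j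

theorem IsStack.length {a : ℕ → ℕ} {l : List ℕ} {k : ℕ} (h : IsStack a l k) : k = l.length := by
  induction l generalizing k with
  | nil => exact h
  | cons x l ih =>
    obtain ⟨j, rfl, -, h⟩ := h
    simp [← ih h]

theorem IsStack.congr {a b : ℕ → ℕ} {l : List ℕ} {k : ℕ} (h : IsStack a l k)
    (hab : ∀ i ≤ k, b i = a i) : IsStack b l k := by
  induction l generalizing k with
  | nil => exact h
  | cons x l ih =>
    obtain ⟨j, rfl, hx, h⟩ := h
    exact ⟨j, rfl, (hab _ le_rfl).trans hx, ih h fun i hi => hab i (by omega)⟩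

theorem IsStack.push {a : ℕ → ℕ} {l : List ℕ} {k : ℕ} (h : IsStack a l k) (x : ℕ) :
    IsStack (Function.update a (k + 1) x) (x :: l) (k + 1) :=
  ⟨k, rfl, by simp, h.congr fun i hi => by rw [Function.update_of_ne (by omega)]⟩

theorem IsStack.exists_cons {a : ℕ → ℕ} {l : List ℕ} {k : ℕ} (h : IsStack a l k) (hk : k ≠ 0) :
    ∃ l', l = a k :: l' ∧ IsStack a l' (k - 1) := by
  cases l with
  | nil => exact absurd h hk
  | cons x l =>
    obtain ⟨j, rfl, rfl, h⟩ := h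
    exact ⟨l, rfl, h⟩

theorem IsStack.eq_nil {a : ℕ → ℕ} {l : List ℕ} (h : IsStack a l 0) : l = [] :=
  List.length_eq_zero_iff.1 h.length.symm

/-- `l` is the list of the entries of `tg` along the pointers `nx`, beginning with `p`; all pointers
are at most `c`. -/
def IsLinked (tg nx : ℕ → ℕ) (c : ℕ) : List ℕ → ℕ → Prop
  | [], p => p = 0
  | y :: l, p => p ≠ 0 ∧ p ≤ c ∧ tg p = y ∧ IsLinked tg nx c l (nx p)

/-- The new record is stored at `c + 1`, beyond every pointer of the list. -/
theorem IsLinked.update {tg nx : ℕ → ℕ} {c : ℕ} {l : List ℕ} {p : ℕ} (h : IsLinked tg nx c l p)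
    (a b : ℕ) : IsLinked (Function.update tg (c + 1) a) (Function.update nx (c + 1) b) (c + 1) l p := by
  induction l generalizing p with
  | nil => exact h
  | cons y l ih =>
    obtain ⟨h0, hc, hy, h⟩ := h
    refine ⟨h0, by omega, by rwa [Function.update_of_ne (by omega)], ?_⟩
    rw [Function.update_of_ne (by omega)]
    exact ih h

theorem IsLinked.exists_cons {tg nx : ℕ → ℕ} {c : ℕ} {l : List ℕ} {p : ℕ} (h : IsLinked tg nx c l p)
    (hp : p ≠ 0) : ∃ l', l = tg p :: l' ∧ IsLinked tg nx c l' (nx p) := by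
  cases l with
  | nil => exact absurd h hp
  | cons y l =>
    obtain ⟨-, -, rfl, h⟩ := h
    exact ⟨l, rfl, h⟩

theorem IsLinked.eq_nil {tg nx : ℕ → ℕ} {c : ℕ} {l : List ℕ} (h : IsLinked tg nx c l 0) : l = [] := by
  cases l with
  | nil => rfl
  | cons y l => exact absurd rfl h.1

/-- Adjacency lists of a list of edges. -/
def adj (E : List (ℕ × ℕ)) (v : ℕ) : List ℕ := (E.filter fun e => e.1 = v).map Prod.snd

theorem mem_adj {E : List (ℕ × ℕ)} {u v : ℕ} : u ∈ adj E v ↔ (v, u) ∈ E := by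
  simp [adj]

theorem adj_cons (E : List (ℕ × ℕ)) (s d v : ℕ) :
    adj ((s, d) :: E) v = if v = s then d :: adj E v else adj E v := by
  by_cases h : v = s
  · subst h; simp [adj]
  · simp [adj, h, Ne.symm h]

/-- Each edge is counted at most once, at its source, which need not be below `N`. -/
theorem sum_length_adj_le (E : List (ℕ × ℕ)) (N : ℕ) :
    ∑ v ∈ Finset.range N, (adj E v).length ≤ E.length := by
  induction E with
  | nil => simp [adj]
  | cons e E ih =>
    obtain ⟨s, d⟩ := e
    have : ∀ v, (adj ((s, d) :: E) v).length = (adj E v).length + if v = s then 1 else 0 := by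
      intro v
      rw [adj_cons]
      split_ifs <;> simp
    simp only [this, Finset.sum_add_distrib, Finset.sum_ite_eq', List.length_cons]
    split_ifs <;> omega

/-- The memory holds the adjacency lists of a list of edges. -/
structure HasGraph (σ : St) (E : List (ℕ × ℕ)) : Prop where
  one : σ.reg .one = 1
  chain : ∀ v, IsLinked (σ.arr .tgt) (σ.arr .nxt) (σ.reg .cnt) (adj E v) (σ.arr .head v)

theorem HasGraph.congr {σ σ' : St} {E : List (ℕ × ℕ)} (h : HasGraph σ E)
    (h1 : σ'.reg .one = σ.reg .one) (h2 : σ'.reg .cnt = σ.reg .cnt) (h3 : σ'.arr .tgt = σ.arr .tgt)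
    (h4 : σ'.arr .nxt = σ.arr .nxt) (h5 : σ'.arr .head = σ.arr .head) : HasGraph σ' E :=
  ⟨h1.trans h.one, by rw [h2, h3, h4, h5]; exact h.chain⟩

/-- Add the edge from `s` to `d`. -/
def addEdge (s d : Reg) : Cmd :=
  .seq (.op (.add .cnt .cnt .one)) <| .seq (.op (.st .tgt .cnt d)) <|
  .seq (.op (.ld .tmp .head s)) <| .seq (.op (.st .nxt .cnt .tmp)) <| .op (.st .head s .cnt)

/-- An array access takes 9 instructions, 8 of them for the address; 37 is one addition and four
accesses. -/
theorem wp_addEdge {s d : Reg} (hs : s ≠ .cnt ∧ s ≠ .tmp) (hd : d ≠ .cnt) {σ : St}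
    {E : List (ℕ × ℕ)} (h : HasGraph σ E) {T : ℕ} (hT : 37 ≤ T) :
    WP (addEdge s d) σ T fun T' σ' => T' = T - 37 ∧ HasGraph σ' ((σ.reg s, σ.reg d) :: E) := by
  simp only [addEdge, wp_seq, wp_op, Op.eff]
  simp only [Op.code, List.length_append, length_addressCode, List.length_singleton]
  refine ⟨by omega, by omega, by omega, by omega, by omega, by omega, ?_⟩
  refine ⟨by simp [h.one], fun v => ?_⟩
  rw [adj_cons]
  have hc := h.chain
  simp only [St.set_reg, St.setArr_reg, St.set_arr, St.setArr_arr, reduceCtorEq, if_true, if_false,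
    h.one, hs.1, hs.2, hd]
  by_cases hv : v = σ.reg s
  · subst hv
    simp only [if_true, Function.update_self]
    refine ⟨by omega, le_rfl, by simp, ?_⟩
    rw [Function.update_self]
    exact (hc _).update _ _
  · simp only [hv, if_false, Function.update_of_ne, ne_eq, not_false_eq_true]
    exact (hc v).update _ _

/-! ### Graph search -/

/-- State of a graph search: `mk` marks the visited vertices, `s` is the list of vertices still to be
expanded, `D` the set of expanded ones; of the edges leaving `x`, those to `rest` have not been
followed. All visited vertices satisfy `P`, and those in `B` have been visited. -/
structure IsSearch (nb : ℕ → List ℕ) (B : Finset ℕ) (P : ℕ → Prop) (mk : ℕ → ℕ) (s : List ℕ)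
    (D : Finset ℕ) (x : ℕ) (rest : List ℕ) : Prop where
  mem : ∀ v, mk v ≠ 0 ↔ v ∈ D ∨ v ∈ s
  nodup : s.Nodup
  disj : ∀ v ∈ s, v ∉ D
  closed : ∀ v ∈ D, ∀ u ∈ nb v, mk u ≠ 0 ∨ (v = x ∧ u ∈ rest)
  sound : ∀ v, mk v ≠ 0 → P v
  sound_rest : ∀ u ∈ rest, P u
  base : ∀ v ∈ B, mk v ≠ 0

theorem IsSearch.skip {nb : ℕ → List ℕ} {B : Finset ℕ} {P : ℕ → Prop} {mk : ℕ → ℕ} {s : List ℕ} {D : Finset ℕ}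
    {x u : ℕ} {rest : List ℕ} (h : IsSearch nb B P mk s D x (u :: rest)) (hu : mk u ≠ 0) :
    IsSearch nb B P mk s D x rest := by
  refine ⟨h.mem, h.nodup, h.disj, fun v hv w hw => ?_, h.sound,
    fun w hw => h.sound_rest w (List.mem_cons_of_mem _ hw), h.base⟩
  rcases h.closed v hv w hw with h1 | ⟨h1, h2⟩
  · exact Or.inl h1
  · rcases List.mem_cons.1 h2 with rfl | h3
    · exact Or.inl hu
    · exact Or.inr ⟨h1, h3⟩

theorem IsSearch.visit {nb : ℕ → List ℕ} {B : Finset ℕ} {P : ℕ → Prop} {mk : ℕ → ℕ} {s : List ℕ} {D : Finset ℕ}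
    {x u : ℕ} {rest : List ℕ} (h : IsSearch nb B P mk s D x (u :: rest)) (hu : mk u = 0) :
    IsSearch nb B P (Function.update mk u 1) (u :: s) D x rest := by
  have hu' : ¬ (u ∈ D ∨ u ∈ s) := fun h' => (h.mem u).2 h' hu
  have hmono : ∀ v, mk v ≠ 0 → Function.update mk u 1 v ≠ 0 := fun v hv => by
    by_cases hvu : v = u <;> simp [hvu, hv]
  refine ⟨fun v => ?_, ?_, ?_, fun v hv w hw => ?_, fun v hv => ?_,
    fun w hw => h.sound_rest w (List.mem_cons_of_mem _ hw), fun v hv => hmono v (h.base v hv)⟩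
  · by_cases hvu : v = u
    · simp [hvu]
    · simp [hvu, ← h.mem]
  · exact List.nodup_cons.2 ⟨fun h' => hu' (Or.inr h'), h.nodup⟩
  · intro v hv
    rcases List.mem_cons.1 hv with rfl | hv
    · exact fun h' => hu' (Or.inl h')
    · exact h.disj v hv
  · rcases h.closed v hv w hw with h1 | ⟨h1, h2⟩
    · exact Or.inl (hmono w h1)
    · rcases List.mem_cons.1 h2 with rfl | h3
      · exact Or.inl (by simp)
      · exact Or.inr ⟨h1, h3⟩
  · by_cases hvu : v = u
    · exact hvu ▸ h.sound_rest u (by simp)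
    · exact h.sound v (by simpa [Function.update_apply, hvu] using hv)

/-- All edges of `y` have been followed, so `x` can become the one vertex that is expanded but not
fully scanned. -/
theorem IsSearch.expand {nb : ℕ → List ℕ} {B : Finset ℕ} {P : ℕ → Prop} (hP : ∀ v, P v → ∀ u ∈ nb v, P u)
    {mk : ℕ → ℕ} {s : List ℕ} {D : Finset ℕ} {x y : ℕ} (h : IsSearch nb B P mk (x :: s) D y []) :
    IsSearch nb B P mk s (insert x D) x (nb x) := by
  have hn := List.nodup_cons.1 h.nodup
  refine ⟨fun v => ?_, hn.2, fun v hv => ?_, fun v hv u hu => ?_, h.sound, fun u hu => ?_, h.base⟩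
  · rw [h.mem, List.mem_cons, Finset.mem_insert]
    tauto
  · rw [Finset.mem_insert, not_or]
    exact ⟨fun h' => hn.1 (h' ▸ hv), h.disj v (List.mem_cons_of_mem _ hv)⟩
  · rcases Finset.mem_insert.1 hv with rfl | hv
    · exact Or.inr ⟨rfl, hu⟩
    · rcases h.closed v hv u hu with h1 | ⟨-, h2⟩
      · exact Or.inl h1
      · simp at h2
  · exact hP x (h.sound x ((h.mem x).2 (Or.inr (by simp)))) u hu

/-- The time credits needed for the expansion of all vertices below `N` that are not in `D`. -/
def searchCredits (nb : ℕ → List ℕ) (N : ℕ) (D : Finset ℕ) : ℕ :=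
  ∑ v ∈ Finset.range N \ D, (49 * (nb v).length + 22)

/-- This pays for one expansion. Per edge, 49 covers five array accesses, one addition, two tests
and a jump; 22 covers fetching the vertex, finding its adjacency list, and the control steps of both
loops. -/
theorem searchCredits_insert {nb : ℕ → List ℕ} {N x : ℕ} {D : Finset ℕ} (hx : x < N) (hD : x ∉ D) :
    searchCredits nb N D = searchCredits nb N (insert x D) + (49 * (nb x).length + 22) := by
  unfold searchCredits
  rw [Finset.sdiff_insert, Finset.sum_erase_add]
  simp [hx, hD]

theorem searchCredits_empty_le (E : List (ℕ × ℕ)) (N : ℕ) :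
    searchCredits (adj E) N ∅ ≤ 49 * E.length + 22 * N := by
  unfold searchCredits
  have := sum_length_adj_le E N
  simp only [Finset.sdiff_empty, Finset.sum_add_distrib, ← Finset.mul_sum, Finset.sum_const,
    Finset.card_range, smul_eq_mul]
  omega

/-- Follow the pointers from `ptr`, visiting unmarked vertices. -/
def scanCmd (k : Fin 2) : Cmd :=
  .loop .ptr <| .seq (.op (.ld .yv .tgt .ptr)) <| .seq (.op (.ld .ptr .nxt .ptr)) <|
  .seq (.op (.ld .tmp (.mark k) .yv)) <| .ifz .tmp <| .seq (.op (.st (.mark k) .yv .one)) <|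
  .seq (.op (.add .top .top .one)) <| .op (.st .stk .top .yv)

theorem wp_scanCmd {k : Fin 2} {σ : St} {nb : ℕ → List ℕ} {B : Finset ℕ} {P : ℕ → Prop} {s : List ℕ}
    {D : Finset ℕ} {x : ℕ} {rest : List ℕ} {T c₀ : ℕ} (h1 : σ.reg .one = 1)
    (hc : IsLinked (σ.arr .tgt) (σ.arr .nxt) (σ.reg .cnt) rest (σ.reg .ptr))
    (hs : IsStack (σ.arr .stk) s (σ.reg .top)) (h : IsSearch nb B P (σ.arr (.mark k)) s D x rest)
    (hT : 49 * rest.length + 1 + c₀ ≤ T) :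
    WP (scanCmd k) σ T fun T' σ' => c₀ ≤ T' ∧ ∃ s', IsStack (σ'.arr .stk) s' (σ'.reg .top) ∧
      IsSearch nb B P (σ'.arr (.mark k)) s' D x [] := by
  refine WP.loop (fun T' σ' => ∃ s' rest', IsStack (σ'.arr .stk) s' (σ'.reg .top) ∧
      IsSearch nb B P (σ'.arr (.mark k)) s' D x rest' ∧ 49 * rest'.length + 1 + c₀ ≤ T' ∧
      IsLinked (σ.arr .tgt) (σ.arr .nxt) (σ.reg .cnt) rest' (σ'.reg .ptr))
    ⟨s, rest, hs, h, hT, hc⟩ ?_ ?_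
  · rintro T' σ' ⟨s', rest', hs', h', hT', hc'⟩ - h0
    rw [h0] at hc'
    obtain rfl := hc'.eq_nil
    simp only [List.length_nil] at hT'
    exact ⟨by omega, by omega, s', hs', h'⟩
  · rintro T' σ' ⟨s', rest', hs', h', hT', hc'⟩ hf h0
    have f1 : σ'.reg .one = 1 := (hf.reg .one (by simp [Cmd.All, Op.keepsReg])).trans h1
    have f2 := hf.arr .tgt (by simp [Cmd.All, Op.keepsArr])
    have f3 := hf.arr .nxt (by simp [Cmd.All, Op.keepsArr])
    obtain ⟨rest'', rfl, hc''⟩ := hc'.exists_cons h0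
    simp only [List.length_cons] at hT'
    refine ⟨by omega, ?_⟩
    simp only [wp_seq, wp_op, Op.eff]
    simp only [Op.code, List.length_append, length_addressCode, List.length_singleton]
    refine ⟨by omega, by omega, by omega, WP.ifz (by omega) ?_ ?_⟩
    · intro ht
      simp only [wp_seq, wp_op, Op.eff]
      simp only [Op.code, List.length_append, length_addressCode, List.length_singleton]
      refine ⟨by omega, by omega, by omega, by omega,
        σ.arr .tgt (σ'.reg .ptr) :: s', rest'', ?_, ?_, by omega, ?_⟩
      · simpa [f1, f2] using hs'.push _
      · simp only [St.set_reg, St.setArr_reg, St.set_arr, St.setArr_arr, reduceCtorEq, if_true,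
          if_false, f1, f2] at ht ⊢
        exact h'.visit ht
      · simpa [f3] using hc''
    · intro ht
      refine ⟨by omega, s', rest'', ?_, ?_, by omega, ?_⟩
      · simpa using hs'
      · simp only [St.set_reg, St.set_arr, reduceCtorEq, if_true, if_false, f2] at ht ⊢
        exact h'.skip ht
      · simpa [f3] using hc''

/-- Expand all vertices on the stack. -/
def searchCmd (k : Fin 2) : Cmd :=
  .loop .top <| .seq (.op (.ld .xv .stk .top)) <| .seq (.op (.sub .top .top .one)) <|
  .seq (.op (.ld .ptr .head .xv)) <| scanCmd k

theorem wp_searchCmd {k : Fin 2} {σ : St} {E : List (ℕ × ℕ)} {B : Finset ℕ} {P : ℕ → Prop} {N : ℕ} {s : List ℕ}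
    {D : Finset ℕ} {x : ℕ} {T c₀ : ℕ} (hP : ∀ v, P v → ∀ u ∈ adj E v, P u) (hPN : ∀ v, P v → v < N)
    (hg : HasGraph σ E) (hs : IsStack (σ.arr .stk) s (σ.reg .top))
    (h : IsSearch (adj E) B P (σ.arr (.mark k)) s D x [])
    (hT : searchCredits (adj E) N D + 1 + c₀ ≤ T) :
    WP (searchCmd k) σ T fun T' σ' => σ'.reg .top = 0 ∧ ∃ D' x',
      searchCredits (adj E) N D' + c₀ ≤ T' ∧
      IsSearch (adj E) B P (σ'.arr (.mark k)) [] D' x' [] := by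
  refine WP.loop (fun T' σ' => ∃ s' D' x', IsStack (σ'.arr .stk) s' (σ'.reg .top) ∧
      IsSearch (adj E) B P (σ'.arr (.mark k)) s' D' x' [] ∧
      searchCredits (adj E) N D' + 1 + c₀ ≤ T') ⟨s, D, x, hs, h, hT⟩ ?_ ?_
  · rintro T' σ' ⟨s', D', x', hs', h', hT'⟩ - h0
    rw [h0] at hs'
    obtain rfl := hs'.eq_nil
    exact ⟨by omega, h0, D', x', by omega, h'⟩
  · rintro T' σ' ⟨s', D', x', hs', h', hT'⟩ hf h0
    have f1 := hf.reg .one (by simp [Cmd.All, Op.keepsReg, scanCmd])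
    have f2 := hf.arr .tgt (by simp [Cmd.All, Op.keepsArr, scanCmd])
    have f3 := hf.arr .nxt (by simp [Cmd.All, Op.keepsArr, scanCmd])
    have f4 := hf.arr .head (by simp [Cmd.All, Op.keepsArr, scanCmd])
    have f5 := hf.reg .cnt (by simp [Cmd.All, Op.keepsReg, scanCmd])
    have hg' := hg.congr f1 f5 f2 f3 f4
    obtain ⟨s'', rfl, hs''⟩ := hs'.exists_cons h0
    set w := σ'.arr .stk (σ'.reg .top) with hw
    have hwN : w < N := hPN w (h'.sound w ((h'.mem w).2 (Or.inr (by simp))))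
    rw [searchCredits_insert hwN (h'.disj w (by simp))] at hT'
    refine ⟨by omega, ?_⟩
    simp only [wp_seq, wp_op, Op.eff]
    simp only [Op.code, List.length_append, length_addressCode, List.length_singleton]
    refine ⟨by omega, by omega, by omega, ?_⟩
    refine (wp_scanCmd (nb := adj E) (B := B) (P := P) (s := s'') (D := insert w D') (x := w) (rest := adj E w)
      (c₀ := searchCredits (adj E) N (insert w D') + 2 + c₀)
      ?_ ?_ ?_ ?_ (by omega)).mono ?_
    · simpa using hg'.one
    · simpa using hg'.chain w
    · simpa [hg'.one] using hs''
    · simpa using h'.expand hP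
    · rintro T'' σ'' ⟨hT'', s₃, hs₃, h₃⟩
      exact ⟨by omega, s₃, insert w D', w, hs₃, h₃, by omega⟩

/-! ### Selecting roots by successive searches -/

open Classical in
/-- The elements of a list that are not related to any earlier element, or to an element of
`prev`. -/
noncomputable def roots (r : ℕ → ℕ → Prop) : List ℕ → List ℕ → List ℕ
  | _, [] => []
  | prev, v :: l => if ∃ u ∈ prev, r u v then roots r (v :: prev) l else v :: roots r (v :: prev) l

/-- Reachability in a list of edges. -/
def EdgeReach (E : List (ℕ × ℕ)) : ℕ → ℕ → Prop := Relation.ReflTransGen fun u v => v ∈ adj E u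

/-- Move the vertices that are not reachable from earlier ones from list `a` to list `b`. -/
def passCmd (a b : Fin 3) (k : Fin 2) : Cmd :=
  .loop (.len a) <| .seq (.op (.ld .cur (.lst a) (.len a))) <|
  .seq (.op (.sub (.len a) (.len a) .one)) <| .seq (.op (.ld .tmp (.mark k) .cur)) <| .ifz .tmp <|
  .seq (.op (.add (.len b) (.len b) .one)) <| .seq (.op (.st (.lst b) (.len b) .cur)) <|
  .seq (.op (.st (.mark k) .cur .one)) <| .seq (.op (.add .top .top .one)) <|
  .seq (.op (.st .stk .top .cur)) <| searchCmd k

/-- Marks are not cleared between searches, so the marked set is always what the entries processed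
so far reach, and an unmarked entry is exactly one to keep. Each vertex is expanded at most once in
the entire pass, so a single supply of search credits suffices; 60 per entry covers the remaining
work. -/
theorem wp_passCmd {a b : Fin 3} (hab : a ≠ b) {k : Fin 2} {σ : St} {E : List (ℕ × ℕ)} {N : ℕ}
    {l : List ℕ} {T c₀ : ℕ} (hE : ∀ u v, (u, v) ∈ E → v < N) (hl : ∀ v ∈ l, v < N)
    (hg : HasGraph σ E) (ha : IsStack (σ.arr (.lst a)) l (σ.reg (.len a)))
    (hb : σ.reg (.len b) = 0) (htop : σ.reg .top = 0) (hk : ∀ v, σ.arr (.mark k) v = 0)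
    (hT : searchCredits (adj E) N ∅ + 60 * l.length + 1 + c₀ ≤ T) :
    WP (passCmd a b k) σ T fun T' σ' => c₀ ≤ T' ∧ σ'.reg .top = 0 ∧
      IsStack (σ'.arr (.lst b)) (roots (EdgeReach E) [] l).reverse (σ'.reg (.len b)) := by
  refine WP.loop (fun T' σ' => ∃ prev rest kept D, IsStack (σ.arr (.lst a)) rest (σ'.reg (.len a)) ∧
      IsStack (σ'.arr (.lst b)) kept (σ'.reg (.len b)) ∧ σ'.reg .top = 0 ∧
      kept.reverse ++ roots (EdgeReach E) prev rest = roots (EdgeReach E) [] l ∧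
      (∀ v, σ'.arr (.mark k) v ≠ 0 ↔ v ∈ D) ∧ (∀ v, v ∈ D ↔ ∃ u ∈ prev, EdgeReach E u v) ∧
      (∀ v ∈ prev, v < N) ∧ (∀ v ∈ rest, v < N) ∧
      searchCredits (adj E) N D + 60 * rest.length + 1 + c₀ ≤ T')
    ⟨[], l, [], ∅, ha, hb, htop, rfl, by simp [hk], by simp, by simp, hl, hT⟩ ?_ ?_
  · rintro T' σ' ⟨prev, rest, kept, D, ha', hb', htop', hkept, -, -, -, -, hT'⟩ - h0
    rw [h0] at ha'
    obtain rfl := ha'.eq_nil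
    refine ⟨by omega, by omega, htop', ?_⟩
    rw [← hkept]
    simpa [roots] using hb'
  · rintro T' σ' ⟨prev, rest, kept, D, ha', hb', htop', hkept, hD, hDr, hprev, hrest, hT'⟩ hf h0
    have f1 := hf.reg .one (by simp [Cmd.All, Op.keepsReg, scanCmd, searchCmd])
    have f2 := hf.arr .tgt (by simp [Cmd.All, Op.keepsArr, scanCmd, searchCmd])
    have f3 := hf.arr .nxt (by simp [Cmd.All, Op.keepsArr, scanCmd, searchCmd])
    have f4 := hf.arr .head (by simp [Cmd.All, Op.keepsArr, scanCmd, searchCmd])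
    have f5 := hf.reg .cnt (by simp [Cmd.All, Op.keepsReg, scanCmd, searchCmd])
    have f6 := hf.arr (.lst a) (by simp [Cmd.All, Op.keepsArr, scanCmd, searchCmd, hab])
    have hg' := hg.congr f1 f5 f2 f3 f4
    obtain ⟨rest', rfl, ha''⟩ := ha'.exists_cons h0
    set w := σ.arr (.lst a) (σ'.reg (.len a)) with hw
    have hwN : w < N := hrest w (by simp)
    simp only [List.length_cons] at hT'
    have hDw : w ∈ D ↔ ∃ u ∈ prev, EdgeReach E u w := hDr w
    refine ⟨by omega, ?_⟩
    simp only [wp_seq, wp_op, Op.eff]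
    simp only [Op.code, List.length_append, length_addressCode, List.length_singleton]
    refine ⟨by omega, by omega, by omega, WP.ifz (by omega) ?_ ?_⟩
    · intro ht
      simp only [St.set_reg, St.set_arr, reduceCtorEq, if_true, if_false, f6, ← hw] at ht
      have hwD : w ∉ D := fun h => (hD w).2 h ht
      have hPN : ∀ v, (∃ u ∈ w :: prev, EdgeReach E u v) → v < N := by
        rintro v ⟨u, hu, huv⟩
        rcases Relation.ReflTransGen.cases_tail huv with rfl | ⟨z, -, hz⟩
        · rcases List.mem_cons.1 hu with rfl | hu
          · exact hwN
          · exact hprev _ hu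
        · exact hE z v (mem_adj.1 hz)
      simp only [wp_seq, wp_op, Op.eff]
      simp only [Op.code, List.length_append, length_addressCode, List.length_singleton]
      refine ⟨by omega, by omega, by omega, by omega, by omega, ?_⟩
      -- The new root is presented as the target of one pending edge, so that `IsSearch.visit` marks
      -- and stacks it.
      have hS : IsSearch (adj E) D (fun v => ∃ u ∈ w :: prev, EdgeReach E u v) (σ'.arr (.mark k)) [] D
          w [w] := by
        refine ⟨by simpa using hD, by simp, by simp, fun v hv u hu => Or.inl ?_, fun v hv => ?_, ?_,
          fun v hv => (hD v).2 hv⟩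
        · rw [hD, hDr]
          obtain ⟨z, hz, hzv⟩ := (hDr v).1 hv
          exact ⟨z, hz, hzv.tail hu⟩
        · obtain ⟨z, hz, hzv⟩ := (hDr v).1 ((hD v).1 hv)
          exact ⟨z, List.mem_cons_of_mem _ hz, hzv⟩
        · intro u hu
          rw [List.mem_singleton.1 hu]
          exact ⟨w, by simp, .refl⟩
      -- The base set now includes `w`: after the search, completeness needs both `w` and the
      -- earlier marks to be present.
      have hS' : IsSearch (adj E) (insert w D) _ _ _ _ _ _ :=
        { hS.visit ht with
          base := fun v hv => by
            rcases Finset.mem_insert.1 hv with rfl | hv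
            · simp
            · exact (hS.visit ht).base v hv }
      refine (wp_searchCmd (E := E) (N := N) (s := [w]) (D := D) (x := w)
        (B := insert w D) (P := fun v => ∃ u ∈ w :: prev, EdgeReach E u v) (c₀ := 60 * rest'.length + 2 + c₀)
        ?_ hPN ?_ ?_ ?_ (by omega)).frame.mono ?_
      · rintro v ⟨u, hu, huv⟩ z hz
        exact ⟨u, hu, huv.tail hz⟩
      · exact hg'.congr (by simp) (by simp) (by simp) (by simp) (by simp)
      · have : IsStack (σ'.arr .stk) [] 0 := rfl
        simpa [htop', hg'.one, f6, ← hw] using this.push w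
      · simpa [f6, ← hw, hg'.one] using hS'
      · rintro T'' σ'' ⟨⟨htop'', D', x', hT'', h''⟩, hf'⟩
        have e1 := hf'.reg (.len a) (by simp [Cmd.All, Op.keepsReg, scanCmd, searchCmd])
        have e2 := hf'.reg (.len b) (by simp [Cmd.All, Op.keepsReg, scanCmd, searchCmd])
        have e3 := hf'.arr (.lst b) (by simp [Cmd.All, Op.keepsArr, scanCmd, searchCmd])
        have hD' : ∀ v, σ''.arr (.mark k) v ≠ 0 ↔ v ∈ D' := by simpa using h''.mem
        refine ⟨by omega, w :: prev, rest', w :: kept, D', ?_, ?_, htop'', ?_, hD', ?_, ?_, ?_, by omega⟩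
        · rw [e1]; simpa [hab, hg'.one] using ha''
        · rw [e2, e3]; simpa [hab.symm, hg'.one, f6, ← hw] using hb'.push w
        · rw [← hkept]
          simp [roots, ← hDw, hwD]
        · intro v
          rw [← hD']
          refine ⟨h''.sound v, ?_⟩
          rintro ⟨u, hu, huv⟩
          rcases List.mem_cons.1 hu with rfl | hu
          · induction huv with
            | refl => exact h''.base _ (Finset.mem_insert_self _ _)
            | @tail y z _ hyz ih => simpa using h''.closed y ((hD' y).1 ih) z hyz
          · exact h''.base v (Finset.mem_insert_of_mem ((hDr v).2 ⟨u, hu, huv⟩))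
        · intro v hv
          rcases List.mem_cons.1 hv with rfl | hv
          · exact hwN
          · exact hprev v hv
        · exact fun v hv => hrest v (List.mem_cons_of_mem _ hv)
    · intro ht
      simp only [St.set_reg, St.set_arr, reduceCtorEq, if_true, if_false, f6, ← hw] at ht
      have hwD : w ∈ D := (hD w).1 ht
      refine ⟨by omega, w :: prev, rest', kept, D, ?_, ?_, ?_, ?_, ?_, ?_, ?_, ?_, by omega⟩
      · simpa [hab, hg'.one] using ha''
      · simpa [hab.symm] using hb'
      · simpa using htop'
      · rw [← hkept]
        simp [roots, ← hDw, hwD]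
      · simpa using hD
      · intro v
        -- A rejected entry is reachable from an earlier one, so adding it to the processed entries
        -- does not enlarge what they reach.
        rw [hDr]
        constructor
        · rintro ⟨u, hu, huv⟩
          exact ⟨u, List.mem_cons_of_mem _ hu, huv⟩
        · rintro ⟨u, hu, huv⟩
          rcases List.mem_cons.1 hu with rfl | hu
          · obtain ⟨z, hz, hzw⟩ := hDw.1 hwD
            exact ⟨z, hz, hzw.trans huv⟩
          · exact ⟨u, hu, huv⟩
      · intro v hv
        rcases List.mem_cons.1 hv with rfl | hv
        · exact hwN
        · exact hprev v hv
      · exact fun v hv => hrest v (List.mem_cons_of_mem _ hv)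

/-! ### The recovery program -/

/-- Read the positions of the nonzero entries. -/
def readEdgesCmd : Cmd :=
  .loop .numE <| .seq (.op (.rd .xv)) <| .seq (.op (.rd .yv)) <| .seq (addEdge .yv .xv) <|
  .op (.sub .numE .numE .one)

/-- A list of pairs of numbers as a list of numbers. -/
def flatPairs (l : List (ℕ × ℕ)) : List ℕ := l.flatMap fun p => [p.1, p.2]

/-- A nonzero entry at `(i, j)` is the edge from `j` to `i`, hence the swap; edges are prepended,
hence the reversal. -/
theorem wp_readEdgesCmd {σ : St} {l : List (ℕ × ℕ)} {tail : List ℕ} {T c₀ : ℕ}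
    (hg : HasGraph σ []) (hi : σ.inp = flatPairs l ++ tail) (hn : σ.reg .numE = l.length)
    (hT : 42 * l.length + 1 + c₀ ≤ T) :
    WP readEdgesCmd σ T fun T' σ' => c₀ ≤ T' ∧ σ'.inp = tail ∧
      HasGraph σ' (l.map Prod.swap).reverse := by
  refine WP.loop (fun T' σ' => ∃ l' E, σ'.inp = flatPairs l' ++ tail ∧ σ'.reg .numE = l'.length ∧
    HasGraph σ' E ∧ (l'.map Prod.swap).reverse ++ E = (l.map Prod.swap).reverse ∧
    42 * l'.length + 1 + c₀ ≤ T') ⟨l, [], hi, hn, hg, by simp, hT⟩ ?_ ?_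
  · rintro T' σ' ⟨l', E, hi', hn', hg', hE, hT'⟩ - h0
    rw [h0] at hn'
    obtain rfl := List.length_eq_zero_iff.1 hn'.symm
    simp only [List.map_nil, List.reverse_nil, List.nil_append] at hE
    exact ⟨by omega, by omega, by simpa [flatPairs] using hi', hE ▸ hg'⟩
  · rintro T' σ' ⟨l', E, hi', hn', hg', hE, hT'⟩ - h0
    cases l' with
    | nil => exact absurd hn' h0
    | cons e l' =>
      simp only [List.length_cons] at hn' hT'
      refine ⟨by omega, ?_⟩
      simp only [wp_seq, wp_op, Op.eff]
      simp only [Op.code, List.length_singleton]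
      refine ⟨by omega, by omega, ?_⟩
      refine (wp_addEdge (E := E) (by simp) (by simp) ?_ (by omega)).frame.mono ?_
      · exact hg'.congr (by simp) (by simp) (by simp) (by simp) (by simp)
      · rintro T'' σ'' ⟨⟨rfl, hg''⟩, hf⟩
        have f1 := hf.reg .numE (by simp [Cmd.All, Op.keepsReg, addEdge])
        have f2 := hf.inp (by simp [Cmd.All, Op.keepsInp, addEdge])
        refine ⟨by omega, by omega, l', (e.2, e.1) :: E, ?_, ?_, ?_, ?_, by omega⟩
        · simp [f2, hi', flatPairs]
        · simp [f1, hg''.one, hn']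
        · refine HasGraph.congr (σ := σ'') ?_ (by simp) (by simp) (by simp) (by simp) (by simp)
          simpa [hi', flatPairs] using hg''
        · simpa [Prod.swap] using hE

/-- Read the forbidden variables. -/
def readForbCmd : Cmd :=
  .loop .numF <| .seq (.op (.rd .xv)) <| .seq (.op (.st .forb .xv .one)) <|
  .op (.sub .numF .numF .one)

theorem wp_readForbCmd {σ : St} {l tail : List ℕ} {T c₀ : ℕ} (h1 : σ.reg .one = 1)
    (hi : σ.inp = l ++ tail) (hn : σ.reg .numF = l.length) (h0 : ∀ v, σ.arr .forb v = 0)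
    (hT : 13 * l.length + 1 + c₀ ≤ T) :
    WP readForbCmd σ T fun T' σ' => c₀ ≤ T' ∧ σ'.inp = tail ∧
      ∀ v, σ'.arr .forb v ≠ 0 ↔ v ∈ l := by
  refine WP.loop (fun T' σ' => ∃ l', σ'.inp = l' ++ tail ∧ σ'.reg .numF = l'.length ∧
    (∀ v, σ'.arr .forb v ≠ 0 ∨ v ∈ l' ↔ v ∈ l) ∧ 13 * l'.length + 1 + c₀ ≤ T')
    ⟨l, hi, hn, by simp [h0], hT⟩ ?_ ?_
  · rintro T' σ' ⟨l', hi', hn', hm, hT'⟩ - h0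
    rw [h0] at hn'
    obtain rfl := List.length_eq_zero_iff.1 hn'.symm
    exact ⟨by omega, by omega, by simpa using hi', by simpa using hm⟩
  · rintro T' σ' ⟨l', hi', hn', hm, hT'⟩ hf h0
    have f1 : σ'.reg .one = 1 := (hf.reg .one (by simp [Cmd.All, Op.keepsReg])).trans h1
    cases l' with
    | nil => exact absurd hn' h0
    | cons e l' =>
      simp only [List.length_cons] at hn' hT'
      refine ⟨by omega, ?_⟩
      simp only [wp_seq, wp_op, Op.eff]
      simp only [Op.code, List.length_append, length_addressCode, List.length_singleton]
      refine ⟨by omega, by omega, by omega, by omega, l', ?_, ?_, ?_, by omega⟩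
      · simp [hi']
      · simp [hn', f1]
      · intro v
        rw [← hm v]
        by_cases hv : v = e <;> simp [hi', f1, hv]

/-- Read the edges of the matching. -/
def readMatchCmd : Cmd :=
  .loop .numM <| .seq (.op (.rd .xv)) <| .seq (.op (.rd .yv)) <| .seq (.op (.st .mat .yv .one)) <|
  .op (.sub .numM .numM .one)

theorem wp_readMatchCmd {σ : St} {l : List (ℕ × ℕ)} {tail : List ℕ} {T c₀ : ℕ}
    (h1 : σ.reg .one = 1) (hi : σ.inp = flatPairs l ++ tail) (hn : σ.reg .numM = l.length)
    (h0 : ∀ v, σ.arr .mat v = 0) (hT : 14 * l.length + 1 + c₀ ≤ T) :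
    WP readMatchCmd σ T fun T' σ' => c₀ ≤ T' ∧ ∀ v, σ'.arr .mat v ≠ 0 ↔ v ∈ l.map Prod.snd := by
  refine WP.loop (fun T' σ' => ∃ l', σ'.inp = flatPairs l' ++ tail ∧ σ'.reg .numM = l'.length ∧
    (∀ v, σ'.arr .mat v ≠ 0 ∨ v ∈ l'.map Prod.snd ↔ v ∈ l.map Prod.snd) ∧
    14 * l'.length + 1 + c₀ ≤ T') ⟨l, hi, hn, by simp [h0], hT⟩ ?_ ?_
  · rintro T' σ' ⟨l', hi', hn', hm, hT'⟩ - h0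
    rw [h0] at hn'
    obtain rfl := List.length_eq_zero_iff.1 hn'.symm
    exact ⟨by omega, by omega, by simpa using hm⟩
  · rintro T' σ' ⟨l', hi', hn', hm, hT'⟩ hf h0
    have f1 : σ'.reg .one = 1 := (hf.reg .one (by simp [Cmd.All, Op.keepsReg])).trans h1
    cases l' with
    | nil => exact absurd hn' h0
    | cons e l' =>
      simp only [List.length_cons] at hn' hT'
      refine ⟨by omega, ?_⟩
      simp only [wp_seq, wp_op, Op.eff]
      simp only [Op.code, List.length_append, length_addressCode, List.length_singleton]
      refine ⟨by omega, by omega, by omega, by omega, by omega, l', ?_, ?_, ?_, by omega⟩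
      · simp [hi', flatPairs]
      · simp [hn', f1]
      · intro v
        rw [← hm v, List.map_cons, List.mem_cons]
        by_cases hv : v = e.2 <;> simp [hi', f1, hv, flatPairs]

/-- Push a register onto a list. -/
def pushCmd (a : Fin 3) (r : Reg) : Cmd :=
  .seq (.op (.add (.len a) (.len a) .one)) <| .op (.st (.lst a) (.len a) r)

theorem wp_pushCmd {a : Fin 3} {r : Reg} (hr : r ≠ .len a) {σ : St} {l : List ℕ} {T : ℕ}
    (h1 : σ.reg .one = 1) (h : IsStack (σ.arr (.lst a)) l (σ.reg (.len a))) (hT : 10 ≤ T) :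
    WP (pushCmd a r) σ T fun T' σ' => T' = T - 10 ∧
      IsStack (σ'.arr (.lst a)) (σ.reg r :: l) (σ'.reg (.len a)) := by
  simp only [pushCmd, wp_seq, wp_op, Op.eff]
  simp only [Op.code, List.length_append, length_addressCode, List.length_singleton]
  refine ⟨by omega, by omega, by omega, ?_⟩
  simpa [h1, hr] using h.push (σ.reg r)

/-- Write the unmatched vertices and add an edge to each of them from an additional vertex; collect
the vertices that are not forbidden. -/
def vertexCmd : Cmd :=
  .loop .idx <| .seq (.op (.sub .idx .idx .one)) <| .seq (.op (.ld .tmp .mat .idx)) <|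
  .seq (.ifz .tmp (.seq (.op (.wr .idx)) (addEdge .num .idx))) <|
  .seq (.op (.ld .tmp .forb .idx)) <| .ifz .tmp (pushCmd 0 .idx)

/-- The index runs down to zero. The number `n`, held in `num`, is not a vertex and serves as the
auxiliary source pointing to all unmatched vertices, so that one search from it covers everything
they reach. -/
theorem wp_vertexCmd {σ : St} {E₀ : List (ℕ × ℕ)} {n : ℕ} {T c₀ : ℕ} (hg : HasGraph σ E₀)
    (hi : σ.reg .idx = n) (hn : σ.reg .num = n) (hl : σ.reg (.len 0) = 0) (ho : σ.out = [])
    (hT : 75 * n + 1 + c₀ ≤ T) :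
    WP vertexCmd σ T fun T' σ' => c₀ ≤ T' ∧ ∃ us cs E, HasGraph σ' E ∧ σ'.out = us ∧ us.Nodup ∧
      (∀ v, v ∈ us ↔ v < n ∧ σ.arr .mat v = 0) ∧
      (∀ e, e ∈ E ↔ e ∈ E₀ ∨ e.1 = n ∧ e.2 ∈ us) ∧ E.length = E₀.length + us.length ∧
      us.length ≤ n ∧ IsStack (σ'.arr (.lst 0)) cs (σ'.reg (.len 0)) ∧
      (∀ v, v ∈ cs ↔ v < n ∧ σ.arr .forb v = 0) ∧ cs.length ≤ n := by
  refine WP.loop (fun T' σ' => ∃ k, σ'.reg .idx = k ∧ k ≤ n ∧ 75 * k + 1 + c₀ ≤ T' ∧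
    ∃ us cs E, HasGraph σ' E ∧ σ'.out = us ∧ us.Nodup ∧
      (∀ v, v ∈ us ↔ (k ≤ v ∧ v < n) ∧ σ.arr .mat v = 0) ∧
      (∀ e, e ∈ E ↔ e ∈ E₀ ∨ e.1 = n ∧ e.2 ∈ us) ∧ E.length = E₀.length + us.length ∧
      us.length + k ≤ n ∧ IsStack (σ'.arr (.lst 0)) cs (σ'.reg (.len 0)) ∧
      (∀ v, v ∈ cs ↔ (k ≤ v ∧ v < n) ∧ σ.arr .forb v = 0) ∧ cs.length + k ≤ n)
    ⟨n, hi, le_rfl, hT, [], [], E₀, hg, ho, by simp, ?_, by simp, by simp, by simp, hl, ?_, by simp⟩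
    ?_ ?_
  · intro v; simp
  · intro v; simp
  · rintro T' σ' ⟨k, hk, hkn, hT', us, cs, E, hg', ho', hnd, hus, hE, hEl, hul, hst, hcs, hcl⟩ - h0
    obtain rfl : k = 0 := hk.symm.trans h0
    exact ⟨by omega, by omega, us, cs, E, hg', ho', hnd, by simpa using hus, hE, hEl, by omega, hst,
      by simpa using hcs, by omega⟩
  · rintro T' σ' ⟨k, hk, hkn, hT', us, cs, E, hg', ho', hnd, hus, hE, hEl, hul, hst, hcs, hcl⟩ hf h0
    have f1 := hf.arr .mat (by simp [Cmd.All, Op.keepsArr, addEdge, pushCmd])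
    have f2 := hf.arr .forb (by simp [Cmd.All, Op.keepsArr, addEdge, pushCmd])
    have f3 := (hf.reg .num (by simp [Cmd.All, Op.keepsReg, addEdge, pushCmd])).trans hn
    obtain ⟨j, rfl⟩ : ∃ j, k = j + 1 := ⟨k - 1, by omega⟩
    refine ⟨by omega, ?_⟩
    have hbnd : ∀ v, j ≤ v ∧ v < n ↔ v = j ∨ (j + 1 ≤ v ∧ v < n) := fun v => by omega
    -- the second half of the body
    have second : ∀ (σ₁ : St) (T₁ : ℕ) (us' : List ℕ) (E' : List (ℕ × ℕ)), 75 * j + 24 + c₀ ≤ T₁ →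
        σ₁.reg .idx = j → σ₁.arr .forb = σ.arr .forb → σ₁.arr (.lst 0) = σ'.arr (.lst 0) →
        σ₁.reg (.len 0) = σ'.reg (.len 0) → HasGraph σ₁ E' → σ₁.out = us' → us'.Nodup →
        (∀ v, v ∈ us' ↔ (j ≤ v ∧ v < n) ∧ σ.arr .mat v = 0) →
        (∀ e, e ∈ E' ↔ e ∈ E₀ ∨ e.1 = n ∧ e.2 ∈ us') → E'.length = E₀.length + us'.length →
        us'.length + j ≤ n →
        WP (.seq (.op (.ld .tmp .forb .idx)) <| .ifz .tmp (pushCmd 0 .idx)) σ₁ T₁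
          fun T'' σ'' => 1 ≤ T'' ∧ ∃ k, σ''.reg .idx = k ∧ k ≤ n ∧ 75 * k + 1 + c₀ ≤ T'' - 1 ∧
            ∃ us cs E, HasGraph σ'' E ∧ σ''.out = us ∧ us.Nodup ∧
              (∀ v, v ∈ us ↔ (k ≤ v ∧ v < n) ∧ σ.arr .mat v = 0) ∧
              (∀ e, e ∈ E ↔ e ∈ E₀ ∨ e.1 = n ∧ e.2 ∈ us) ∧ E.length = E₀.length + us.length ∧
              us.length + k ≤ n ∧ IsStack (σ''.arr (.lst 0)) cs (σ''.reg (.len 0)) ∧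
              (∀ v, v ∈ cs ↔ (k ≤ v ∧ v < n) ∧ σ.arr .forb v = 0) ∧ cs.length + k ≤ n := by
      intro σ₁ T₁ us' E' hT₁ hi₁ hf₁ hl₁ hlen₁ hg₁ ho₁ hnd₁ hus₁ hE₁ hEl₁ hul₁
      simp only [wp_seq, wp_op, Op.eff]
      simp only [Op.code, List.length_append, length_addressCode, List.length_singleton]
      refine ⟨by omega, WP.ifz (by omega) ?_ ?_⟩
      · intro ht
        simp only [St.set_reg, if_true, hi₁, hf₁] at ht
        refine (wp_pushCmd (l := cs) (by simp) (by simpa using hg₁.one)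
          (by simpa [hl₁, hlen₁] using hst) (by omega)).frame.mono ?_
        rintro T'' σ'' ⟨⟨rfl, hst''⟩, hf''⟩
        have g1 := hf''.reg .one (by simp [Cmd.All, Op.keepsReg, pushCmd])
        have g2 := hf''.reg .cnt (by simp [Cmd.All, Op.keepsReg, pushCmd])
        have g3 := hf''.reg .idx (by simp [Cmd.All, Op.keepsReg, pushCmd])
        have g4 := hf''.arr .tgt (by simp [Cmd.All, Op.keepsArr, pushCmd])
        have g5 := hf''.arr .nxt (by simp [Cmd.All, Op.keepsArr, pushCmd])
        have g6 := hf''.arr .head (by simp [Cmd.All, Op.keepsArr, pushCmd])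
        have g7 := hf''.out (by simp [Cmd.All, Op.keepsOut, pushCmd])
        refine ⟨by omega, j, by simpa [hi₁] using g3, by omega, by omega, us', j :: cs, E',
          hg₁.congr (by simpa using g1) (by simpa using g2) g4 g5 g6, g7.trans ho₁, hnd₁, hus₁, hE₁,
          hEl₁, hul₁, by simpa [hi₁] using hst'', fun v => ?_, by simp; omega⟩
        rw [List.mem_cons, hcs, hbnd]
        by_cases hv : v = j
        · simp [hv, ht]
        · simp [hv]
      · intro ht
        simp only [St.set_reg, if_true, hi₁, hf₁] at ht
        refine ⟨by omega, j, by simpa using hi₁, by omega, by omega, us', cs, E',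
          hg₁.congr (by simp) (by simp) rfl rfl rfl, ho₁, hnd₁, hus₁, hE₁,
          hEl₁, hul₁, by simpa [hl₁, hlen₁] using hst, fun v => ?_, by omega⟩
        rw [hcs, hbnd]
        by_cases hv : v = j
        · simp [hv, ht]
        · simp [hv]
    rw [wp_seq, wp_op]
    simp only [Op.eff, Op.code, List.length_singleton]
    refine ⟨by omega, ?_⟩
    rw [wp_seq, wp_op]
    simp only [Op.eff, Op.code, List.length_append, length_addressCode, List.length_singleton]
    refine ⟨by omega, ?_⟩
    rw [wp_seq]
    refine WP.ifz (by omega) ?_ ?_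
    · intro ht
      simp only [St.set_reg, reduceCtorEq, if_true, if_false, St.set_arr, hk, hg'.one, f1,
        Nat.add_sub_cancel] at ht
      rw [wp_seq, wp_op]
      simp only [Op.eff, Op.code, List.length_singleton]
      refine ⟨by omega, ?_⟩
      refine (wp_addEdge (E := E) (by simp) (by simp) ?_ (by omega)).frame.mono ?_
      · exact hg'.congr (by simp) (by simp) rfl rfl rfl
      · rintro T'' σ'' ⟨⟨rfl, hg''⟩, hf''⟩
        have g3 := hf''.reg .idx (by simp [Cmd.All, Op.keepsReg, addEdge])
        have g4 := hf''.arr .forb (by simp [Cmd.All, Op.keepsArr, addEdge])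
        have g5 := hf''.arr (.lst 0) (by simp [Cmd.All, Op.keepsArr, addEdge])
        have g6 := hf''.reg (.len 0) (by simp [Cmd.All, Op.keepsReg, addEdge])
        have g7 := hf''.out (by simp [Cmd.All, Op.keepsOut, addEdge])
        simp only [St.set_reg, reduceCtorEq, if_true, if_false, St.set_arr, hk, hg'.one, f3,
          Nat.add_sub_cancel, St.set_out, ho', f2] at g3 g4 g5 g6 g7 hg''
        refine second σ'' _ (us ++ [j]) ((n, j) :: E) (by omega) g3 g4 g5 g6 hg'' g7 ?_ ?_ ?_ ?_ ?_
        · refine List.nodup_append.2 ⟨hnd, by simp, fun v hv w hw => ?_⟩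
          have := ((hus v).1 hv).1.1
          have := List.mem_singleton.1 hw
          omega
        · intro v
          rw [List.mem_append, hus, hbnd, List.mem_singleton]
          by_cases hv : v = j
          · simp [hv, ht]
          · simp [hv]
        · rintro ⟨a, b⟩
          rw [List.mem_cons, hE, List.mem_append, List.mem_singleton, Prod.mk.injEq]
          simp only
          tauto
        · simp [hEl]; omega
        · simp; omega
    · intro ht
      simp only [St.set_reg, reduceCtorEq, if_true, if_false, St.set_arr, hk, hg'.one, f1,
        Nat.add_sub_cancel] at ht
      refine second _ _ us E (by omega) (by simp [hk, hg'.one]) (by simpa using f2) rfl (by simp)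
        (hg'.congr (by simp) (by simp) rfl rfl rfl) ho' hnd ?_ hE hEl (by omega)
      intro v
      rw [hus, hbnd]
      by_cases hv : v = j
      · simp [hv, ht]
      · simp [hv]

/-- Write all but the first entry of the last list. -/
def writeCmd : Cmd :=
  .seq (.op (.sub (.len 2) (.len 2) .one)) <| .loop (.len 2) <|
  .seq (.op (.add .tmp (.len 2) .one)) <| .seq (.op (.ld .xv (.lst 2) .tmp)) <|
  .seq (.op (.wr .xv)) <| .op (.sub (.len 2) (.len 2) .one)

/-- The bottom entry `x` will be the auxiliary vertex, which must not be written. The register is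
kept one below the stack height, so the loop stops with that entry left. -/
theorem wp_writeCmd {σ : St} {l : List ℕ} {x : ℕ} {T : ℕ} (h1 : σ.reg .one = 1)
    (h : IsStack (σ.arr (.lst 2)) (l ++ [x]) (σ.reg (.len 2))) (hT : 14 * l.length + 2 ≤ T) :
    WP writeCmd σ T fun _ σ' => σ'.out = σ.out ++ l := by
  rw [writeCmd, wp_seq, wp_op]
  simp only [Op.eff, Op.code, List.length_singleton]
  refine ⟨by omega, ?_⟩
  refine WP.loop (fun T' σ' => ∃ l', IsStack (σ.arr (.lst 2)) (l' ++ [x]) (σ'.reg (.len 2) + 1) ∧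
    σ'.out ++ l' = σ.out ++ l ∧ 14 * l'.length + 1 ≤ T') ⟨l, ?_, rfl, by omega⟩ ?_ ?_
  · have := h.length
    rw [List.length_append, List.length_singleton] at this
    simpa [h1, this] using h
  · rintro T' σ' ⟨l', hst, ho, hT'⟩ - h0
    have := hst.length
    rw [h0, List.length_append, List.length_singleton] at this
    obtain rfl := List.length_eq_zero_iff.1 (by omega : l'.length = 0)
    exact ⟨by omega, by simpa using ho⟩
  · rintro T' σ' ⟨l', hst, ho, hT'⟩ hf h0
    have f1 := hf.reg .one (by simp [Cmd.All, Op.keepsReg])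
    have f2 := hf.arr (.lst 2) (by simp [Cmd.All, Op.keepsArr])
    simp only [St.set_reg, reduceCtorEq, if_false, h1, St.set_arr] at f1 f2
    have hlen := hst.length
    cases l' with
    | nil => simp at hlen; exact absurd hlen h0
    | cons y l' =>
      simp only [List.length_cons] at hT'
      obtain ⟨l'', hl'', hst''⟩ := hst.exists_cons (by omega)
      simp only [List.cons_append, List.cons.injEq] at hl''
      obtain ⟨hy, rfl⟩ := hl''
      refine ⟨by omega, ?_⟩
      simp only [wp_seq, wp_op, Op.eff]
      simp only [Op.code, List.length_append, length_addressCode, List.length_singleton]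
      refine ⟨by omega, by omega, by omega, by omega, by omega, l', ?_, ?_, by omega⟩
      · have e : σ'.reg (.len 2) - 1 + 1 = σ'.reg (.len 2) + 1 - 1 := by omega
        simpa [f1, e] using hst''
      · rw [← ho]
        simp [f1, f2, hy]

/-- The part of the program that reads the input and writes the unmatched vertices. -/
def inputCmd : Cmd :=
  .seq (.op (.const .one 1)) <| .seq (.op (.rd .num)) <| .seq (.op (.rd .numE)) <|
  .seq (.op (.rd .numF)) <| .seq (.op (.rd .numM)) <| .seq readEdgesCmd <| .seq readForbCmd <|
  .seq readMatchCmd <| .seq (.op (.mov .idx .num)) vertexCmd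

theorem wp_inputCmd {n : ℕ} {es ms : List (ℕ × ℕ)} {fs : List ℕ} {T c₀ : ℕ}
    (hT : 42 * es.length + 13 * fs.length + 14 * ms.length + 75 * n + 10 + c₀ ≤ T) :
    WP inputCmd (initSt ([n, es.length, fs.length, ms.length] ++ flatPairs es ++ fs ++ flatPairs ms))
      T fun T' σ => c₀ ≤ T' ∧ ∃ us cs E, HasGraph σ E ∧ σ.out = us ∧ us.Nodup ∧
      (∀ v, v ∈ us ↔ v < n ∧ v ∉ ms.map Prod.snd) ∧
      (∀ e, e ∈ E ↔ e.swap ∈ es ∨ e.1 = n ∧ e.2 ∈ us) ∧ E.length ≤ es.length + n ∧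
      IsStack (σ.arr (.lst 0)) cs (σ.reg (.len 0)) ∧
      (∀ v, v ∈ cs ↔ v < n ∧ v ∉ fs) ∧ cs.length ≤ n ∧ σ.reg .num = n ∧ σ.reg (.len 1) = 0 ∧
      σ.reg (.len 2) = 0 ∧ σ.reg .top = 0 ∧ ∀ k v, σ.arr (.mark k) v = 0 := by
  rw [inputCmd]
  iterate 5
    rw [wp_seq, wp_op]
    simp only [Op.eff, Op.code, List.length_singleton]
    refine ⟨by omega, ?_⟩
  set σ₀ : St := initSt ([n, es.length, fs.length, ms.length] ++ flatPairs es ++ fs ++ flatPairs ms)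
    with hσ₀
  have i0 : σ₀.inp = n :: es.length :: fs.length :: ms.length :: (flatPairs es ++ (fs ++ flatPairs ms)) := by
    simp [hσ₀, initSt]
  have r0 : σ₀.reg = fun _ => 0 := rfl
  have a0 : σ₀.arr = fun _ _ => 0 := rfl
  have o0 : σ₀.out = [] := rfl
  rw [wp_seq]
  refine (wp_readEdgesCmd (l := es) (tail := fs ++ flatPairs ms)
    (c₀ := 13 * fs.length + 14 * ms.length + 75 * n + 4 + c₀) ?_ ?_ ?_ (by omega)).frame.mono ?_
  · exact ⟨by simp, fun v => by simp [adj, a0, IsLinked]⟩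
  · simp [i0]
  · simp [i0]
  rintro T₁ σ₁ ⟨⟨hT₁, hi₁, hg₁⟩, hf₁⟩
  have n₁ : σ₁.reg .num = n :=
    (hf₁.reg .num (by simp [Cmd.All, Op.keepsReg, readEdgesCmd, addEdge])).trans (by simp [i0])
  have nF₁ : σ₁.reg .numF = fs.length :=
    (hf₁.reg .numF (by simp [Cmd.All, Op.keepsReg, readEdgesCmd, addEdge])).trans (by simp [i0])
  have nM₁ : σ₁.reg .numM = ms.length :=
    (hf₁.reg .numM (by simp [Cmd.All, Op.keepsReg, readEdgesCmd, addEdge])).trans (by simp [i0])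
  have len₁ : ∀ k, σ₁.reg (.len k) = 0 := fun k =>
    (hf₁.reg (.len k) (by simp [Cmd.All, Op.keepsReg, readEdgesCmd, addEdge])).trans (by simp [r0])
  have top₁ : σ₁.reg .top = 0 :=
    (hf₁.reg .top (by simp [Cmd.All, Op.keepsReg, readEdgesCmd, addEdge])).trans (by simp [r0])
  have fo₁ : ∀ v, σ₁.arr .forb v = 0 := fun v => by
    rw [hf₁.arr .forb (by simp [Cmd.All, Op.keepsArr, readEdgesCmd, addEdge])]; rfl
  have ma₁ : ∀ v, σ₁.arr .mat v = 0 := fun v => by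
    rw [hf₁.arr .mat (by simp [Cmd.All, Op.keepsArr, readEdgesCmd, addEdge])]; rfl
  have mk₁ : ∀ k v, σ₁.arr (.mark k) v = 0 := fun k v => by
    rw [hf₁.arr (.mark k) (by simp [Cmd.All, Op.keepsArr, readEdgesCmd, addEdge])]; rfl
  have o₁ : σ₁.out = [] := hf₁.out (by simp [Cmd.All, Op.keepsOut, readEdgesCmd, addEdge])
  clear hf₁
  rw [wp_seq]
  refine (wp_readForbCmd (l := fs) (tail := flatPairs ms)
    (c₀ := 14 * ms.length + 75 * n + 3 + c₀) hg₁.one hi₁ nF₁ fo₁ (by omega)).frame.mono ?_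
  rintro T₂ σ₂ ⟨⟨hT₂, hi₂, fo₂⟩, hf₂⟩
  have kr₂ : ∀ r, r ≠ .numF → r ≠ .xv → σ₂.reg r = σ₁.reg r := fun r h h' =>
    hf₂.reg r (by simp [Cmd.All, Op.keepsReg, readForbCmd, h, h'])
  have ka₂ : ∀ a, a ≠ .forb → σ₂.arr a = σ₁.arr a := fun a h =>
    hf₂.arr a (by simp [Cmd.All, Op.keepsArr, readForbCmd, h])
  have o₂ : σ₂.out = [] := (hf₂.out (by simp [Cmd.All, Op.keepsOut, readForbCmd])).trans o₁
  rw [wp_seq]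
  refine (wp_readMatchCmd (l := ms) (tail := []) (c₀ := 75 * n + 2 + c₀)
    ((kr₂ _ (by simp) (by simp)).trans hg₁.one) (by simpa using hi₂)
    ((kr₂ _ (by simp) (by simp)).trans nM₁) (by simpa [ka₂] using ma₁) (by omega)).frame.mono ?_
  rintro T₃ σ₃ ⟨⟨hT₃, ma₃⟩, hf₃⟩
  have kr₃ : ∀ r, r ≠ .numM → r ≠ .xv → r ≠ .yv → r ≠ .numF → σ₃.reg r = σ₁.reg r :=
    fun r h h' h'' h₃ => (hf₃.reg r (by simp [Cmd.All, Op.keepsReg, readMatchCmd, h, h', h''])).trans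
      (kr₂ r h₃ h')
  have ka₃ : ∀ a, a ≠ .mat → σ₃.arr a = σ₂.arr a := fun a h =>
    hf₃.arr a (by simp [Cmd.All, Op.keepsArr, readMatchCmd, h])
  have o₃ : σ₃.out = [] := (hf₃.out (by simp [Cmd.All, Op.keepsOut, readMatchCmd])).trans o₂
  rw [wp_seq, wp_op]
  simp only [Op.eff, Op.code, List.length_singleton]
  refine ⟨by omega, ?_⟩
  refine (wp_vertexCmd (E₀ := (es.map Prod.swap).reverse) (n := n) (c₀ := c₀) ?_ ?_ ?_ ?_ ?_
    (by omega)).frame.mono ?_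
  · exact hg₁.congr (by simp [kr₃]) (by simp [kr₃]) (by simp [ka₃, ka₂]) (by simp [ka₃, ka₂])
      (by simp [ka₃, ka₂])
  · simp [kr₃, n₁]
  · simp [kr₃, n₁]
  · simp [kr₃, len₁]
  · simpa using o₃
  rintro T₄ σ₄ ⟨⟨hT₄, us, cs, E, hg₄, ho₄, hnd, hus, hE, hEl, hul, hst, hcs, hcl⟩, hf₄⟩
  refine ⟨hT₄, us, cs, E, hg₄, ho₄, hnd, ?_, ?_, ?_, hst, ?_, hcl, ?_, ?_, ?_, ?_, ?_⟩
  · intro v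
    rw [hus, ← ma₃]
    simp
  · intro e
    rw [hE]
    simp [Prod.swap, Prod.ext_iff, and_comm]
  · rw [hEl]
    simp; omega
  · intro v
    rw [hcs, ← fo₂]
    simp [ka₃]
  · rw [hf₄.reg _ (by simp [Cmd.All, Op.keepsReg, vertexCmd, pushCmd, addEdge])]
    simp [kr₃, n₁]
  · rw [hf₄.reg _ (by simp [Cmd.All, Op.keepsReg, vertexCmd, pushCmd, addEdge])]
    simp [kr₃, len₁]
  · rw [hf₄.reg _ (by simp [Cmd.All, Op.keepsReg, vertexCmd, pushCmd, addEdge])]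
    simp [kr₃, len₁]
  · rw [hf₄.reg _ (by simp [Cmd.All, Op.keepsReg, vertexCmd, pushCmd, addEdge])]
    simp [kr₃, top₁]
  · intro k v
    rw [hf₄.arr _ (by simp [Cmd.All, Op.keepsArr, vertexCmd, pushCmd, addEdge])]
    simp [ka₃, ka₂, mk₁]

theorem length_roots_le (r : ℕ → ℕ → Prop) (prev l : List ℕ) : (roots r prev l).length ≤ l.length := by
  induction l generalizing prev with
  | nil => simp [roots]
  | cons v l ih =>
    rw [roots]
    split_ifs
    · exact (ih _).trans (by simp)
    · simpa using ih _

theorem roots_sublist (r : ℕ → ℕ → Prop) (prev l : List ℕ) : (roots r prev l).Sublist l := by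
  induction l generalizing prev with
  | nil => simp [roots]
  | cons v l ih =>
    rw [roots]
    split_ifs
    · exact (ih _).cons _
    · exact (ih _).cons_cons _

/-- The program that computes an optimal set from a minimum cost allowed matching. -/
def recoverCmd : Cmd :=
  .seq inputCmd <| .seq (pushCmd 0 .num) <| .seq (passCmd 0 1 0) <| .seq (pushCmd 1 .num) <|
  .seq (passCmd 1 2 1) writeCmd

theorem wp_recoverCmd {n : ℕ} {es ms : List (ℕ × ℕ)} {fs : List ℕ} {T : ℕ}
    (hes : ∀ e ∈ es, e.1 < n ∧ e.2 < n)
    (hT : 200 * es.length + 13 * fs.length + 14 * ms.length + 500 * n + 500 ≤ T) :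
    WP recoverCmd (initSt ([n, es.length, fs.length, ms.length] ++ flatPairs es ++ fs ++ flatPairs ms))
      T fun _ σ => ∃ us cs E, us.Nodup ∧ (∀ v, v ∈ us ↔ v < n ∧ v ∉ ms.map Prod.snd) ∧
      (∀ e, e ∈ E ↔ e.swap ∈ es ∨ e.1 = n ∧ e.2 ∈ us) ∧ (∀ v, v ∈ cs ↔ v < n ∧ v ∉ fs) ∧
      σ.out = us ++ (roots (EdgeReach E) [n] (roots (EdgeReach E) [] (n :: cs)).reverse).reverse := by
  have hT' : 42 * es.length + 13 * fs.length + 14 * ms.length + 75 * n + 10 +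
      (158 * es.length + 400 * n + 450) ≤ T := by linarith
  rw [recoverCmd, wp_seq]
  refine (wp_inputCmd hT').mono ?_
  rintro T₁ σ₁ ⟨hT₁, us, cs, E, hg₁, ho₁, hnd, hus, hE, hEl, hst, hcs, hcl, n₁, l₁, l₂, top₁, mk₁⟩
  have hEn : ∀ u v, (u, v) ∈ E → v < n + 1 := by
    intro u v huv
    rcases (hE _).1 huv with h | h
    · exact (hes _ h).1.trans (Nat.lt_succ_self n)
    · exact ((hus _).1 h.2).1.trans (Nat.lt_succ_self n)
  have hcr := searchCredits_empty_le E (n + 1)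
  have hcsn : ∀ v ∈ n :: cs, v < n + 1 := by
    intro v hv
    rcases List.mem_cons.1 hv with rfl | hv
    · exact Nat.lt_succ_self _
    · exact ((hcs v).1 hv).1.trans (Nat.lt_succ_self n)
  rw [wp_seq]
  refine (wp_pushCmd (by simp) hg₁.one hst (by omega)).frame.mono ?_
  rintro T₂ σ₂ ⟨⟨rfl, hst₂⟩, hf₂⟩
  have kr₂ : ∀ r, r ≠ .len 0 → σ₂.reg r = σ₁.reg r := fun r h =>
    hf₂.reg r (by simp [Cmd.All, Op.keepsReg, pushCmd, h])
  have ka₂ : ∀ a, a ≠ .lst 0 → σ₂.arr a = σ₁.arr a := fun a h =>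
    hf₂.arr a (by simp [Cmd.All, Op.keepsArr, pushCmd, h])
  have o₂ := hf₂.out (by simp [Cmd.All, Op.keepsOut, pushCmd])
  rw [n₁] at hst₂
  rw [wp_seq]
  -- The bound `n + 1` makes room for the auxiliary vertex; `c₀` reserves credits for the second
  -- pass and the output.
  refine (wp_passCmd (E := E) (N := n + 1) (c₀ := 100 * es.length + 150 * n + 200) (by simp) hEn hcsn
    (hg₁.congr (by simp [kr₂]) (by simp [kr₂]) (by simp [ka₂]) (by simp [ka₂]) (by simp [ka₂])) hst₂
    (by simp [kr₂, l₁]) (by simp [kr₂, top₁]) (by simp [ka₂, mk₁])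
    (by simp only [List.length_cons]; omega)).frame.mono ?_
  rintro T₃ σ₃ ⟨⟨hT₃, top₃, hst₃⟩, hf₃⟩
  have one₃ := hf₃.reg .one (by simp [Cmd.All, Op.keepsReg, passCmd, searchCmd, scanCmd])
  have cnt₃ := hf₃.reg .cnt (by simp [Cmd.All, Op.keepsReg, passCmd, searchCmd, scanCmd])
  have num₃ := hf₃.reg .num (by simp [Cmd.All, Op.keepsReg, passCmd, searchCmd, scanCmd])
  have len₃ := hf₃.reg (.len 2) (by simp [Cmd.All, Op.keepsReg, passCmd, searchCmd, scanCmd])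
  have tgt₃ := hf₃.arr .tgt (by simp [Cmd.All, Op.keepsArr, passCmd, searchCmd, scanCmd])
  have nxt₃ := hf₃.arr .nxt (by simp [Cmd.All, Op.keepsArr, passCmd, searchCmd, scanCmd])
  have head₃ := hf₃.arr .head (by simp [Cmd.All, Op.keepsArr, passCmd, searchCmd, scanCmd])
  have mk₃ := hf₃.arr (.mark 1) (by simp [Cmd.All, Op.keepsArr, passCmd, searchCmd, scanCmd])
  have o₃ := hf₃.out (by simp [Cmd.All, Op.keepsOut, passCmd, searchCmd, scanCmd])
  simp only [kr₂, ne_eq, reduceCtorEq, not_false_eq_true, Reg.len.injEq, Fin.reduceEq] at one₃ cnt₃ num₃ len₃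
  simp only [ka₂, ne_eq, reduceCtorEq, not_false_eq_true] at tgt₃ nxt₃ head₃ mk₃
  clear hf₂ hf₃
  rw [wp_seq]
  refine (wp_pushCmd (by simp) (one₃.trans hg₁.one) hst₃ (by omega)).frame.mono ?_
  rintro T₄ σ₄ ⟨⟨rfl, hst₄⟩, hf₄⟩
  have kr₄ : ∀ r, r ≠ .len 1 → σ₄.reg r = σ₃.reg r := fun r h =>
    hf₄.reg r (by simp [Cmd.All, Op.keepsReg, pushCmd, h])
  have ka₄ : ∀ a, a ≠ .lst 1 → σ₄.arr a = σ₃.arr a := fun a h =>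
    hf₄.arr a (by simp [Cmd.All, Op.keepsArr, pushCmd, h])
  have o₄ := hf₄.out (by simp [Cmd.All, Op.keepsOut, pushCmd])
  rw [num₃, n₁] at hst₄
  have hl₁ := length_roots_le (EdgeReach E) [] (n :: cs)
  rw [List.length_cons] at hl₁
  have hl₂ := length_roots_le (EdgeReach E) [n] (roots (EdgeReach E) [] (n :: cs)).reverse
  rw [List.length_reverse] at hl₂
  rw [wp_seq]
  refine (wp_passCmd (E := E) (N := n + 1) (c₀ := 14 * n + 20) (by simp) hEn ?_
    (hg₁.congr (by simp [kr₄, one₃]) (by simp [kr₄, cnt₃]) (by simp [ka₄, tgt₃])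
      (by simp [ka₄, nxt₃]) (by simp [ka₄, head₃])) hst₄
    (by simp [kr₄, len₃, l₂]) (by simp [kr₄, top₃]) (by simp [ka₄, mk₃, mk₁])
    (by simp only [List.length_cons, List.length_reverse]; omega)).frame.mono ?_
  · intro v hv
    rcases List.mem_cons.1 hv with rfl | hv
    · exact Nat.lt_succ_self _
    · exact hcsn v ((roots_sublist _ _ _).subset (List.mem_reverse.1 hv))
  rintro T₅ σ₅ ⟨⟨hT₅, -, hst₅⟩, hf₅⟩
  have one₅ := hf₅.reg .one (by simp [Cmd.All, Op.keepsReg, passCmd, searchCmd, scanCmd])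
  have o₅ := hf₅.out (by simp [Cmd.All, Op.keepsOut, passCmd, searchCmd, scanCmd])
  -- With nothing before it, the auxiliary vertex at the head is always kept, and so it lies at the
  -- bottom of the resulting stack.
  rw [roots, if_neg (by simp), List.reverse_cons] at hst₅
  refine (wp_writeCmd (by rw [one₅, kr₄ _ (by simp), one₃, hg₁.one]) hst₅ ?_).mono ?_
  · rw [List.length_reverse]; omega
  rintro T₆ σ₆ h₆
  exact ⟨us, cs, E, hnd, hus, hE, hcs, by rw [h₆, o₅, o₄, o₃, o₂, ho₁]⟩

/-! ### Correctness of the recovery program -/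

theorem not_rel_of_mem_roots {r : ℕ → ℕ → Prop} {prev l : List ℕ} {u v : ℕ}
    (hv : v ∈ roots r prev l) (hu : u ∈ prev) : ¬ r u v := by
  induction l generalizing prev with
  | nil => simp [roots] at hv
  | cons w l ih =>
    rw [roots] at hv
    split_ifs at hv with h
    · exact ih hv (List.mem_cons_of_mem _ hu)
    · rcases List.mem_cons.1 hv with rfl | hv
      · exact fun huv => h ⟨u, hu, huv⟩
      · exact ih hv (List.mem_cons_of_mem _ hu)

theorem pairwise_roots (r : ℕ → ℕ → Prop) (prev l : List ℕ) :
    (roots r prev l).Pairwise fun x y => ¬ r x y := by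
  induction l generalizing prev with
  | nil => simp [roots]
  | cons w l ih =>
    rw [roots]
    split_ifs
    · exact ih _
    · exact List.pairwise_cons.2 ⟨fun v hv => not_rel_of_mem_roots hv (by simp), ih _⟩

/-- A rejected element is related to an earlier one that may itself have been rejected; transitivity
traces it back to a kept element or to `prev`. -/
theorem exists_rel_of_mem {r : ℕ → ℕ → Prop} (hr : ∀ x, r x x) (ht : ∀ x y z, r x y → r y z → r x z)
    {prev l : List ℕ} {v : ℕ} (hv : v ∈ l) : ∃ u, (u ∈ prev ∨ u ∈ roots r prev l) ∧ r u v := by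
  induction l generalizing prev with
  | nil => simp at hv
  | cons w l ih =>
    rw [roots]
    have key : ∀ u, r u w → ∀ z, (z ∈ w :: prev ∨ z ∈ roots r (w :: prev) l) → r z v →
        (z ∈ prev ∨ z ∈ roots r (w :: prev) l) ∧ r z v ∨ r u v := by
      rintro u huw z hz hzv
      rcases hz with hz | hz
      · rcases List.mem_cons.1 hz with rfl | hz
        · exact Or.inr (ht _ _ _ huw hzv)
        · exact Or.inl ⟨Or.inl hz, hzv⟩
      · exact Or.inl ⟨Or.inr hz, hzv⟩
    split_ifs with h
    · obtain ⟨u, hu, huw⟩ := h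
      rcases List.mem_cons.1 hv with rfl | hv
      · exact ⟨u, Or.inl hu, huw⟩
      · obtain ⟨z, hz, hzv⟩ := ih (prev := w :: prev) hv
        rcases key u huw z hz hzv with h | h
        · exact ⟨z, h⟩
        · exact ⟨u, Or.inl hu, h⟩
    · rcases List.mem_cons.1 hv with rfl | hv
      · exact ⟨v, Or.inr (by simp), hr v⟩
      · obtain ⟨z, hz, hzv⟩ := ih (prev := w :: prev) hv
        rcases key w (hr w) z hz hzv with h | h
        · exact ⟨z, h.1.imp_right (List.mem_cons_of_mem _), h.2⟩
        · exact ⟨w, Or.inr (by simp), h⟩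

/-- Two passes of root selection, the second one in reverse order, leave an antichain that still
reaches everything. -/
theorem roots_reverse_roots {r : ℕ → ℕ → Prop} (hr : ∀ x, r x x)
    (ht : ∀ x y z, r x y → r y z → r x z) (n : ℕ) (l : List ℕ) :
    let K := roots r [n] (roots r [] (n :: l)).reverse
    (∀ k ∈ K, k ∈ l ∧ ¬ r n k) ∧ (∀ x ∈ K, ∀ y ∈ K, r x y → x = y) ∧ K.Nodup ∧
      ∀ v ∈ l, r n v ∨ ∃ k ∈ K, r k v := by
  intro K
  have hsub : K.Sublist (roots r [] (n :: l)).reverse := roots_sublist _ _ _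
  have hnot : ∀ k ∈ K, ¬ r n k := fun k hk => not_rel_of_mem_roots hk (by simp)
  -- The second pass excludes relations from earlier to later entries of the reversed list, and the
  -- first pass had excluded those in the other direction.
  have hpair : K.Pairwise fun x y => ¬ r x y ∧ ¬ r y x :=
    (pairwise_roots r [n] _).and
      ((List.pairwise_reverse.2 (pairwise_roots r [] (n :: l))).sublist hsub)
  refine ⟨fun k hk => ⟨?_, hnot k hk⟩, fun x hx y hy hxy => ?_, ?_, fun v hv => ?_⟩
  · have := (roots_sublist _ _ _).subset (List.mem_reverse.1 (hsub.subset hk))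
    rcases List.mem_cons.1 this with rfl | h
    · exact absurd (hr k) (hnot k hk)
    · exact h
  · by_contra hne
    have hsymm : Std.Symm fun x y => ¬ r x y ∧ ¬ r y x := ⟨fun _ _ h => ⟨h.2, h.1⟩⟩
    exact (hpair.forall hx hy hne).1 hxy
  · refine hpair.imp fun {a b} h he => h.1 ?_
    rw [he]
    exact hr b
  · obtain ⟨u, hu, huv⟩ := exists_rel_of_mem hr ht (prev := []) (List.mem_cons_of_mem n hv)
    have hu : u ∈ (roots r [] (n :: l)).reverse := by simpa using hu
    obtain ⟨w, hw, hwu⟩ := exists_rel_of_mem hr ht (prev := [n]) hu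
    rcases hw with hw | hw
    · exact Or.inl (List.mem_singleton.1 hw ▸ ht _ _ _ hwu huv)
    · exact Or.inr ⟨w, hw, ht _ _ _ hwu huv⟩

/-- Pairs of elements of `Fin n` as pairs of numbers. -/
def valPair {n : ℕ} (p : Fin n × Fin n) : ℕ × ℕ := (p.1, p.2)

theorem mem_map_valPair {n : ℕ} {l : List (Fin n × Fin n)} {i j : Fin n} :
    ((i : ℕ), (j : ℕ)) ∈ l.map valPair ↔ (i, j) ∈ l := by
  simp [valPair, Fin.val_inj]

theorem encodeInput_eq {n : ℕ} (entries : List (Fin n × Fin n)) (forbidden : List (Fin n))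
    (matching : List (Fin n × Fin n)) : encodeInput entries forbidden matching =
      [n, (entries.map valPair).length, (forbidden.map Fin.val).length,
        (matching.map valPair).length] ++ flatPairs (entries.map valPair) ++
        forbidden.map Fin.val ++ flatPairs (matching.map valPair) := by
  simp [encodeInput, flattenPairs, flatPairs, valPair, List.flatMap_map]

section Recovery

variable {n : ℕ} {A : Matrix (Fin n) (Fin n) ℝ} {F : Finset (Fin n)} {M : Finset (Fin n × Fin n)}
  {entries matching : List (Fin n × Fin n)} {forbidden : List (Fin n)}

/-- The vertices that are written by the program form an optimal set. -/
theorem isOptimal_of_output (hsolv : ProblemSolvable A F)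
    (hM : IsMinCostAllowedMatching (adjacencyGraph A) F M)
    (he : IsListing entries {p | A p.1 p.2 ≠ 0}) (hf : IsListing forbidden (F : Set (Fin n)))
    (hm : IsListing matching (M : Set (Fin n × Fin n))) {us cs : List ℕ} {E : List (ℕ × ℕ)}
    (hnd : us.Nodup) (hus : ∀ v, v ∈ us ↔ v < n ∧ v ∉ (matching.map valPair).map Prod.snd)
    (hE : ∀ e, e ∈ E ↔ e.swap ∈ entries.map valPair ∨ e.1 = n ∧ e.2 ∈ us)
    (hcs : ∀ v, v ∈ cs ↔ v < n ∧ v ∉ forbidden.map Fin.val) :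
    ∃ L : List (Fin n), L.Nodup ∧ IsOptimal A F L.toFinset ∧
      L.map Fin.val = us ++
        (roots (EdgeReach E) [n] (roots (EdgeReach E) [] (n :: cs)).reverse).reverse := by
  obtain ⟨hKcs, hanti, hKnd, hcov⟩ := roots_reverse_roots (r := EdgeReach E) (fun _ => .refl)
    (fun _ _ _ h h' => h.trans h') n cs
  set K := roots (EdgeReach E) [n] (roots (EdgeReach E) [] (n :: cs)).reverse with hK
  have hadj : ∀ i j : Fin n, (adjacencyGraph A).Adj i j ↔ ((i : ℕ), (j : ℕ)) ∈ E := by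
    intro i j
    rw [hE]
    have h1 : ((i : ℕ), (j : ℕ)).swap ∈ entries.map valPair ↔ (j, i) ∈ entries := mem_map_valPair
    have h2 : ¬ ((i : ℕ) = n) := i.2.ne
    rw [h1, he.2]
    simp [h2, adjacencyGraph]
  have hreach : ∀ i j : Fin n, Relation.ReflTransGen (adjacencyGraph A).Adj i j → EdgeReach E i j := by
    intro i j h
    induction h with
    | refl => exact .refl
    | tail _ h ih => exact ih.tail (mem_adj.2 ((hadj _ _).1 h))
  -- No edge enters the auxiliary vertex, so paths from genuine vertices stay in the graph.
  have hreach' : ∀ (i : Fin n) (y : ℕ), EdgeReach E i y → ∃ j : Fin n, (j : ℕ) = y ∧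
      Relation.ReflTransGen (adjacencyGraph A).Adj i j := by
    intro i y h
    induction h with
    | refl => exact ⟨i, rfl, .refl⟩
    | @tail b c _ hbc ih =>
      obtain ⟨j, rfl, hj⟩ := ih
      have hbc := mem_adj.1 hbc
      have hc : c < n := by
        rcases (hE _).1 hbc with h | h
        · simp only [valPair, List.mem_map, Prod.swap_prod_mk, Prod.mk.injEq] at h
          obtain ⟨a, -, h, -⟩ := h
          exact h ▸ a.1.2
        · exact absurd h.1 j.2.ne
      exact ⟨⟨c, hc⟩, rfl, hj.tail ((hadj j ⟨c, hc⟩).2 hbc)⟩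
  have hsuper : ∀ u ∈ us, EdgeReach E n u := fun u hu =>
    .single (mem_adj.2 ((hE _).2 (Or.inr ⟨rfl, hu⟩)))
  have hsuper' : ∀ v : Fin n, EdgeReach E n v → ∃ u ∈ us, EdgeReach E u v := by
    intro v h
    rcases Relation.ReflTransGen.cases_head h with h | ⟨u, hu, huv⟩
    · exact absurd h.symm v.2.ne
    · rcases (hE _).1 (mem_adj.1 hu) with h | h
      · simp only [valPair, List.mem_map, Prod.swap_prod_mk, Prod.mk.injEq] at h
        obtain ⟨a, -, -, h⟩ := h
        exact absurd h a.2.2.ne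
      · exact ⟨u, h.2, huv⟩
  have husn : ∀ u ∈ us, u < n := fun u hu => ((hus u).1 hu).1
  have hKn : ∀ k ∈ K.reverse, k < n := fun k hk => ((hcs k).1 (hKcs k (List.mem_reverse.1 hk)).1).1
  let Ul : List (Fin n) := us.pmap Fin.mk husn
  let Kl : List (Fin n) := K.reverse.pmap Fin.mk hKn
  have hUl : ∀ v : Fin n, v ∈ Ul.toFinset ↔ (v : ℕ) ∈ us := by
    intro v
    simp only [Ul, List.mem_toFinset, List.mem_pmap]
    exact ⟨fun ⟨a, ha, h⟩ => h ▸ ha, fun h => ⟨v, h, rfl⟩⟩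
  have hKl : ∀ v : Fin n, v ∈ Kl.toFinset ↔ (v : ℕ) ∈ K := by
    intro v
    simp only [Kl, List.mem_toFinset, List.mem_pmap, List.mem_reverse]
    exact ⟨fun ⟨a, ha, h⟩ => h ▸ ha, fun h => ⟨v, h, rfl⟩⟩
  have hdisj : ∀ v ∈ us, v ∉ K := fun v hv hvK => (hKcs v hvK).2 (hsuper v hv)
  have hmap : (Ul ++ Kl).map Fin.val = us ++ K.reverse := by
    simp [Ul, Kl, List.map_pmap]
  refine ⟨Ul ++ Kl, ?_, ?_, hmap⟩
  · apply List.Nodup.of_map Fin.val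
    rw [hmap]
    refine List.nodup_append.2 ⟨hnd, List.nodup_reverse.2 hKnd, fun a ha b hb hab => ?_⟩
    exact hdisj a ha (hab ▸ List.mem_reverse.1 hb)
  · rw [List.toFinset_append]
    refine isOptimal_union hM (fun v => ?_) ?_ (fun v => ?_) (fun i hi k hk hik => ?_) ?_
    · rw [hUl, hus]
      simp only [v.2, true_and, List.map_map, List.mem_map, not_exists, not_and, unmatched,
        Function.comp, valPair]
      constructor
      · exact fun h e heM hev => h e ((hm.2 e).2 heM) (congrArg Fin.val hev)
      · exact fun h e heM hev => h e ((hm.2 e).1 heM) (Fin.ext hev)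
    · rw [Finset.disjoint_left]
      intro v hv hvF
      have := ((hcs v).1 (hKcs v ((hKl v).1 hv)).1).2
      exact this (List.mem_map_of_mem ((hf.2 v).2 hvF))
    -- Solvability puts a vertex outside `F` in every source component, so those vertices reach
    -- everything. It remains to reach each of them from the output; a path from the auxiliary
    -- vertex passes through an unmatched one.
    · obtain ⟨w, hw, hwv⟩ := reaches_of_source (G := adjacencyGraph A) (J := {v | v ∉ F})
        (fun c hc => by
          obtain ⟨v, hv, hvF⟩ := (problemSolvable_iff.1 hsolv).2 c hc
          exact ⟨v, hvF, hv⟩) v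
      have hwcs : (w : ℕ) ∈ cs := by
        rw [hcs]
        refine ⟨w.2, fun h => hw ?_⟩
        obtain ⟨x, hx, hxw⟩ := List.mem_map.1 h
        exact Fin.ext hxw ▸ (hf.2 x).1 hx
      obtain ⟨i, hi, hiw⟩ : ∃ i : Fin n, i ∈ Ul.toFinset ∪ Kl.toFinset ∧ EdgeReach E i w := by
        rcases hcov w hwcs with h | ⟨k, hk, hkw⟩
        · obtain ⟨u, hu, huw⟩ := hsuper' w h
          exact ⟨⟨u, husn u hu⟩, Finset.mem_union_left _ ((hUl _).2 hu), huw⟩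
        · exact ⟨⟨k, hKn k (List.mem_reverse.2 hk)⟩, Finset.mem_union_right _ ((hKl _).2 hk), hkw⟩
      obtain ⟨j, hj, hij⟩ := hreach' i w hiw
      exact ⟨i, hi, (Fin.ext hj ▸ hij : Relation.ReflTransGen _ i w).trans hwv⟩
    · have hkK := (hKl k).1 hk
      rcases Finset.mem_union.1 hi with h | h
      · exact absurd ((hsuper i ((hUl i).1 h)).trans (hreach i k hik)) (hKcs k hkK).2
      · exact Fin.ext (hanti i ((hKl i).1 h) k hkK (hreach i k hik))
    · rw [Finset.disjoint_left]
      intro v hv hvK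
      exact hdisj v ((hUl v).1 hv) ((hKl v).1 hvK)

theorem IsListing.length_eq_numNonzero (he : IsListing entries {p | A p.1 p.2 ≠ 0}) :
    entries.length = numNonzero A := by
  have : {p : Fin n × Fin n | A p.1 p.2 ≠ 0} = (entries.toFinset : Set (Fin n × Fin n)) := by
    ext p; simpa using (he.2 p).symm
  rw [numNonzero, this, Set.ncard_coe_finset, List.toFinset_card_of_nodup he.1]

/-- Every vertex is an endpoint of an edge, and an edge has two endpoints. -/
theorem le_two_mul_length_of_not_isIsolated (hiso : ∀ v, ¬ IsIsolated (adjacencyGraph A) v)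
    (he : IsListing entries {p | A p.1 p.2 ≠ 0}) : n ≤ 2 * entries.length := by
  have hsub : (Finset.univ : Finset (Fin n)) ⊆
      (entries.map Prod.fst ++ entries.map Prod.snd).toFinset := by
    intro v _
    have hv := hiso v
    simp only [IsIsolated, not_forall, not_and_or, not_not] at hv
    rw [List.mem_toFinset, List.mem_append]
    obtain ⟨w, hw | hw⟩ := hv
    · exact Or.inr (List.mem_map.2 ⟨(w, v), (he.2 _).2 hw, rfl⟩)
    · exact Or.inl (List.mem_map.2 ⟨(v, w), (he.2 _).2 hw, rfl⟩)
  have h1 := (Finset.card_le_card hsub).trans (List.toFinset_card_le _)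
  simp only [Finset.card_univ, Fintype.card_fin, List.length_append, List.length_map] at h1
  omega

theorem length_matching_le (hM : IsMatching (adjacencyGraph A) M)
    (he : IsListing entries {p | A p.1 p.2 ≠ 0}) (hm : IsListing matching (M : Set (Fin n × Fin n))) :
    matching.length ≤ entries.length := by
  have h1 : (matching.map Prod.swap).Nodup := hm.1.map Prod.swap_injective
  have h2 : matching.map Prod.swap ⊆ entries := by
    intro e he'
    obtain ⟨d, hd, rfl⟩ := List.mem_map.1 he'
    exact (he.2 _).2 (hM.1 d ((hm.2 d).1 hd))
  simpa using (h1.subperm h2).length_le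

end Recovery

end MinStructControl

/-! ### Assembly of the main theorem -/

open MinStructControl
theorem mainTheorem2 :
    (∀ (n : ℕ) (A : Matrix (Fin n) (Fin n) ℝ) (F : Finset (Fin n)),
      (∀ v, ¬ IsIsolated (adjacencyGraph A) v) →
        (ProblemSolvable A F ↔
          (∃ M, IsAllowedMatching (adjacencyGraph A) F M) ∧
          (∀ c, IsSourceSCC (adjacencyGraph A) c → ∃ v, sccOf (adjacencyGraph A) v = c ∧ v ∉ F)) ∧
        ((∀ c, IsSourceSCC (adjacencyGraph A) c → ∃ v, sccOf (adjacencyGraph A) v = c ∧ v ∉ F) →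
          optimalValue A F = minMatchingCost (adjacencyGraph A) F)) ∧
    (∃ (P : List Instr) (C : ℕ),
      ∀ (n : ℕ) (A : Matrix (Fin n) (Fin n) ℝ) (F : Finset (Fin n)) (M : Finset (Fin n × Fin n))
        (entries : List (Fin n × Fin n)) (forbidden : List (Fin n))
        (matching : List (Fin n × Fin n)),
        (∀ v, ¬ IsIsolated (adjacencyGraph A) v) →
        ProblemSolvable A F →
        IsMinCostAllowedMatching (adjacencyGraph A) F M →
        IsListing entries {p | A p.1 p.2 ≠ 0} →
        IsListing forbidden (F : Set (Fin n)) →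
        IsListing matching (M : Set (Fin n × Fin n)) →
        ∃ (t : ℕ) (L : List (Fin n)),
          t ≤ C * max 1 (numNonzero A) ∧
          L.Nodup ∧ IsOptimal A F L.toFinset ∧
          HaltsWith P (encodeInput entries forbidden matching) t (L.map Fin.val)) := by
  refine ⟨fun n A F _ => ⟨problemSolvable_iff, optimalValue_eq_minMatchingCost⟩,
    -- The time is at most `214 * m + 513 * n + 500`, since the matching has at most `m` edges and
    -- `F` at most `n` elements. With `n ≤ 2 * m` this is at most `1740 * max 1 m`.
    recoverCmd.code 0, 2000, ?_⟩
  intro n A F M entries forbidden matching hiso hsolv hM he hf hm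
  obtain ⟨t, σ, hexec, ht, us, cs, E, hnd, hus, hE, hcs, hout⟩ := wp_recoverCmd (n := n)
    (es := entries.map valPair) (ms := matching.map valPair) (fs := forbidden.map Fin.val)
    (by
      intro e he
      obtain ⟨p, -, rfl⟩ := List.mem_map.1 he
      exact ⟨p.1.2, p.2.2⟩) le_rfl
  obtain ⟨L, hL, hopt, hLout⟩ := isOptimal_of_output hsolv hM he hf hm hnd hus hE hcs
  refine ⟨t, L, ?_, hL, hopt, ?_⟩
  · have h1 := le_two_mul_length_of_not_isIsolated hiso he
    have h2 := length_matching_le hM.1.1 he hm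
    have h3 := hf.1.length_le_card
    rw [Fintype.card_fin] at h3
    simp only [List.length_map] at ht
    rw [← he.length_eq_numNonzero]
    have h4 := le_max_left 1 entries.length
    have h5 := le_max_right 1 entries.length
    linarith
  · rw [encodeInput_eq, hLout, ← hout]
    exact hexec.haltsWith
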